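/- Let $M$ be the square-tiled surface obtained from 24 unit squares labelled $1,\dots,24$ by gluing the right side of square $i$ to the left side of square $h(i)$ and the top side of square $i$ to the bottom side of square $v(i)$ by translations, where $$h=(1,2,3,4,5,6)(7,8,9,10,11,12)(13,14,15,16,17,18)(19,20,21,22,23,24),$$ $$v=(1,7,13,11,3,21)(2,20,14,12,18,22)(4,10,16,8,6,24)(5,23,17,9,15,19)$$ (this is the square-tiled form of the translation 2-cover of the mutetrahedron). Let $p\colon M\to\mathbb T^2=\mathbb R^2/\mathbb Z^2$ be the covering that is the identity on each square, and $\omega=p^*(dz)$. Let $\mathrm{Aff}(M)$ be the group of homeomorphisms of $M$ that are affine in the local coordinates of $\omega$ with a constant derivative in $\mathrm{SL}(2,\mathbb R)$, let $\mathrm{SL}(M)$ be the group of these derivatives (the Veech group), and let $\mathrm{Aut}(M)=\{f : p\circ f=p\}\subset\mathrm{Aff}(M)$. Let $H_1^{(0)}(M)=\{\gamma\in H_1(M;\mathbb R):\int_\gamma\omega=0\}$, let $\alpha\colon\mathrm{Aff}(M)\to\mathrm{GL}(H_1^{(0)}(M))$ be the action on this zero-holonomy subspace, and call $\alpha(\mathrm{Aff}(M))$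 the Kontsevich–Zorich monodromy group of $M$. Put $T=\begin{pmatrix}1&1\\0&1\end{pmatrix}$ and $S=\begin{pmatrix}1&0\\1&1\end{pmatrix}$. For a square $i$ let $\sigma_i$ and $\zeta_i$ be the classes in $H_1(M;\mathbb R)$ of the closed straight curves that start at the midpoint of the bottom side of square $i$ and have holonomy $(2,2)$ and $(-4,2)$, respectively, and put $\Sigma_i=\sigma_i-\sigma_8$, $Z_i=\zeta_i-\zeta_8$. Then $\mathrm{SL}(M)=\langle S^{-1}T,\ TST^{-1}\rangle$, the elements $\Sigma_1,\Sigma_3,\Sigma_4,\Sigma_6,Z_1,Z_3,Z_4,Z_6$ form a basis of $H_1^{(0)}(M)$, and there are $\varphi,\psi\in\mathrm{Aff}(M)$ with derivatives $S^{-1}T$ and $TST^{-1}$ such that, with respect to this ordered basis (columns are the coordinates of the images), $$\alpha(\varphi)=\begin{pmatrix} 0&0&0&0&0&0&-1&0\\ 0&0&0&0&-1&-1&-1&-1\\ 0&0&0&0&0&0&1&1\\ 0&0&0&0&1&0&1&0\\ 0&0&-1&0&1&0&1&1\\ 0&1&0&0&0&0&-1&0\\ 1&0&1&0&-1&-1&-1&-1\\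 0&0&0&1&0&1&1&1\end{pmatrix},\qquad \alpha(\psi)=\begin{pmatrix} 1&0&1&0&-1&0&-1&0\\ 0&1&0&0&0&-1&-1&-1\\ 0&0&-1&0&1&-1&1&2\\ 0&0&0&1&0&0&1&0\\ 0&0&0&0&0&0&-1&-1\\ 0&0&0&0&1&1&1&1\\ 0&0&0&0&0&0&1&0\\ 0&0&0&0&-1&0&-1&0\end{pmatrix},$$ and up to the action of $\mathrm{Aut}(M)$ these two matrices generate the Kontsevich–Zorich monodromy group of $M$: the group $\alpha(\mathrm{Aff}(M))$ is generated by $\alpha(\varphi)$, $\alpha(\psi)$ and $\alpha(\mathrm{Aut}(M))$. -/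

import Mathlib

open unitInterval Topology Matrix

namespace SquareTiled

noncomputable section

section Affine
variable {Y : Type*} [TopologicalSpace Y]

/-- The projection of the plane onto the torus `𝕋² = (ℝ/ℤ)²`. -/
def torusMk (u : Fin 2 → ℝ) : Fin 2 → UnitAddCircle := fun k => (u k : UnitAddCircle)

lemma continuous_torusMk : Continuous torusMk :=
  continuous_pi fun k => (AddCircle.continuous_mk' 1).comp (continuous_apply k)

lemma torusMk_add (u v : Fin 2 → ℝ) : torusMk (u + v) = torusMk u + torusMk v := rfl

lemma torusMk_sub (u v : Fin 2 → ℝ) : torusMk (u - v) = torusMk u - torusMk v := rfl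

lemma eventually_sub_eq {a b : Y → Fin 2 → ℝ} {y₀ : Y} (ha : ContinuousAt a y₀)
    (hb : ContinuousAt b y₀) (hab : ∀ᶠ y in 𝓝 y₀, torusMk (a y) = torusMk (b y)) :
    ∀ᶠ y in 𝓝 y₀, a y - b y = a y₀ - b y₀ := by
  have key : ∀ k, ∀ᶠ y in 𝓝 y₀, (a y - b y) k = (a y₀ - b y₀) k := by
    intro k
    have hc : ContinuousAt (fun y => (a y - b y) k) y₀ :=
      ((continuous_apply k).continuousAt).comp (ha.sub hb)
    have h1 := hc.eventually (Metric.ball_mem_nhds _ one_pos)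
    have h0 := hab.self_of_nhds
    filter_upwards [h1, hab] with y hy hy'
    have e1 := congrFun hy' k
    have e0 := congrFun h0 k
    simp only [torusMk] at e1 e0
    obtain ⟨m, hm⟩ := (QuotientAddGroup.eq_iff_sub_mem.mp e1)
    obtain ⟨m', hm'⟩ := (QuotientAddGroup.eq_iff_sub_mem.mp e0)
    simp only [Real.dist_eq, Pi.sub_apply] at hy ⊢
    simp only [zsmul_eq_mul, mul_one] at hm hm'
    rw [← hm, ← hm'] at hy ⊢
    have : |m - m'| < 1 := by exact_mod_cast hy
    have := Int.abs_lt_one_iff.mp this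
    have : m = m' := by omega
    rw [this]
  have := Filter.eventually_all.mpr key
  filter_upwards [this] with y hy
  exact funext hy

end Affine

/-- A square-tiled surface with `n` unit squares: the right side of square `i` is glued to the left
side of square `h i`, the top of square `i` to the bottom of square `v i`. -/
structure Origami (n : ℕ) where
  h : Equiv.Perm (Fin n)
  v : Equiv.Perm (Fin n)

namespace Origami
variable {n : ℕ} (O : Origami n)

/-- The elementary identifications of boundary points of the squares `{i} × [0,1] × [0,1]`. -/
inductive Glue : Fin n × (I × I) → Fin n × (I × I) → Prop
  | right (i : Fin n) (y : I) : Glue (i, (1, y)) (O.h i, (0, y))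
  | top (i : Fin n) (x : I) : Glue (i, (x, 1)) (O.v i, (x, 0))

/-- The square-tiled surface as a topological space, the quotient of the disjoint union of the squares. -/
def Surface : Type := Quot O.Glue

instance : TopologicalSpace O.Surface := inferInstanceAs (TopologicalSpace (Quot O.Glue))

/-- The point of the surface with coordinates `(x, y)` in the square `i`. -/
def pt (i : Fin n) (x y : I) : O.Surface := Quot.mk _ (i, (x, y))

/-- The branched covering `p` of the torus; the translation structure is `ω = p^*(dz)`. -/
def proj : O.Surface → Fin 2 → UnitAddCircle :=
  Quot.lift (fun q => torusMk ![q.2.1, q.2.2]) (by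
    rintro _ _ (⟨i, y⟩ | ⟨i, x⟩) <;> ext k <;> fin_cases k <;> simp [torusMk])

lemma continuous_proj : Continuous O.proj := by
  refine continuous_quot_lift _ (continuous_torusMk.comp (continuous_pi fun k => ?_))
  fin_cases k
  · exact continuous_subtype_val.comp (continuous_fst.comp continuous_snd)
  · exact continuous_subtype_val.comp (continuous_snd.comp continuous_snd)

/-- `f` is affine with derivative `A`: around every point `x` there is a local coordinate `z` of the
translation structure (a continuous local lift of `p` to the plane) in which `f` is `z ↦ A z + b`.
The matrix `A` does not depend on `x`, the vector `b` does. -/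
def IsAffine (f : O.Surface → O.Surface) (A : Matrix (Fin 2) (Fin 2) ℝ) : Prop :=
  ∀ x, ∃ U ∈ 𝓝 x, ∃ z : O.Surface → Fin 2 → ℝ, ContinuousOn z U ∧
    (∀ y ∈ U, O.proj y = torusMk (z y)) ∧
    ∃ b : Fin 2 → ℝ, ∀ y ∈ U, O.proj (f y) = torusMk (A *ᵥ z y + b)

lemma exists_coord (x : O.Surface) : ∃ U ∈ 𝓝 x, ∃ z : O.Surface → Fin 2 → ℝ, ContinuousOn z U ∧
    ∀ y ∈ U, O.proj y = torusMk (z y) := by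
  have h : ∀ k, ∃ e : OpenPartialHomeomorph ℝ UnitAddCircle, O.proj x k ∈ e.target ∧ ⇑e = ((↑) : ℝ → UnitAddCircle) := by
    intro k
    obtain ⟨r, hr⟩ := QuotientAddGroup.mk_surjective (O.proj x k)
    obtain ⟨e, he, he'⟩ := (AddCircle.isLocalHomeomorph_coe (1:ℝ)) r
    refine ⟨e, ?_, he'.symm⟩
    rw [← hr]
    have := e.map_source he
    rwa [← he'] at this
  choose e he he' using h
  refine ⟨⋂ k, (fun y => O.proj y k) ⁻¹' (e k).target, ?_, fun y k => (e k).symm (O.proj y k), ?_, ?_⟩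
  · refine Filter.iInter_mem.mpr fun k => ?_
    exact (((continuous_apply k).comp O.continuous_proj).continuousAt).preimage_mem_nhds
      ((e k).open_target.mem_nhds (he k))
  · refine continuousOn_pi.mpr fun k => ?_
    refine (e k).continuousOn_symm.comp (((continuous_apply k).comp O.continuous_proj).continuousOn) ?_
    intro y hy
    exact Set.mem_iInter.mp hy k
  · intro y hy
    ext k
    have := (e k).right_inv (Set.mem_iInter.mp hy k)
    rw [he' k] at this
    exact this.symm

lemma isAffine_id : O.IsAffine id 1 := by
  intro x
  obtain ⟨U, hU, z, hz, hp⟩ := O.exists_coord x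
  exact ⟨U, hU, z, hz, hp, 0, fun y hy => by simpa using hp y hy⟩

variable {O}

lemma IsAffine.comp {f g : O.Surface → O.Surface} {A B : Matrix (Fin 2) (Fin 2) ℝ}
    (hf : O.IsAffine f A) (hg : O.IsAffine g B) (hc : Continuous g) :
    O.IsAffine (f ∘ g) (A * B) := by
  intro x
  obtain ⟨U, hU, z, hz, hp, b, hb⟩ := hg x
  obtain ⟨V, hV, w, hw, hq, c, hc'⟩ := hf (g x)
  have hV' : g ⁻¹' V ∈ 𝓝 x := hc.continuousAt.preimage_mem_nhds hV
  have h1 : ContinuousAt (fun y => w (g y)) x :=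
    ContinuousAt.comp (hw.continuousAt hV) hc.continuousAt
  have hzx := hz.continuousAt hU
  have h2 : ContinuousAt (fun y => B *ᵥ z y + b) x := by
    refine ContinuousAt.add ?_ continuousAt_const
    exact (Continuous.matrix_mulVec continuous_const continuous_id).continuousAt.comp hzx
  have h3 := eventually_sub_eq h1 h2 (by
    filter_upwards [hU, hV'] with y hy hy'
    rw [← hb y hy, ← hq _ hy'])
  set m := w (g x) - (B *ᵥ z x + b)
  refine ⟨{y | w (g y) - (B *ᵥ z y + b) = m} ∩ (U ∩ g ⁻¹' V),
    Filter.inter_mem h3 (Filter.inter_mem hU hV'), z, hz.mono (fun y hy => hy.2.1),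
    fun y hy => hp y hy.2.1, A *ᵥ (b + m) + c, fun y hy => ?_⟩
  have e : w (g y) = B *ᵥ z y + b + m := by rw [← hy.1]; abel
  rw [Function.comp, hc' _ hy.2.2, e]
  simp only [Matrix.mulVec_add, Matrix.mulVec_mulVec, add_assoc]

lemma IsAffine.symm {f : O.Surface ≃ₜ O.Surface} {A B : Matrix (Fin 2) (Fin 2) ℝ}
    (hf : O.IsAffine f A) (hBA : B * A = 1) : O.IsAffine f.symm B := by
  intro x
  obtain ⟨U, hU, z, hz, hp, b, hb⟩ := hf (f.symm x)
  refine ⟨f.symm ⁻¹' U, f.symm.continuous.continuousAt.preimage_mem_nhds hU,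
    fun y => A *ᵥ z (f.symm y) + b, ?_, ?_, - B *ᵥ b, ?_⟩
  · refine ContinuousOn.add ?_ continuousOn_const
    refine (Continuous.matrix_mulVec continuous_const continuous_id).comp_continuousOn ?_
    exact hz.comp f.symm.continuous.continuousOn (fun y hy => hy)
  · intro y hy
    simpa using hb _ hy
  · intro y hy
    rw [hp _ hy]
    rw [Matrix.mulVec_add, Matrix.mulVec_mulVec, hBA, Matrix.neg_mulVec, Matrix.one_mulVec,
      add_neg_cancel_right]

lemma sl_inv_mul_coe (A : SpecialLinearGroup (Fin 2) ℝ) :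
    ((A⁻¹ : SpecialLinearGroup (Fin 2) ℝ) : Matrix (Fin 2) (Fin 2) ℝ) * (A : Matrix (Fin 2) (Fin 2) ℝ) = 1 := by
  exact congrArg Subtype.val (inv_mul_cancel A)

variable (O)

/-- The group of affine homeomorphisms with derivative in `SL(2, ℝ)`. -/
def affineGroup : Subgroup (O.Surface ≃ₜ O.Surface) where
  carrier := {f | ∃ A : SpecialLinearGroup (Fin 2) ℝ, O.IsAffine f A}
  one_mem' := ⟨1, O.isAffine_id⟩
  mul_mem' := by
    rintro f g ⟨A, hA⟩ ⟨B, hB⟩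
    exact ⟨A * B, hA.comp hB g.continuous⟩
  inv_mem' := by
    rintro f ⟨A, hA⟩
    exact ⟨A⁻¹, hA.symm (sl_inv_mul_coe A)⟩

/-- The Veech group: the derivatives, in `SL(2, ℝ)`, of the affine homeomorphisms. -/
def veechGroup : Subgroup (SpecialLinearGroup (Fin 2) ℝ) where
  carrier := {A | ∃ f : O.Surface ≃ₜ O.Surface, O.IsAffine f A}
  one_mem' := ⟨1, O.isAffine_id⟩
  mul_mem' := by
    rintro A B ⟨f, hA⟩ ⟨g, hB⟩
    exact ⟨f * g, hA.comp hB g.continuous⟩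
  inv_mem' := by
    rintro A ⟨f, hA⟩
    exact ⟨f⁻¹, hA.symm (sl_inv_mul_coe A)⟩

/-- The automorphism group: the homeomorphisms `f` with `p ∘ f = p`. -/
def automorphismGroup : Subgroup (O.Surface ≃ₜ O.Surface) where
  carrier := {f | ∀ x, O.proj (f x) = O.proj x}
  one_mem' _ := rfl
  mul_mem' {f g} hf hg x := (hf (g x)).trans (hg x)
  inv_mem' {f} hf x := by simpa using (hf (f⁻¹ x)).symm

end Origami

section Lift

lemma exists_lift_circle {A : Type*} [TopologicalSpace A] [ContractibleSpace A]
    (c : C(A, UnitAddCircle)) : ∃ u : C(A, ℝ), ∀ a, (u a : UnitAddCircle) = c a := by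
  obtain ⟨a₀, ⟨F⟩⟩ := id_nullhomotopic A
  obtain ⟨r, hr⟩ := QuotientAddGroup.mk_surjective (c a₀)
  have cov := AddCircle.isCoveringMap_coe (1 : ℝ)
  have h0 : ∀ a, (c.comp F.symm.toContinuousMap) (0, a) =
      ((ContinuousMap.const A r : C(A, ℝ)) a : UnitAddCircle) := by
    intro a
    change c (F.symm (0, a)) = _
    rw [F.symm.apply_zero]
    exact hr.symm
  refine ⟨(cov.liftHomotopy _ _ h0).comp ((ContinuousMap.const A 1).prodMk (.id A)), fun a => ?_⟩
  have := congrFun (cov.liftHomotopy_lifts _ _ h0) (1, a)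
  refine this.trans ?_
  change c (F.symm (1, a)) = _
  rw [F.symm.apply_one]
  rfl

lemma exists_lift {A : Type*} [TopologicalSpace A] [ContractibleSpace A]
    (c : C(A, Fin 2 → UnitAddCircle)) : ∃ u : C(A, Fin 2 → ℝ), ∀ a, torusMk (u a) = c a := by
  choose u hu using fun k => exists_lift_circle
    ((⟨fun w => w k, continuous_apply k⟩ : C(Fin 2 → UnitAddCircle, UnitAddCircle)).comp c)
  exact ⟨⟨fun a k => u k a, continuous_pi fun k => (u k).continuous⟩,
    fun a => funext fun k => hu k a⟩

instance : ContractibleSpace I :=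
  (convex_Icc (0 : ℝ) 1).contractibleSpace ⟨0, by simp⟩

instance {m : ℕ} : ContractibleSpace (stdSimplex ℝ (Fin (m + 1))) :=
  (convex_stdSimplex ℝ (Fin (m + 1))).contractibleSpace ⟨_, single_mem_stdSimplex ℝ 0⟩

lemma lift_sub_eq {A : Type*} [TopologicalSpace A] [PreconnectedSpace A] (u w : C(A, Fin 2 → ℝ))
    (h : ∀ a, torusMk (u a) = torusMk (w a)) (a a' : A) : u a - w a = u a' - w a' := by
  have : IsLocallyConstant fun a => u a - w a :=
    (IsLocallyConstant.iff_eventually_eq _).mpr fun a =>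
      eventually_sub_eq u.continuous.continuousAt w.continuous.continuousAt (.of_forall h)
  exact this.apply_eq_of_preconnectedSpace a a'

/-- The displacement `u 1 - u 0` of a lift `u` to the plane of a path in the torus. -/
def displacement (c : C(I, Fin 2 → UnitAddCircle)) : Fin 2 → ℝ :=
  (exists_lift c).choose 1 - (exists_lift c).choose 0

lemma displacement_eq (c : C(I, Fin 2 → UnitAddCircle)) (u : C(I, Fin 2 → ℝ))
    (hu : ∀ t, torusMk (u t) = c t) : displacement c = u 1 - u 0 := by
  have h := lift_sub_eq (exists_lift c).choose u
    (fun t => by rw [(exists_lift c).choose_spec t, hu t]) 1 0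
  rw [displacement, sub_eq_sub_iff_sub_eq_sub]
  exact h

end Lift
section Homology
open CategoryTheory AlgebraicTopology Simplicial Opposite
variable (X : Type) [TopologicalSpace X]

/-- The singular simplicial set of `X`. -/
abbrev singSet : SSet := TopCat.toSSet.obj (TopCat.of X)

/-- The singular chain complex of `X` with real coefficients. -/
abbrev chains : ChainComplex (ModuleCat ℝ) ℕ :=
  (singSet X).chainComplex (ModuleCat.of ℝ ℝ)

/-- The first singular homology group of `X` with real coefficients. -/
abbrev H₁ : ModuleCat ℝ := (singSet X).homology (ModuleCat.of ℝ ℝ) 1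

lemma H₁_eq : H₁ X =
    ((singularHomologyFunctor (ModuleCat ℝ) 1).obj (ModuleCat.of ℝ ℝ)).obj (TopCat.of X) := rfl

variable {X}

/-- The standard parametrization of the 1-simplex by the unit interval, from vertex 0 to vertex 1. -/
def edge : C(I, stdSimplex ℝ (Fin 2)) where
  toFun t := ⟨![1 - t, t], by
    constructor
    · intro i; fin_cases i
      · simpa using t.2.2
      · simpa using t.2.1
    · simp⟩
  continuous_toFun := by
    refine Continuous.subtype_mk (continuous_pi fun k => ?_) _
    fin_cases k <;> simp <;> fun_prop

/-- The inverse parametrization: the second barycentric coordinate on the 1-simplex. -/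
def coord : C(stdSimplex ℝ (Fin 2), I) where
  toFun s := ⟨s 1, stdSimplex.zero_le s 1, stdSimplex.le_one s 1⟩
  continuous_toFun := by
    refine Continuous.subtype_mk ((continuous_apply 1).comp continuous_subtype_val) _

lemma edge_zero : edge 0 = stdSimplex.vertex 0 := by
  refine Subtype.ext (funext fun k => ?_)
  fin_cases k <;> simp [edge]

lemma edge_one : edge 1 = stdSimplex.vertex 1 := by
  refine Subtype.ext (funext fun k => ?_)
  fin_cases k <;> simp [edge]

lemma coord_vertex_zero : coord (stdSimplex.vertex 0) = 0 := by
  ext; simp [coord]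

lemma coord_vertex_one : coord (stdSimplex.vertex 1) = 1 := by
  ext; simp [coord]

/-- A path regarded as a singular 1-simplex. -/
def simplexOfPath (γ : C(I, X)) : singSet X _⦋1⦌ :=
  ((TopCat.of X).toSSetObjEquiv (op ⦋1⦌)).symm (γ.comp coord)

/-- A singular 1-simplex regarded as a path. -/
def pathOfSimplex (s : singSet X _⦋1⦌) : C(I, X) :=
  ((TopCat.of X).toSSetObjEquiv (op ⦋1⦌) s).comp edge

/-- The singular 1-chain of a path (as the map sending a scalar `r` to `r` times the path). -/
def chainOfPath (γ : C(I, X)) : ModuleCat.of ℝ ℝ ⟶ (chains X).X 1 :=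
  (singSet X).ιChainComplex (simplexOfPath γ)

lemma chainOfPath_d {x : X} (γ : Path x x) :
    chainOfPath γ.toContinuousMap ≫ (chains X).d 1 0 = 0 := by
  refine ((singSet X).ιChainComplex_d (R := ModuleCat.of ℝ ℝ) (n := 0) _).trans ?_
  have e : (singSet X).δ 0 (simplexOfPath γ.toContinuousMap) =
      (singSet X).δ 1 (simplexOfPath γ.toContinuousMap) := by
    apply ((TopCat.of X).toSSetObjEquiv (op ⦋0⦌)).injective
    ext z
    change γ (coord (stdSimplex.map (Fin.succAbove 0) z)) =
      γ (coord (stdSimplex.map (Fin.succAbove 1) z))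
    have hz : z = stdSimplex.vertex (S := ℝ) (0 : Fin 1) := Subsingleton.elim (α := stdSimplex ℝ (Fin 1)) _ _
    subst hz
    erw [stdSimplex.map_vertex, stdSimplex.map_vertex]
    change γ (coord (stdSimplex.vertex 1)) = γ (coord (stdSimplex.vertex 0))
    rw [coord_vertex_zero, coord_vertex_one, γ.source, γ.target]
  simp [Fin.sum_univ_two, e]

/-- The homology class of a closed path. -/
def loopClass {x : X} (γ : Path x x) : H₁ X :=
  ((chains X).liftCycles (chainOfPath γ.toContinuousMap) 0 (by simp) (chainOfPath_d γ) ≫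
    (chains X).homologyπ 1).hom (1 : ℝ)

section Periods
variable {X : Type} [TopologicalSpace X] (p : C(X, Fin 2 → UnitAddCircle))

/-- Integration of the translation form over singular 1-chains, where `X` carries the form `p^*(dz)`
for a map `p` to the torus: a path is sent to the displacement of a lift of its image to the plane. -/
def periodChain : (chains X).X 1 ⟶ ModuleCat.of ℝ (Fin 2 → ℝ) :=
  ((singSet X).isColimitChainComplexXCofan (ModuleCat.of ℝ ℝ) 1).desc
    (Limits.Cofan.mk _ fun s => ModuleCat.ofHom
      (LinearMap.toSpanSingleton ℝ (Fin 2 → ℝ) (displacement (p.comp (pathOfSimplex s)))))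

lemma ι_periodChain (s : singSet X _⦋1⦌) :
    (singSet X).ιChainComplex s ≫ periodChain p = ModuleCat.ofHom
      (LinearMap.toSpanSingleton ℝ (Fin 2 → ℝ) (displacement (p.comp (pathOfSimplex s)))) :=
  ((singSet X).isColimitChainComplexXCofan (ModuleCat.of ℝ ℝ) 1).fac _ ⟨s⟩

lemma d_periodChain : (chains X).d 2 1 ≫ periodChain p = 0 := by
  refine SSet.chainComplex_hom_ext fun s => ?_
  refine (Category.assoc _ _ _).symm.trans ?_
  erw [(singSet X).ιChainComplex_d (R := ModuleCat.of ℝ ℝ) (n := 1) s]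
  obtain ⟨u, hu⟩ := exists_lift (A := stdSimplex ℝ (Fin 3))
    (p.comp ((TopCat.of X).toSSetObjEquiv (op ⦋2⦌) s))
  have hface : ∀ i : Fin 3, displacement (p.comp (pathOfSimplex ((singSet X).δ i s))) =
      u (stdSimplex.vertex (i.succAbove 1)) - u (stdSimplex.vertex (i.succAbove 0)) := by
    intro i
    rw [displacement_eq _ (u.comp ((⟨stdSimplex.map i.succAbove, stdSimplex.continuous_map _⟩ :
      C(stdSimplex ℝ (Fin 2), stdSimplex ℝ (Fin 3))).comp edge)) (fun t => hu _)]
    simp only [ContinuousMap.comp_apply, ContinuousMap.coe_mk, edge_zero, edge_one,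
      stdSimplex.map_vertex]
  have key : (∑ i : Fin 3, (-1 : ℤ) ^ (i : ℕ) •
      (singSet X).ιChainComplex (R := ModuleCat.of ℝ ℝ) ((singSet X).δ i s)) ≫ periodChain p = 0 := by
    rw [Preadditive.sum_comp]
    simp only [Preadditive.zsmul_comp, ι_periodChain, hface, Fin.sum_univ_three]
    ext
    simp only [Fin.isValue, Fin.val_zero, Fin.val_one, Fin.val_two, pow_zero, pow_one]
    simp
    exact sub_self _
  exact key.trans Limits.comp_zero.symm

/-- The map `γ ↦ ∫_γ p^*(dz)` on first homology. -/
def periods : H₁ X →ₗ[ℝ] (Fin 2 → ℝ) :=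
  ((chains X).homologyι 1 ≫
    (chains X).descOpcycles (periodChain p) 2 (by simp) (d_periodChain p)).hom

end Periods

section Functoriality
variable {X : Type} [TopologicalSpace X]

/-- The map induced on first homology by a continuous map. -/
def H₁map (f : C(X, X)) : H₁ X →ₗ[ℝ] H₁ X :=
  (SSet.homologyMap (TopCat.toSSet.map (TopCat.ofHom f)) (ModuleCat.of ℝ ℝ) 1).hom

lemma H₁map_id : H₁map (ContinuousMap.id X) = LinearMap.id := by
  have : TopCat.toSSet.map (TopCat.ofHom (ContinuousMap.id X)) = 𝟙 (singSet X) :=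
    TopCat.toSSet.map_id (TopCat.of X)
  rw [H₁map, this, SSet.homologyMap_id]
  rfl

lemma H₁map_comp (f g : C(X, X)) : H₁map (f.comp g) = H₁map f ∘ₗ H₁map g := by
  have : TopCat.toSSet.map (TopCat.ofHom (f.comp g)) =
      TopCat.toSSet.map (TopCat.ofHom g) ≫ TopCat.toSSet.map (TopCat.ofHom f) :=
    TopCat.toSSet.map_comp (TopCat.ofHom g) (TopCat.ofHom f)
  rw [H₁map, this, SSet.homologyMap_comp]
  rfl

lemma periods_H₁map (p : C(X, Fin 2 → UnitAddCircle)) (f : C(X, X))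
    (L : (Fin 2 → ℝ) →ₗ[ℝ] (Fin 2 → ℝ))
    (h : ∀ γ : C(I, X), displacement (p.comp (f.comp γ)) = L (displacement (p.comp γ)))
    (x : H₁ X) : periods p (H₁map f x) = L (periods p x) := by
  have hchain : (SSet.chainComplexMap (TopCat.toSSet.map (TopCat.ofHom f)) (ModuleCat.of ℝ ℝ)).f 1 ≫
      periodChain p = periodChain p ≫ ModuleCat.ofHom L := by
    refine SSet.chainComplex_hom_ext fun s => ?_
    rw [SSet.ι_chainComplexMap_f_assoc, ι_periodChain, reassoc_of% (ι_periodChain p s),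
      ← ModuleCat.ofHom_comp]
    congr 1
    ext1
    simp only [LinearMap.toSpanSingleton_apply, LinearMap.comp_apply, one_smul]
    exact h (pathOfSimplex s)
  have key : SSet.homologyMap (TopCat.toSSet.map (TopCat.ofHom f)) (ModuleCat.of ℝ ℝ) 1 ≫
      ((chains X).homologyι 1 ≫
        (chains X).descOpcycles (periodChain p) 2 (by simp) (d_periodChain p)) =
      ((chains X).homologyι 1 ≫
        (chains X).descOpcycles (periodChain p) 2 (by simp) (d_periodChain p)) ≫
        ModuleCat.ofHom L := by
    rw [← cancel_epi ((chains X).homologyπ 1)]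
    simp [hchain]
  exact congrArg (fun φ => φ.hom x) key

end Functoriality
end Homology

namespace Origami
variable {n : ℕ} {O : Origami n}

lemma IsAffine.displacement {f : C(O.Surface, O.Surface)} {A : Matrix (Fin 2) (Fin 2) ℝ}
    (hf : O.IsAffine f A) (γ : C(I, O.Surface)) :
    displacement ((⟨O.proj, O.continuous_proj⟩ : C(_, _)).comp (f.comp γ)) =
      A *ᵥ displacement ((⟨O.proj, O.continuous_proj⟩ : C(_, _)).comp γ) := by
  obtain ⟨u, hu⟩ := exists_lift ((⟨O.proj, O.continuous_proj⟩ : C(_, _)).comp γ)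
  obtain ⟨w, hw⟩ := exists_lift ((⟨O.proj, O.continuous_proj⟩ : C(_, _)).comp (f.comp γ))
  rw [displacement_eq _ u hu, displacement_eq _ w hw]
  have hA : Continuous fun v : Fin 2 → ℝ => A *ᵥ v :=
    Continuous.matrix_mulVec continuous_const continuous_id
  have hloc : IsLocallyConstant fun t => w t - A *ᵥ u t := by
    refine (IsLocallyConstant.iff_eventually_eq _).mpr fun t₀ => ?_
    obtain ⟨U, hU, z, hz, hp, b, hb⟩ := hf (γ t₀)
    have hU' : γ ⁻¹' U ∈ 𝓝 t₀ := γ.continuous.continuousAt.preimage_mem_nhds hU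
    have hzγ : ContinuousAt (fun t => z (γ t)) t₀ :=
      ContinuousAt.comp (hz.continuousAt hU) γ.continuous.continuousAt
    have h1 := eventually_sub_eq u.continuous.continuousAt hzγ (by
      filter_upwards [hU'] with t ht
      exact (hu t).trans (hp _ ht))
    have h2 := eventually_sub_eq w.continuous.continuousAt
      (b := fun t => A *ᵥ z (γ t) + b)
      ((hA.continuousAt.comp hzγ).add (continuousAt_const (y := b))) (by
      filter_upwards [hU'] with t ht
      exact (hw t).trans (hb _ ht))
    filter_upwards [h1, h2] with t ht1 ht2
    have e1 : u t = z (γ t) + (u t₀ - z (γ t₀)) := by rw [← ht1]; abel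
    have e2 : w t = A *ᵥ z (γ t) + b + (w t₀ - (A *ᵥ z (γ t₀) + b)) := by rw [← ht2]; abel
    rw [e1, e2, Matrix.mulVec_add, Matrix.mulVec_sub]
    abel
  have := hloc.apply_eq_of_preconnectedSpace 1 0
  rw [Matrix.mulVec_sub]
  rw [sub_eq_sub_iff_sub_eq_sub] at this
  exact this

variable (O)

/-- The covering of the torus as a bundled continuous map. -/
def projMap : C(O.Surface, Fin 2 → UnitAddCircle) := ⟨O.proj, O.continuous_proj⟩

/-- The holonomy `γ ↦ ∫_γ ω` on first homology, with values in the plane. -/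
def holonomy : H₁ O.Surface →ₗ[ℝ] (Fin 2 → ℝ) := periods O.projMap

/-- The zero-holonomy subspace of first homology. -/
def zeroHolonomy : Submodule ℝ (H₁ O.Surface) := LinearMap.ker O.holonomy

variable {O} in
lemma H₁map_mem_zeroHolonomy {f : O.Surface ≃ₜ O.Surface} (hf : f ∈ O.affineGroup)
    (x : H₁ O.Surface) (hx : x ∈ O.zeroHolonomy) : H₁map (f : C(O.Surface, O.Surface)) x ∈ O.zeroHolonomy := by
  obtain ⟨A, hA⟩ := hf
  have := periods_H₁map O.projMap (f : C(O.Surface, O.Surface)) (Matrix.mulVecLin A.1)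
    (fun γ => IsAffine.displacement (f := (f : C(O.Surface, O.Surface))) hA γ) x
  have hx' : periods O.projMap x = 0 := hx
  change periods O.projMap _ = 0
  rw [hx', map_zero] at this
  exact this

/-- The action of an affine homeomorphism on the zero-holonomy subspace, as an endomorphism. -/
def alphaEnd (f : O.affineGroup) : Module.End ℝ O.zeroHolonomy :=
  (H₁map (f.1 : C(O.Surface, O.Surface))).restrict (H₁map_mem_zeroHolonomy f.2)

lemma coe_alphaEnd (f : O.affineGroup) (x : O.zeroHolonomy) :
    (O.alphaEnd f x : H₁ O.Surface) = H₁map (f.1 : C(O.Surface, O.Surface)) x := rfl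

lemma alphaEnd_one : O.alphaEnd 1 = 1 := by
  refine LinearMap.ext fun x => Subtype.ext ?_
  exact LinearMap.congr_fun H₁map_id x.1

lemma alphaEnd_mul (f g : O.affineGroup) : O.alphaEnd (f * g) = O.alphaEnd f * O.alphaEnd g := by
  refine LinearMap.ext fun x => Subtype.ext ?_
  exact LinearMap.congr_fun (H₁map_comp (f.1 : C(O.Surface, O.Surface))
    (g.1 : C(O.Surface, O.Surface))) x.1

/-- The representation `α` of the affine group on the zero-holonomy subspace. -/
def alpha : O.affineGroup →* LinearMap.GeneralLinearGroup ℝ O.zeroHolonomy :=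
  MonoidHom.toHomUnits
    { toFun := O.alphaEnd, map_one' := O.alphaEnd_one, map_mul' := O.alphaEnd_mul }

lemma coe_alpha (f : O.affineGroup) (x : O.zeroHolonomy) :
    ((O.alpha f : Module.End ℝ O.zeroHolonomy) x : H₁ O.Surface) =
      H₁map (f.1 : C(O.Surface, O.Surface)) x := rfl

/-- The Kontsevich–Zorich monodromy group: the image of the affine group under `α`. -/
def kontsevichZorichGroup : Subgroup (LinearMap.GeneralLinearGroup ℝ O.zeroHolonomy) :=
  O.alpha.range

/-- The point `(1 - t) a + t b` of the unit interval. -/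
def lerp (a b t : I) : I :=
  ⟨(1 - t) * a + t * b, (convex_Icc (0 : ℝ) 1) a.2 b.2 (unitInterval.one_minus_nonneg t) t.2.1 (by ring)⟩

/-- The straight segment inside the square `i` from `(x₀, y₀)` to `(x₁, y₁)`. -/
def segment (i : Fin n) (x₀ y₀ x₁ y₁ : I) : Path (O.pt i x₀ y₀) (O.pt i x₁ y₁) where
  toFun t := O.pt i (lerp x₀ x₁ t) (lerp y₀ y₁ t)
  continuous_toFun := by
    refine continuous_quot_mk.comp (Continuous.prodMk continuous_const (Continuous.prodMk ?_ ?_)) <;>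
    · unfold lerp
      fun_prop
  source' := by simp [lerp]
  target' := by simp [lerp]

lemma pt_right (i : Fin n) (y : I) : O.pt i 1 y = O.pt (O.h i) 0 y := Quot.sound (.right i y)

lemma pt_top (i : Fin n) (x : I) : O.pt i x 1 = O.pt (O.v i) x 0 := Quot.sound (.top i x)

/-- The number `1/2`. -/
def half : I := ⟨1 / 2, by norm_num, by norm_num⟩
/-- The number `1/4`. -/
def quarter : I := ⟨1 / 4, by norm_num, by norm_num⟩
/-- The number `3/4`. -/
def threeQuarters : I := ⟨3 / 4, by norm_num, by norm_num⟩

/-- The midpoint of the bottom side of square `i`. -/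
def bot (i : Fin n) : O.Surface := O.pt i half 0

/-- The straight path with holonomy `(1, 1)` that starts at the midpoint of the bottom of square `i`. -/
def pathRight (i : Fin n) : Path (O.bot i) (O.bot (O.v (O.h i))) :=
  ((O.segment i half 0 1 half).cast rfl (O.pt_right i half).symm).trans
    ((O.segment (O.h i) 0 half half 1).cast rfl (O.pt_top (O.h i) half).symm)

/-- The straight path with holonomy `(-2, 1)` that starts at the midpoint of the bottom of square `i`. -/
def pathLeft (i : Fin n) : Path (O.bot i) (O.bot (O.v (O.h⁻¹ (O.h⁻¹ i)))) :=
  ((O.segment i half 0 0 quarter).trans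
    ((O.segment (O.h⁻¹ i) 1 quarter 0 threeQuarters).cast
      (by rw [O.pt_right, ← Equiv.Perm.mul_apply, mul_inv_cancel, Equiv.Perm.one_apply]) rfl)).trans
    ((O.segment (O.h⁻¹ (O.h⁻¹ i)) 1 threeQuarters half 1).cast
      (by rw [O.pt_right, ← Equiv.Perm.mul_apply, mul_inv_cancel, Equiv.Perm.one_apply]) (O.pt_top _ half).symm)

end Origami

/-- The matrix `T`. -/
def matT : SpecialLinearGroup (Fin 2) ℝ := ⟨!![1, 1; 0, 1], by simp⟩

/-- The matrix `S`. -/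
def matS : SpecialLinearGroup (Fin 2) ℝ := ⟨!![1, 0; 1, 1], by simp⟩

/-- The 2-cover `M` of the mutetrahedron. The 24 squares are labelled `1, …, 24`; as elements of
`Fin 24` the labels are read modulo 24, so that `24 = 0`. -/
def mutetrahedron : Origami 24 where
  h := List.formPerm [1, 2, 3, 4, 5, 6] * List.formPerm [7, 8, 9, 10, 11, 12] *
    List.formPerm [13, 14, 15, 16, 17, 18] * List.formPerm [19, 20, 21, 22, 23, 24]
  v := List.formPerm [1, 7, 13, 11, 3, 21] * List.formPerm [2, 20, 14, 12, 18, 22] *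
    List.formPerm [4, 10, 16, 8, 6, 24] * List.formPerm [5, 23, 17, 9, 15, 19]

namespace Mutetrahedron

set_option maxRecDepth 20000 in
lemma right_closed : ∀ i, mutetrahedron.v (mutetrahedron.h (mutetrahedron.v (mutetrahedron.h i))) = i := by
  decide

set_option maxRecDepth 20000 in
lemma left_closed : ∀ i, mutetrahedron.v (mutetrahedron.h⁻¹ (mutetrahedron.h⁻¹
    (mutetrahedron.v (mutetrahedron.h⁻¹ (mutetrahedron.h⁻¹ i))))) = i := by
  decide

/-- The closed straight curve with holonomy `(2, 2)` that starts on the bottom of square `i`. -/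
def sigmaCurve (i : Fin 24) : Path (mutetrahedron.bot i) (mutetrahedron.bot i) :=
  ((mutetrahedron.pathRight i).trans (mutetrahedron.pathRight _)).cast rfl
    (by rw [right_closed])

/-- The closed straight curve with holonomy `(-4, 2)` that starts on the bottom of square `i`. -/
def zetaCurve (i : Fin 24) : Path (mutetrahedron.bot i) (mutetrahedron.bot i) :=
  ((mutetrahedron.pathLeft i).trans (mutetrahedron.pathLeft _)).cast rfl
    (by rw [left_closed])

/-- The homology class `σ_i`. -/
def sigma (i : Fin 24) : H₁ mutetrahedron.Surface := loopClass (sigmaCurve i)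

/-- The homology class `ζ_i`. -/
def zeta (i : Fin 24) : H₁ mutetrahedron.Surface := loopClass (zetaCurve i)

/-- The indices `1, 3, 4, 6` of the basis `Σ_1, Σ_3, Σ_4, Σ_6, Z_1, Z_3, Z_4, Z_6`. -/
def basisIndex : Fin 4 → Fin 24 := ![1, 3, 4, 6]

/-- The matrix of `α(S⁻¹T)`, in blocks with respect to `(Σ_1, Σ_3, Σ_4, Σ_6 | Z_1, Z_3, Z_4, Z_6)`. -/
def alphaST : Matrix (Fin 4 ⊕ Fin 4) (Fin 4 ⊕ Fin 4) ℝ :=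
  Matrix.fromBlocks
    0
    !![ 0,  0, -1,  0;
       -1, -1, -1, -1;
        0,  0,  1,  1;
        1,  0,  1,  0]
    !![ 0,  0, -1,  0;
        0,  1,  0,  0;
        1,  0,  1,  0;
        0,  0,  0,  1]
    !![ 1,  0,  1,  1;
        0,  0, -1,  0;
       -1, -1, -1, -1;
        0,  1,  1,  1]

/-- The matrix of `α(TST⁻¹)`, in blocks with respect to `(Σ_1, Σ_3, Σ_4, Σ_6 | Z_1, Z_3, Z_4, Z_6)`. -/
def alphaTST : Matrix (Fin 4 ⊕ Fin 4) (Fin 4 ⊕ Fin 4) ℝ :=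
  Matrix.fromBlocks
    !![ 1,  0,  1,  0;
        0,  1,  0,  0;
        0,  0, -1,  0;
        0,  0,  0,  1]
    !![-1,  0, -1,  0;
        0, -1, -1, -1;
        1, -1,  1,  2;
        0,  0,  1,  0]
    0
    !![ 0,  0, -1, -1;
        1,  1,  1,  1;
        0,  0,  1,  0;
       -1,  0, -1,  0]

end Mutetrahedron

end

end SquareTiled

open SquareTiled SquareTiled.Mutetrahedron

/-!
A linear functional on `H₁(M; ℝ)` is integration over the singular cycles of a function `c` on
paths that vanishes on constant paths and on the boundaries of maps of a square (`IsPathCocycle`,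
`exists_pathCocycle`). On a square-tiled surface such a function is determined, up to a
coboundary, by its values `b i`, `l i` on the bottom and left sides of the squares: near the
centre of a square, the midpoint of a side or a vertex, paths can be pushed into closed squares,
where `c` is a coboundary (`pathCocycle_eq_zero`, `exists_primitive`). Two finite computations
then control the zero-holonomy subspace. First, a cocycle `(b, l)` that vanishes on the ten curves
`σ_i`, `ζ_i`, `i = 1, 3, 4, 6, 8`, is a coboundary (`exists_coboundary`), so these ten classes
span `H₁`. Second, eight explicit integral cocycles, realized as the displacements of maps from
the surface to the circle (`cellMap`), are dual, up to the factor `2`, to `Σ_k`, `Z_k`. Together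
with the two coordinates of the holonomy, they separate the classes, which gives the basis and its
coordinates (`zeroBasis`, `zeroBasis_repr`).

A shear of all squares maps the surface to the square-tiled surface with another pair of
permutations. The shears with derivatives `T`, `S⁻¹` and `T⁻¹`, `S`, `T` lead back to the original
surface after a relabelling, and this gives `φ` and `ψ` (`homeoST`, `homeoTST`). They act on the
values `(b, l)` of a cocycle by explicit formulas, from which their matrices are read off.

For the Veech group, let `A` be the derivative of an affine homeomorphism `f`. The map `f`
permutes the singular points, which lie over the origin of the torus, and there are a horizontal
and a vertical side with singular endpoints, so `A` is integral (`exists_int_matrix`). The squares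
have a colouring by `ℤ/3` that changes by `1` to the right and by `-1` upwards, so the coordinates
of the holonomy of a closed curve agree modulo `3`; applied to the image of the curve `σ_8`, of
holonomy `(2, 2)`, this shows that `A` preserves the line of `(1, 1)` modulo `3`. By a Euclidean
algorithm, the matrices in `SL(2, ℤ)` with this property are generated by `S⁻¹T` and `TST⁻¹`
(`mem_closure_of_dvd`). Hence `f` differs from a word in `φ` and `ψ` by an affine homeomorphism
with trivial derivative. The latter is locally a translation over the torus and maps a singular
point to a singular point, so it commutes with the projection (`mem_automorphismGroup`).
-/

namespace SquareTiled

/-! ### Cocycles on paths -/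

section PathCocycle
variable {X Y : Type*} [TopologicalSpace X] [TopologicalSpace Y]

/-- A real-valued function on the continuous paths of `X` that vanishes on constant paths and on the
boundary of every continuous square. This is a degree one cocycle that sees only the fundamental
groupoid: additivity under concatenation and homotopy invariance are both instances of `square`. -/
structure IsPathCocycle (c : C(I, X) → ℝ) : Prop where
  const : ∀ x, c (.const I x) = 0
  square : ∀ K : C(I × I, X),
    c (K.comp (.prodMk (.id I) (.const I 0))) + c (K.comp (.prodMk (.const I 1) (.id I))) =
      c (K.comp (.prodMk (.const I 0) (.id I))) + c (K.comp (.prodMk (.id I) (.const I 1)))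

/-- The restriction of a path to the interval from `a` to `b`, parametrized by `I`. -/
def subpath (γ : C(I, X)) (a b : I) : C(I, X) where
  toFun t := γ (Origami.lerp a b t)
  continuous_toFun := by unfold Origami.lerp; fun_prop

lemma subpath_apply (γ : C(I, X)) (a b t : I) : subpath γ a b t = γ (Origami.lerp a b t) := rfl

lemma lerp_zero (a b : I) : Origami.lerp a b 0 = a := by simp [Origami.lerp]
lemma lerp_one (a b : I) : Origami.lerp a b 1 = b := by simp [Origami.lerp]
lemma lerp_self (a t : I) : Origami.lerp a a t = a := by
  apply Subtype.ext
  simp only [Origami.lerp]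
  ring
lemma coe_lerp (a b t : I) : (Origami.lerp a b t : ℝ) = (1 - t) * a + t * b := rfl
lemma lerp_zero_one (t : I) : Origami.lerp 0 1 t = t := by
  apply Subtype.ext
  simp [Origami.lerp]
lemma continuous_lerp {f g k : X → I} (hf : Continuous f) (hg : Continuous g) (hk : Continuous k) :
    Continuous fun x => Origami.lerp (f x) (g x) (k x) := by
  unfold Origami.lerp
  fun_prop

lemma subpath_zero_one (γ : C(I, X)) : subpath γ 0 1 = γ := by
  ext t
  rw [subpath_apply, lerp_zero_one]

namespace IsPathCocycle
variable {c c' : C(I, X) → ℝ}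

lemma sub (hc : IsPathCocycle c) (hc' : IsPathCocycle c') : IsPathCocycle fun γ => c γ - c' γ where
  const x := by rw [hc.const, hc'.const, sub_zero]
  square K := by linarith [hc.square K, hc'.square K]

lemma comap (hc : IsPathCocycle c) (f : C(Y, X)) :
    IsPathCocycle fun γ : C(I, Y) => c (f.comp γ) where
  const x := hc.const (f x)
  square K := hc.square (f.comp K)

lemma coboundary (F : X → ℝ) : IsPathCocycle fun γ : C(I, X) => F (γ 1) - F (γ 0) where
  const x := by simp
  square K := by
    simp only [ContinuousMap.comp_apply, ContinuousMap.prod_eval, ContinuousMap.id_apply,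
      ContinuousMap.const_apply]
    ring

lemma subpath_add (hc : IsPathCocycle c) (γ : C(I, X)) (a b d : I) :
    c (subpath γ a b) + c (subpath γ b d) = c (subpath γ a d) := by
  let K : C(I × I, X) :=
    ⟨fun z => γ (Origami.lerp a (Origami.lerp b d z.2) z.1), γ.continuous.comp
      (continuous_lerp continuous_const
        (continuous_lerp continuous_const continuous_const continuous_snd) continuous_fst)⟩
  have h := hc.square K
  have e1 : K.comp (.prodMk (.id I) (.const I 0)) = subpath γ a b := by
    ext t; simp [K, subpath_apply, lerp_zero]
  have e2 : K.comp (.prodMk (.const I 1) (.id I)) = subpath γ b d := by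
    ext t; simp [K, subpath_apply, lerp_one]
  have e3 : K.comp (.prodMk (.const I 0) (.id I)) = .const I (γ a) := by
    ext t; simp [K, lerp_zero]
  have e4 : K.comp (.prodMk (.id I) (.const I 1)) = subpath γ a d := by
    ext t; simp [K, subpath_apply, lerp_one]
  rw [e1, e2, e3, e4, hc.const, zero_add] at h
  exact h

lemma trans (hc : IsPathCocycle c) {x y z : X} (γ : Path x y) (δ : Path y z) :
    c (γ.trans δ).toContinuousMap = c γ.toContinuousMap + c δ.toContinuousMap := by
  have h := hc.subpath_add (γ.trans δ).toContinuousMap 0 Origami.half 1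
  rw [subpath_zero_one] at h
  rw [← h]
  congr 2
  · ext t
    change (γ.trans δ) _ = _
    have ht : (Origami.lerp 0 Origami.half t : ℝ) = t / 2 := by
      simp [coe_lerp, Origami.half]; ring
    rw [Path.trans_apply, dif_pos (by rw [ht]; linarith [t.2.2])]
    change γ _ = γ _
    congr 1
    apply Subtype.ext
    simp only [ht]
    ring
  · ext t
    change (γ.trans δ) _ = _
    have ht : (Origami.lerp Origami.half 1 t : ℝ) = 1 / 2 + t / 2 := by
      simp [coe_lerp, Origami.half]; ring
    rw [Path.trans_apply]
    split_ifs with h0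
    · have h1 : t = 0 := by
        apply Subtype.ext
        have := t.2.1
        rw [ht] at h0
        simp only [Set.Icc.coe_zero]
        linarith
      subst h1
      have : (⟨2 * (Origami.lerp Origami.half 1 0 : ℝ), (unitInterval.mul_pos_mem_iff
          zero_lt_two).2 ⟨(Origami.lerp Origami.half 1 0).2.1, h0⟩⟩ : I) = 1 := by
        apply Subtype.ext
        simp only [ht]
        simp
      rw [this, γ.target]
      exact δ.source.symm
    · change δ _ = δ _
      congr 1
      apply Subtype.ext
      simp only [ht]
      ring

/-- A path cocycle on the square is a coboundary: cone off from the corner `(0, 0)`. -/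
lemma eq_ray_sub (c : C(I, I × I) → ℝ) (hc : IsPathCocycle c) (η : C(I, I × I)) :
    c η = c ⟨fun t => (t * (η 1).1, t * (η 1).2), by fun_prop⟩ -
      c ⟨fun t => (t * (η 0).1, t * (η 0).2), by fun_prop⟩ := by
  let K : C(I × I, I × I) := ⟨fun z => (z.2 * (η z.1).1, z.2 * (η z.1).2), by fun_prop⟩
  have h := hc.square K
  have e1 : K.comp (.prodMk (.id I) (.const I 0)) = .const I (0, 0) := by
    refine ContinuousMap.ext fun t => ?_
    simp [K]
  have e2 : K.comp (.prodMk (.const I 1) (.id I)) =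
      ⟨fun t => (t * (η 1).1, t * (η 1).2), by fun_prop⟩ := rfl
  have e3 : K.comp (.prodMk (.const I 0) (.id I)) =
      ⟨fun t => (t * (η 0).1, t * (η 0).2), by fun_prop⟩ := rfl
  have e4 : K.comp (.prodMk (.id I) (.const I 1)) = η := by
    refine ContinuousMap.ext fun t => ?_
    simp [K]
  rw [e1, e2, e3, e4, hc.const, zero_add] at h
  linarith

/-- A path cocycle that vanishes locally vanishes. -/
lemma eq_zero_of_cover (hc : IsPathCocycle c) {ι : Type*} {U : ι → Set X} (hU : ∀ k, IsOpen (U k))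
    (hcov : ∀ x, ∃ k, x ∈ U k) (h0 : ∀ k (γ : C(I, X)), (∀ t, γ t ∈ U k) → c γ = 0) (γ : C(I, X)) :
    c γ = 0 := by
  obtain ⟨t, ht0, hmono, ⟨n, hn⟩, ht⟩ := exists_monotone_Icc_subset_open_cover_unitInterval
    (c := fun k => γ ⁻¹' (U k)) (fun k => (hU k).preimage γ.continuous)
    (fun s _ => by obtain ⟨k, hk⟩ := hcov (γ s); exact Set.mem_iUnion.mpr ⟨k, hk⟩)
  have hstep : ∀ m, c (subpath γ (t m) (t (m + 1))) = 0 := by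
    intro m
    obtain ⟨k, hk⟩ := ht m
    refine h0 k _ fun s => hk ?_
    have h1 : (t m : ℝ) ≤ t (m + 1) := hmono (Nat.le_succ m)
    have h2 := s.2.1
    have h3 := s.2.2
    constructor
    · change (t m : ℝ) ≤ _
      rw [coe_lerp]; nlinarith
    · change _ ≤ (t (m + 1) : ℝ)
      rw [coe_lerp]; nlinarith
  have hsum : ∀ m, c (subpath γ 0 (t m)) = 0 := by
    intro m
    induction m with
    | zero =>
      rw [ht0, ← hc.const (γ 0)]
      congr 1
      ext s
      rw [subpath_apply, lerp_self]
      rfl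
    | succ m ih => rw [← hc.subpath_add γ 0 (t m), ih, hstep, add_zero]
  have := hsum n
  rwa [hn n le_rfl, subpath_zero_one] at this

end IsPathCocycle
end PathCocycle

/-! ### Path cocycles on a square-tiled surface -/

namespace Origami
variable {n : ℕ} (O : Origami n)

/-- The projection of the disjoint union of the squares onto the surface. -/
def toSurface : Fin n × (I × I) → O.Surface := Quot.mk O.Glue

lemma isQuotientMap_toSurface : IsQuotientMap O.toSurface :=
  isQuotientMap_quot_mk

lemma exists_pt (x : O.Surface) : ∃ i a b, x = O.pt i a b := by
  induction x using Quot.ind with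
  | mk q => exact ⟨q.1, q.2.1, q.2.2, rfl⟩

lemma proj_pt (i : Fin n) (a b : I) : O.proj (O.pt i a b) = torusMk ![(a : ℝ), (b : ℝ)] := rfl

/-- The inclusion of the closed square `i`. -/
def square (i : Fin n) : C(I × I, O.Surface) :=
  ⟨fun z => O.pt i z.1 z.2, continuous_quot_mk.comp (by fun_prop)⟩

lemma square_apply (i : Fin n) (z : I × I) : O.square i z = O.pt i z.1 z.2 := rfl

/-- The bottom side of the square `i`, from left to right. -/
def bottomSide (i : Fin n) : C(I, O.Surface) := (O.square i).comp ⟨fun t => (t, 0), by fun_prop⟩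

/-- The left side of the square `i`, from bottom to top. -/
def leftSide (i : Fin n) : C(I, O.Surface) := (O.square i).comp ⟨fun t => (0, t), by fun_prop⟩

lemma bottomSide_apply (i : Fin n) (t : I) : O.bottomSide i t = O.pt i t 0 := rfl
lemma leftSide_apply (i : Fin n) (t : I) : O.leftSide i t = O.pt i 0 t := rfl

lemma finite_coe_eq (a : UnitAddCircle) : {t : I | ((t : ℝ) : UnitAddCircle) = a}.Finite := by
  rcases Set.eq_empty_or_nonempty {t : I | ((t : ℝ) : UnitAddCircle) = a} with h | ⟨t₀, h₀⟩
  · rw [h]; exact Set.finite_empty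
  · have hf : Set.Finite ({(t₀ : ℝ) - 1, (t₀ : ℝ), (t₀ : ℝ) + 1} : Set ℝ) := Set.toFinite _
    refine (hf.preimage (Subtype.val_injective.injOn)).subset fun t ht => ?_
    have h1 : ((t : ℝ) : UnitAddCircle) = ((t₀ : ℝ) : UnitAddCircle) := by
      rw [Set.mem_ofPred_eq] at ht h₀
      rw [ht, h₀]
    obtain ⟨m, hm⟩ := QuotientAddGroup.eq_iff_sub_mem.mp h1
    simp only [zsmul_eq_mul, mul_one] at hm
    have b1 := t.2.1
    have b2 := t.2.2
    have b3 := t₀.2.1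
    have b4 := t₀.2.2
    have hm1 : m ≤ 1 := by
      have : (m : ℝ) ≤ 1 := by linarith
      exact_mod_cast this
    have hm2 : -1 ≤ m := by
      have : (-1 : ℝ) ≤ m := by linarith
      exact_mod_cast this
    simp only [Set.mem_preimage, Set.mem_insert_iff, Set.mem_singleton_iff]
    obtain rfl | rfl | rfl : m = -1 ∨ m = 0 ∨ m = 1 := by omega
    · left; push_cast at hm; linarith
    · right; left; push_cast at hm; linarith
    · right; right; push_cast at hm; linarith

lemma finite_pair (a : Fin 2 → UnitAddCircle) :
    {q : Fin n × (I × I) | torusMk ![(q.2.1 : ℝ), (q.2.2 : ℝ)] = a}.Finite := by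
  refine (Set.finite_univ.prod ((finite_coe_eq (a 0)).prod (finite_coe_eq (a 1)))).subset
    fun q hq => ⟨Set.mem_univ _, congrFun hq 0, congrFun hq 1⟩

lemma finite_fiber (a : Fin 2 → UnitAddCircle) : {x : O.Surface | O.proj x = a}.Finite := by
  refine ((finite_pair (n := n) a).image O.toSurface).subset fun x hx => ?_
  induction x using Quot.ind with
  | mk q => exact ⟨q, hx, rfl⟩

instance : T1Space O.Surface where
  t1 x := by
    rw [← O.isQuotientMap_toSurface.isClosed_preimage]
    refine Set.Finite.isClosed ((finite_pair (O.proj x)).subset fun q hq => ?_)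
    have : O.toSurface q = x := hq
    rw [← this]
    rfl

/-- A path over a single point of the torus is constant, since the fibres are finite. -/
lemma eq_of_proj_const (γ : C(I, O.Surface)) (a : Fin 2 → UnitAddCircle)
    (h : ∀ t, O.proj (γ t) = a) (t : I) : γ t = γ 0 := by
  have hp : IsPreconnected (Set.range γ) := isPreconnected_range γ.continuous
  have hf : (Set.range γ).Finite :=
    (O.finite_fiber a).subset (by rintro _ ⟨s, rfl⟩; exact h s)
  exact hp.isDiscrete_iff_subsingleton.mp hf.isDiscrete ⟨t, rfl⟩ ⟨0, rfl⟩

/-- A map of the unit interval, locally constant modulo `1` on the open set `J`, along which a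
neighbourhood in the surface is contracted. It fixes the endpoints so that the contraction respects
the gluings. -/
structure Contraction where
  J : Set I
  τ : I → I
  a : UnitAddCircle
  isOpen : IsOpen J
  mem_iff : (1 : I) ∈ J ↔ (0 : I) ∈ J
  cont : ContinuousOn τ J
  map_zero : τ 0 = 0
  map_one : τ 1 = 1
  coe_eq : ∀ t ∈ J, ((τ t : ℝ) : UnitAddCircle) = a

/-- Push the two halves of the interval to its endpoints. -/
noncomputable def Contraction.ends : Contraction where
  J := {t | (t : ℝ) ≠ 1 / 2}
  τ t := if (t : ℝ) < 1 / 2 then 0 else 1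
  a := 0
  isOpen := isOpen_ne.preimage continuous_subtype_val
  mem_iff := by simp only [Set.mem_ofPred_eq, Set.Icc.coe_one, Set.Icc.coe_zero]; norm_num
  cont := by
    intro t ht
    refine ContinuousAt.continuousWithinAt ?_
    rcases lt_or_gt_of_ne (show (t : ℝ) ≠ 1 / 2 from ht) with h | h
    · refine (continuousAt_const (y := (0 : I))).congr ?_
      filter_upwards [(isOpen_Iio.preimage continuous_subtype_val).mem_nhds h] with s hs
      exact (if_pos hs).symm
    · refine (continuousAt_const (y := (1 : I))).congr ?_
      filter_upwards [(isOpen_Ioi.preimage continuous_subtype_val).mem_nhds h] with s hs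
      exact (if_neg (not_lt.mpr (le_of_lt hs))).symm
  map_zero := by simp
  map_one := by
    rw [if_neg]
    simp only [Set.Icc.coe_one]
    norm_num
  coe_eq t _ := by split_ifs <;> simp

/-- Push the open interval to its midpoint. -/
noncomputable def Contraction.middle : Contraction where
  J := {t | 0 < (t : ℝ) ∧ (t : ℝ) < 1}
  τ t := if t = 0 then 0 else if t = 1 then 1 else half
  a := ((1 / 2 : ℝ) : UnitAddCircle)
  isOpen := (isOpen_Ioo (a := (0 : ℝ)) (b := 1)).preimage continuous_subtype_val
  mem_iff := by simp
  cont := by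
    refine (continuousOn_const (c := half)).congr fun t ht => ?_
    dsimp only
    rw [if_neg, if_neg]
    · rintro rfl; exact lt_irrefl _ ht.2
    · rintro rfl; exact lt_irrefl _ ht.1
  map_zero := by simp
  map_one := by simp
  coe_eq t ht := by
    rw [if_neg, if_neg]
    · simp [half]
    · rintro rfl; exact lt_irrefl _ ht.2
    · rintro rfl; exact lt_irrefl _ ht.1

namespace Contraction
variable (A B : Contraction)

/-- The part of the surface where the coordinates lie in the domains of two contractions. -/
def domain : Set O.Surface :=
  {x | Quot.lift (fun q : Fin n × (I × I) => q.2.1 ∈ A.J ∧ q.2.2 ∈ B.J) (by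
    rintro _ _ (⟨i, y⟩ | ⟨i, x⟩)
    · exact propext (and_congr_left' A.mem_iff)
    · exact propext (and_congr_right' B.mem_iff)) x}

lemma isOpen_domain : IsOpen (domain O A B) := by
  rw [← O.isQuotientMap_toSurface.isOpen_preimage]
  exact (A.isOpen.preimage (continuous_fst.comp continuous_snd)).inter
    (B.isOpen.preimage (continuous_snd.comp continuous_snd))

/-- The straight track of a point under a pair of contractions. -/
def track : O.Surface → C(I, O.Surface) :=
  Quot.lift (fun q => (O.square q.1).comp
    ⟨fun s => (lerp q.2.1 (A.τ q.2.1) s, lerp q.2.2 (B.τ q.2.2) s),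
      (continuous_lerp continuous_const continuous_const continuous_id).prodMk
        (continuous_lerp continuous_const continuous_const continuous_id)⟩) (by
    rintro _ _ (⟨i, y⟩ | ⟨i, x⟩)
    · ext s
      change O.pt _ _ _ = O.pt _ _ _
      simp only [A.map_one, A.map_zero, lerp_self]
      exact O.pt_right _ _
    · ext s
      change O.pt _ _ _ = O.pt _ _ _
      simp only [B.map_one, B.map_zero, lerp_self]
      exact O.pt_top _ _)

lemma track_pt (i : Fin n) (x y s : I) :
    track O A B (O.pt i x y) s = O.pt i (lerp x (A.τ x) s) (lerp y (B.τ y) s) := rfl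

lemma continuousOn_track : ContinuousOn (track O A B) (domain O A B) := by
  rw [continuousOn_iff_continuous_domRestrict]
  rw [(O.isQuotientMap_toSurface.restrictPreimage_isOpen (isOpen_domain O A B)).continuous_iff]
  refine ContinuousMap.continuous_of_continuous_uncurry _ ?_
  refine continuous_quot_mk.comp ?_
  have hx : Continuous fun z : (O.toSurface ⁻¹' domain O A B) × I => A.τ z.1.1.2.1 :=
    A.cont.comp_continuous (by fun_prop) fun z => z.1.2.1
  have hy : Continuous fun z : (O.toSurface ⁻¹' domain O A B) × I => B.τ z.1.1.2.2 :=
    B.cont.comp_continuous (by fun_prop) fun z => z.1.2.2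
  exact Continuous.prodMk (by fun_prop) (Continuous.prodMk
    (continuous_lerp (by fun_prop) hx continuous_snd)
    (continuous_lerp (by fun_prop) hy continuous_snd))

end Contraction

/-- A path cocycle that vanishes on all paths inside a closed square vanishes. Near the centre of a
square, the midpoint of a side, or a vertex, the straight contraction to that point moves every
point inside a closed square. -/
lemma pathCocycle_eq_zero {c : C(I, O.Surface) → ℝ} (hc : IsPathCocycle c)
    (h : ∀ i (η : C(I, I × I)), c ((O.square i).comp η) = 0) (γ : C(I, O.Surface)) : c γ = 0 := by
  let S : Bool → Contraction := fun k => if k then .ends else .middle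
  refine hc.eq_zero_of_cover (U := fun k : Bool × Bool => Contraction.domain O (S k.1) (S k.2))
    (fun k => Contraction.isOpen_domain _ _ _) (fun x => ?_) (fun k γ hγ => ?_) γ
  · obtain ⟨i, a, b, rfl⟩ := O.exists_pt x
    have key : ∀ t : I, ∃ k, t ∈ (S k).J := by
      intro t
      by_cases ht : (t : ℝ) = 1 / 2
      · refine ⟨false, ?_⟩
        change 0 < (t : ℝ) ∧ (t : ℝ) < 1
        rw [ht]; norm_num
      · exact ⟨true, ht⟩
    obtain ⟨k, hk⟩ := key a
    obtain ⟨l, hl⟩ := key b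
    exact ⟨(k, l), hk, hl⟩
  · let G : C(I, C(I, O.Surface)) := ⟨fun t => Contraction.track O (S k.1) (S k.2) (γ t),
      (Contraction.continuousOn_track O _ _).comp_continuous γ.continuous hγ⟩
    have hs := hc.square G.uncurry
    have htrack : ∀ x, c (Contraction.track O (S k.1) (S k.2) x) = 0 := by
      intro x
      obtain ⟨i, a, b, rfl⟩ := O.exists_pt x
      exact h i _
    have e1 : G.uncurry.comp (.prodMk (.id I) (.const I 0)) = γ := by
      ext t
      change Contraction.track O (S k.1) (S k.2) (γ t) 0 = γ t
      obtain ⟨i, a, b, hx⟩ := O.exists_pt (γ t)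
      rw [hx, Contraction.track_pt, lerp_zero, lerp_zero]
    have e2 : c (G.uncurry.comp (.prodMk (.const I 1) (.id I))) = 0 := htrack (γ 1)
    have e3 : c (G.uncurry.comp (.prodMk (.const I 0) (.id I))) = 0 := htrack (γ 0)
    have e4 : c (G.uncurry.comp (.prodMk (.id I) (.const I 1))) = 0 := by
      set δ := G.uncurry.comp (.prodMk (.id I) (.const I 1)) with hδ
      have hproj : ∀ t, O.proj (δ t) = ![(S k.1).a, (S k.2).a] := by
        intro t
        change O.proj (Contraction.track O (S k.1) (S k.2) (γ t) 1) = _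
        have hm := hγ t
        obtain ⟨i, a, b, hx⟩ := O.exists_pt (γ t)
        rw [hx] at hm ⊢
        rw [Contraction.track_pt, lerp_one, lerp_one, proj_pt]
        ext l
        fin_cases l
        · exact (S k.1).coe_eq _ hm.1
        · exact (S k.2).coe_eq _ hm.2
      rw [← hc.const (δ 0)]
      congr 1
      ext t
      exact O.eq_of_proj_const δ _ hproj t
    rw [e1, e2, e3, e4] at hs
    simpa using hs

/-- The straight path from the corner `(0, 0)` of the unit square to the point `z`. -/
def ray (z : I × I) : C(I, I × I) := ⟨fun t => (t * z.1, t * z.2), by fun_prop⟩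

section Potential
variable {O} {c : C(I, O.Surface) → ℝ}

lemma pathCocycle_square (hc : IsPathCocycle c) (i : Fin n) (η : C(I, I × I)) :
    c ((O.square i).comp η) =
    c ((O.square i).comp (ray (η 1))) - c ((O.square i).comp (ray (η 0))) :=
  IsPathCocycle.eq_ray_sub _ (hc.comap (O.square i)) η

lemma pathCocycle_ray_zero (hc : IsPathCocycle c) (i : Fin n) :
    c ((O.square i).comp (ray (0, 0))) = 0 := by
  rw [← hc.const (O.pt i 0 0)]
  congr 1
  ext t
  simp [ray, square_apply]

lemma pathCocycle_ray_right (hc : IsPathCocycle c) (i : Fin n) (y : I) :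
    c ((O.square i).comp (ray (1, y))) =
    c (O.bottomSide i) + c ((O.square (O.h i)).comp (ray (0, y))) := by
  have h1 := pathCocycle_square hc i ⟨fun t => (1, t * y), by fun_prop⟩
  have h2 : (O.square i).comp ⟨fun t => (1, t * y), by fun_prop⟩ =
      (O.square (O.h i)).comp (ray (0, y)) := by
    ext t
    simp [ray, square_apply, pt_right]
  have h3 : (O.square i).comp (ray (1, 0)) = O.bottomSide i := by
    ext t
    simp [ray, square_apply, bottomSide_apply]
  rw [h2] at h1
  simp only [ContinuousMap.coe_mk, one_mul, zero_mul, h3] at h1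
  linarith

lemma pathCocycle_ray_top (hc : IsPathCocycle c) (i : Fin n) (x : I) :
    c ((O.square i).comp (ray (x, 1))) =
    c (O.leftSide i) + c ((O.square (O.v i)).comp (ray (x, 0))) := by
  have h1 := pathCocycle_square hc i ⟨fun t => (t * x, 1), by fun_prop⟩
  have h2 : (O.square i).comp ⟨fun t => (t * x, 1), by fun_prop⟩ =
      (O.square (O.v i)).comp (ray (x, 0)) := by
    ext t
    simp [ray, square_apply, pt_top]
  have h3 : (O.square i).comp (ray (0, 1)) = O.leftSide i := by
    ext t
    simp [ray, square_apply, leftSide_apply]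
  rw [h2] at h1
  simp only [ContinuousMap.coe_mk, one_mul, zero_mul, h3] at h1
  linarith

/-- The value of a path cocycle on the diagonal of a square. -/
lemma pathCocycle_ray_one (hc : IsPathCocycle c) (i : Fin n) : c ((O.square i).comp (ray (1, 1))) =
    c (O.bottomSide i) + c (O.leftSide (O.h i)) := by
  have h := pathCocycle_ray_top hc (O.h i) 0
  rw [pathCocycle_ray_zero hc, add_zero] at h
  rw [pathCocycle_ray_right hc, h]

/-- The relation given by the boundary of a square. -/
lemma pathCocycle_relation (hc : IsPathCocycle c) (i : Fin n) :
    c (O.bottomSide i) + c (O.leftSide (O.h i)) =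
    c (O.leftSide i) + c (O.bottomSide (O.v i)) := by
  have h := pathCocycle_ray_right hc (O.v i) 0
  rw [pathCocycle_ray_zero hc, add_zero] at h
  rw [← pathCocycle_ray_one hc, pathCocycle_ray_top hc, h]

/-- A path cocycle that is exact on the sides of the squares is a coboundary. -/
theorem exists_primitive (hc : IsPathCocycle c) (u : Fin n → ℝ)
    (hb : ∀ i, c (O.bottomSide i) = u (O.h i) - u i)
    (hl : ∀ i, c (O.leftSide i) = u (O.v i) - u i) :
    ∃ F : O.Surface → ℝ, ∀ γ, c γ = F (γ 1) - F (γ 0) := by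
  let F : O.Surface → ℝ := Quot.lift (fun q => u q.1 + c ((O.square q.1).comp (ray q.2))) (by
    rintro _ _ (⟨i, y⟩ | ⟨i, x⟩)
    · dsimp only
      rw [pathCocycle_ray_right hc, hb]
      ring
    · dsimp only
      rw [pathCocycle_ray_top hc, hl]
      ring)
  refine ⟨F, fun γ => ?_⟩
  have := O.pathCocycle_eq_zero (hc.sub (IsPathCocycle.coboundary F)) (fun i η => ?_) γ
  · linarith
  · rw [pathCocycle_square hc]
    change _ - ((u i + c ((O.square i).comp (ray (η 1)))) -
      (u i + c ((O.square i).comp (ray (η 0))))) = 0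
    ring

lemma pathCocycle_segment (hc : IsPathCocycle c) (i : Fin n) (x₀ y₀ x₁ y₁ : I) :
    c (O.segment i x₀ y₀ x₁ y₁).toContinuousMap =
      c ((O.square i).comp (ray (x₁, y₁))) - c ((O.square i).comp (ray (x₀, y₀))) := by
  have := pathCocycle_square hc i ⟨fun t => (lerp x₀ x₁ t, lerp y₀ y₁ t),
    (continuous_lerp continuous_const continuous_const continuous_id).prodMk
      (continuous_lerp continuous_const continuous_const continuous_id)⟩
  simp only [ContinuousMap.coe_mk, lerp_zero, lerp_one] at this
  exact this

/-- The terms of the midpoints of the bottom sides form a coboundary, which cancels on closed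
curves. -/
lemma pathCocycle_pathRight (hc : IsPathCocycle c) (i : Fin n) :
    c (O.pathRight i).toContinuousMap =
    c (O.bottomSide i) + c (O.leftSide (O.h i)) +
      c ((O.square (O.v (O.h i))).comp (ray (half, 0))) -
        c ((O.square i).comp (ray (half, 0))) := by
  have h1 := pathCocycle_segment hc i half 0 1 half
  have h2 := pathCocycle_segment hc (O.h i) 0 half half 1
  rw [pathCocycle_ray_right hc] at h1
  rw [pathCocycle_ray_top hc] at h2
  refine (hc.trans _ _).trans ((congrArg₂ (· + ·) h1 h2).trans ?_)
  ring

lemma pathCocycle_pathLeft (hc : IsPathCocycle c) (i : Fin n) :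
    c (O.pathLeft i).toContinuousMap =
    -c (O.bottomSide (O.h⁻¹ i)) - c (O.bottomSide (O.h⁻¹ (O.h⁻¹ i))) +
      c (O.leftSide (O.h⁻¹ (O.h⁻¹ i))) +
      c ((O.square (O.v (O.h⁻¹ (O.h⁻¹ i)))).comp (ray (half, 0))) -
        c ((O.square i).comp (ray (half, 0))) := by
  have h1 := pathCocycle_segment hc i half 0 0 quarter
  have h2 := pathCocycle_segment hc (O.h⁻¹ i) 1 quarter 0 threeQuarters
  have h3 := pathCocycle_segment hc (O.h⁻¹ (O.h⁻¹ i)) 1 threeQuarters half 1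
  have hinv : ∀ j, O.h (O.h⁻¹ j) = j := O.h.apply_symm_apply
  rw [pathCocycle_ray_right hc, hinv] at h2 h3
  rw [pathCocycle_ray_top hc] at h3
  refine (hc.trans _ _).trans ((congrArg₂ (· + ·) ((hc.trans _ _).trans
    (congrArg₂ (· + ·) h1 h2)) h3).trans ?_)
  ring

end Potential

end Origami

/-! ### Linear functionals on first homology as path cocycles -/

section Functionals
open CategoryTheory AlgebraicTopology Simplicial Opposite
variable {X : Type} [TopologicalSpace X]

lemma edge_coord (z : stdSimplex ℝ (Fin 2)) : edge (coord z) = z := by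
  have h : z.1 0 + z.1 1 = 1 := (Fin.sum_univ_two _).symm.trans z.2.2
  refine Subtype.ext (funext fun k => ?_)
  fin_cases k
  · change 1 - z.1 1 = z.1 0
    linarith
  · rfl

lemma coord_edge (t : I) : coord (edge t) = t := rfl

lemma pathOfSimplex_simplexOfPath (γ : C(I, X)) : pathOfSimplex (simplexOfPath γ) = γ := by
  ext t
  exact congrArg γ (coord_edge t)

lemma simplexOfPath_pathOfSimplex (s : singSet X _⦋1⦌) : simplexOfPath (pathOfSimplex s) = s := by
  apply ((TopCat.of X).toSSetObjEquiv (op ⦋1⦌)).injective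
  ext z
  exact congrArg ((TopCat.of X).toSSetObjEquiv (op ⦋1⦌) s) (edge_coord z)

/-- The face opposite to the vertex `i` of a singular triangle, as a path. -/
noncomputable def facePath (g : C(stdSimplex ℝ (Fin 3), X)) (i : Fin 3) : C(I, X) :=
  g.comp ((⟨stdSimplex.map i.succAbove, stdSimplex.continuous_map _⟩ :
    C(stdSimplex ℝ (Fin 2), stdSimplex ℝ (Fin 3))).comp edge)

lemma chainOfPath_facePath (g : C(stdSimplex ℝ (Fin 3), X)) :
    chainOfPath (facePath g 0) - chainOfPath (facePath g 1) + chainOfPath (facePath g 2) =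
      (singSet X).ιChainComplex (((TopCat.of X).toSSetObjEquiv (op ⦋2⦌)).symm g) ≫
        (chains X).d 2 1 := by
  have hf : ∀ i, simplexOfPath (facePath g i) =
      (singSet X).δ i (((TopCat.of X).toSSetObjEquiv (op ⦋2⦌)).symm g) := by
    intro i
    apply ((TopCat.of X).toSSetObjEquiv (op ⦋1⦌)).injective
    ext z
    change g (stdSimplex.map i.succAbove (edge (coord z))) = g (stdSimplex.map i.succAbove z)
    rw [edge_coord]
  refine Eq.trans ?_ ((singSet X).ιChainComplex_d (R := ModuleCat.of ℝ ℝ) (n := 1) _).symm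
  have key : chainOfPath (facePath g 0) - chainOfPath (facePath g 1) + chainOfPath (facePath g 2) =
      ∑ i : Fin 3, (-1 : ℤ) ^ (i : ℕ) • (singSet X).ιChainComplex (R := ModuleCat.of ℝ ℝ)
        ((singSet X).δ i (((TopCat.of X).toSSetObjEquiv (op ⦋2⦌)).symm g)) := by
    simp only [chainOfPath, hf, Fin.sum_univ_three]
    simp [sub_eq_add_neg]
  exact key

/-- A cochain on singular `1`-chains that vanishes on boundaries gives a path cocycle. -/
lemma isPathCocycle_of_cochain (e : (chains X).X 1 ⟶ ModuleCat.of ℝ ℝ)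
    (he : (chains X).d 2 1 ≫ e = 0) :
    IsPathCocycle fun γ : C(I, X) => (chainOfPath γ ≫ e).hom (1 : ℝ) := by
  have tri : ∀ g : C(stdSimplex ℝ (Fin 3), X), (chainOfPath (facePath g 0) ≫ e).hom (1 : ℝ) -
      (chainOfPath (facePath g 1) ≫ e).hom (1 : ℝ) +
      (chainOfPath (facePath g 2) ≫ e).hom (1 : ℝ) = 0 := by
    intro g
    have h := congrArg (fun f => (f ≫ e).hom (1 : ℝ)) (chainOfPath_facePath g)
    simp only [Category.assoc, he, Limits.comp_zero, Preadditive.add_comp,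
      Preadditive.sub_comp] at h
    exact h
  constructor
  · intro x
    have h := tri (.const _ x)
    have hf : ∀ i, facePath (.const (stdSimplex ℝ (Fin 3)) x) i = .const I x := fun i => rfl
    simp only [hf] at h
    linarith
  · intro K
    have hlow : ∀ s : stdSimplex ℝ (Fin 3), s 1 + s 2 ∈ I := fun s => by
      have h3 : s.1 0 + s.1 1 + s.1 2 = 1 := (Fin.sum_univ_three _).symm.trans s.2.2
      have h0 : 0 ≤ s.1 0 := stdSimplex.zero_le s 0
      have h1 : 0 ≤ s.1 1 := stdSimplex.zero_le s 1
      have h2 : 0 ≤ s.1 2 := stdSimplex.zero_le s 2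
      constructor
      · change 0 ≤ s.1 1 + s.1 2
        linarith
      · change s.1 1 + s.1 2 ≤ 1
        linarith
    let sum : C(stdSimplex ℝ (Fin 3), I) := ⟨fun s => ⟨s 1 + s 2, hlow s⟩,
      Continuous.subtype_mk (((continuous_apply 1).comp continuous_subtype_val).add
        ((continuous_apply 2).comp continuous_subtype_val)) _⟩
    let last : C(stdSimplex ℝ (Fin 3), I) :=
      ⟨fun s => ⟨s 2, stdSimplex.zero_le s 2, stdSimplex.le_one s 2⟩,
        Continuous.subtype_mk ((continuous_apply 2).comp continuous_subtype_val) _⟩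
    have hmap : ∀ (i : Fin 3) (t : I) (k : Fin 3),
        (stdSimplex.map (S := ℝ) i.succAbove (edge t)) k =
          (if i.succAbove 0 = k then 1 - (t : ℝ) else 0) +
            (if i.succAbove 1 = k then (t : ℝ) else 0) := by
      intro i t k
      rw [stdSimplex.map_coe, FunOnFinite.linearMap_apply_apply, Finset.sum_filter,
        Fin.sum_univ_two]
      rfl
    have s00 : (0 : Fin 3).succAbove (0 : Fin 2) = 1 := rfl
    have s01 : (0 : Fin 3).succAbove (1 : Fin 2) = 2 := rfl
    have s10 : (1 : Fin 3).succAbove (0 : Fin 2) = 0 := rfl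
    have s11 : (1 : Fin 3).succAbove (1 : Fin 2) = 2 := rfl
    have s20 : (2 : Fin 3).succAbove (0 : Fin 2) = 0 := rfl
    have s21 : (2 : Fin 3).succAbove (1 : Fin 2) = 1 := rfl
    -- the square is cut along its diagonal into two triangles
    have h1 := tri (K.comp (sum.prodMk last))
    have h2 := tri (K.comp (last.prodMk sum))
    have ext1 : ∀ (i : Fin 3) (f : C(I, I × I)),
        (∀ t, ((f t).1 : ℝ) = (stdSimplex.map (S := ℝ) i.succAbove (edge t)) 1 +
          (stdSimplex.map (S := ℝ) i.succAbove (edge t)) 2) →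
        (∀ t, ((f t).2 : ℝ) = (stdSimplex.map (S := ℝ) i.succAbove (edge t)) 2) →
        facePath (K.comp (sum.prodMk last)) i = K.comp f := by
      intro i f hf1 hf2
      refine ContinuousMap.ext fun t => congrArg K (Prod.ext ?_ ?_)
      · exact Subtype.ext (hf1 t).symm
      · exact Subtype.ext (hf2 t).symm
    have ext2 : ∀ (i : Fin 3) (f : C(I, I × I)),
        (∀ t, ((f t).2 : ℝ) = (stdSimplex.map (S := ℝ) i.succAbove (edge t)) 1 +
          (stdSimplex.map (S := ℝ) i.succAbove (edge t)) 2) →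
        (∀ t, ((f t).1 : ℝ) = (stdSimplex.map (S := ℝ) i.succAbove (edge t)) 2) →
        facePath (K.comp (last.prodMk sum)) i = K.comp f := by
      intro i f hf1 hf2
      refine ContinuousMap.ext fun t => congrArg K (Prod.ext ?_ ?_)
      · exact Subtype.ext (hf2 t).symm
      · exact Subtype.ext (hf1 t).symm
    rw [ext1 0 (.prodMk (.const I 1) (.id I))
          (fun t => by rw [hmap, hmap, s00, s01]; simp)
          (fun t => by rw [hmap, s00, s01]; simp),
      ext1 1 (.prodMk (.id I) (.id I))
          (fun t => by rw [hmap, hmap, s10, s11]; simp)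
          (fun t => by rw [hmap, s10, s11]; simp),
      ext1 2 (.prodMk (.id I) (.const I 0))
          (fun t => by rw [hmap, hmap, s20, s21]; simp)
          (fun t => by rw [hmap, s20, s21]; simp)] at h1
    rw [ext2 0 (.prodMk (.id I) (.const I 1))
          (fun t => by rw [hmap, hmap, s00, s01]; simp)
          (fun t => by rw [hmap, s00, s01]; simp),
      ext2 1 (.prodMk (.id I) (.id I))
          (fun t => by rw [hmap, hmap, s10, s11]; simp)
          (fun t => by rw [hmap, s10, s11]; simp),
      ext2 2 (.prodMk (.const I 0) (.id I))
          (fun t => by rw [hmap, hmap, s20, s21]; simp)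
          (fun t => by rw [hmap, s20, s21]; simp)] at h2
    linarith

lemma loopClass_functional {x : X} (γ : Path x x) (e : (chains X).opcycles 1 ⟶ ModuleCat.of ℝ ℝ) :
    ((chains X).homologyι 1 ≫ e).hom (loopClass γ) =
      (chainOfPath γ.toContinuousMap ≫ (chains X).pOpcycles 1 ≫ e).hom (1 : ℝ) := by
  change (((chains X).liftCycles (chainOfPath γ.toContinuousMap) 0 (by simp) (chainOfPath_d γ) ≫
    (chains X).homologyπ 1) ≫ ((chains X).homologyι 1 ≫ e)).hom (1 : ℝ) = _
  congr 2
  simp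

/-- Every linear functional on first homology is integration of a path cocycle, and it vanishes when
this cocycle is a coboundary. -/
theorem exists_pathCocycle (ℓ : H₁ X →ₗ[ℝ] ℝ) : ∃ c : C(I, X) → ℝ, IsPathCocycle c ∧
    (∀ (x : X) (γ : Path x x), ℓ (loopClass γ) = c γ.toContinuousMap) ∧
    ∀ F : X → ℝ, (∀ γ, c γ = F (γ 1) - F (γ 0)) → ℓ = 0 := by
  -- homology is a subspace of the chains modulo boundaries, to which the functional is extended
  let L : (chains X).homology 1 ⟶ ModuleCat.of ℝ ℝ := ModuleCat.ofHom ℓ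
  have hinj : LinearMap.ker ((chains X).homologyι 1).hom = ⊥ :=
    LinearMap.ker_eq_bot.mpr ((ModuleCat.mono_iff_injective _).mp inferInstance)
  obtain ⟨r, hr⟩ := LinearMap.exists_leftInverse_of_injective _ hinj
  let e : (chains X).opcycles 1 ⟶ ModuleCat.of ℝ ℝ := ModuleCat.ofHom (L.hom ∘ₗ r)
  have he : (chains X).homologyι 1 ≫ e = L := by
    ext z
    exact congrArg L.hom (LinearMap.congr_fun hr z)
  refine ⟨fun γ => (chainOfPath γ ≫ (chains X).pOpcycles 1 ≫ e).hom (1 : ℝ),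
    isPathCocycle_of_cochain _ (by simp), fun x γ => ?_, fun F hF => ?_⟩
  · refine Eq.trans ?_ (loopClass_functional γ e)
    rw [he]
    rfl
  · let G : (chains X).X 0 ⟶ ModuleCat.of ℝ ℝ :=
      ((singSet X).isColimitChainComplexXCofan (ModuleCat.of ℝ ℝ) 0).desc
        (Limits.Cofan.mk _ fun s => ModuleCat.ofHom (LinearMap.toSpanSingleton ℝ ℝ
          (F ((TopCat.of X).toSSetObjEquiv (op ⦋0⦌) s (stdSimplex.vertex 0)))))
    have hG : ∀ s, (singSet X).ιChainComplex s ≫ G = ModuleCat.ofHom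
        (LinearMap.toSpanSingleton ℝ ℝ
          (F ((TopCat.of X).toSSetObjEquiv (op ⦋0⦌) s (stdSimplex.vertex 0)))) :=
      fun s => ((singSet X).isColimitChainComplexXCofan (ModuleCat.of ℝ ℝ) 0).fac _ ⟨s⟩
    have hd : (chains X).pOpcycles 1 ≫ e = (chains X).d 1 0 ≫ G := by
      refine SSet.chainComplex_hom_ext fun s => ?_
      have h1 := hF (pathOfSimplex s)
      dsimp only at h1
      unfold chainOfPath at h1
      rw [simplexOfPath_pathOfSimplex] at h1
      have h2 : ((singSet X).ιChainComplex s ≫ (chains X).d 1 0 ≫ G).hom (1 : ℝ) =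
          F (pathOfSimplex s 1) - F (pathOfSimplex s 0) := by
        rw [← Category.assoc]
        erw [(singSet X).ιChainComplex_d (R := ModuleCat.of ℝ ℝ) (n := 0) s]
        have hface : ∀ i : Fin 2, ((TopCat.of X).toSSetObjEquiv (op ⦋0⦌) ((singSet X).δ i s))
            (stdSimplex.vertex 0) = pathOfSimplex s (if i = 0 then 1 else 0) := by
          intro i
          change ((TopCat.of X).toSSetObjEquiv (op ⦋1⦌) s)
            (stdSimplex.map i.succAbove (stdSimplex.vertex 0)) =
            ((TopCat.of X).toSSetObjEquiv (op ⦋1⦌) s) (edge _)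
          rw [stdSimplex.map_vertex]
          fin_cases i
          · simp [edge_one]
          · simp [edge_zero]
        have key : ((∑ i : Fin 2, (-1 : ℤ) ^ (i : ℕ) •
            (singSet X).ιChainComplex (R := ModuleCat.of ℝ ℝ) ((singSet X).δ i s)) ≫ G).hom
              (1 : ℝ) = F (pathOfSimplex s 1) - F (pathOfSimplex s 0) := by
          rw [Preadditive.sum_comp]
          simp only [Preadditive.zsmul_comp, hG, hface, Fin.sum_univ_two]
          simp [sub_eq_add_neg]
        exact key
      ext
      exact h1.trans h2.symm
    have h0 : (chains X).homologyπ 1 ≫ L = 0 := by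
      rw [← he]
      simp [hd]
    have h1 : L = 0 := by
      rw [← cancel_epi ((chains X).homologyπ 1), h0, Limits.comp_zero]
    exact congrArg ModuleCat.Hom.hom h1

variable (p : C(X, Fin 2 → UnitAddCircle))

/-- Each coordinate of the displacement in the plane is a path cocycle. -/
lemma isPathCocycle_displacement (k : Fin 2) :
    IsPathCocycle fun γ : C(I, X) => displacement (p.comp γ) k where
  const x := by
    obtain ⟨u, hu⟩ := exists_lift (p.comp (.const I x))
    have h := lift_sub_eq u (.const I (u 0)) (fun t => by rw [hu]; exact (hu 0).symm) 1 0
    rw [displacement_eq _ u hu]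
    have h2 := congrFun h k
    simp only [ContinuousMap.const_apply, Pi.sub_apply] at h2 ⊢
    linarith
  square K := by
    have : ContractibleSpace (I × I) := inferInstance
    obtain ⟨u, hu⟩ := exists_lift (p.comp K)
    have h : ∀ f : C(I, I × I), displacement (p.comp (K.comp f)) = u (f 1) - u (f 0) :=
      fun f => displacement_eq _ (u.comp f) fun t => hu _
    simp only [h, ContinuousMap.prod_eval, ContinuousMap.id_apply, ContinuousMap.const_apply,
      Pi.sub_apply]
    ring

lemma periods_loopClass {x : X} (γ : Path x x) :
    periods p (loopClass γ) = displacement (p.comp γ.toContinuousMap) := by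
  have h : ((chains X).liftCycles (chainOfPath γ.toContinuousMap) 0 (by simp) (chainOfPath_d γ) ≫
      (chains X).homologyπ 1) ≫ ((chains X).homologyι 1 ≫
        (chains X).descOpcycles (periodChain p) 2 (by simp) (d_periodChain p)) =
      chainOfPath γ.toContinuousMap ≫ periodChain p := by
    simp
  have h1 := ι_periodChain p (simplexOfPath γ.toContinuousMap)
  rw [pathOfSimplex_simplexOfPath] at h1
  replace h := h.trans h1
  have h2 := congrArg (fun f => f.hom (1 : ℝ)) h
  refine h2.trans ?_
  simp

/-- The change of variables formula for periods. -/
lemma periods_comp (f : C(X, X)) (x : H₁ X) : periods p (H₁map f x) = periods (p.comp f) x := by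
  have hchain : (SSet.chainComplexMap (TopCat.toSSet.map (TopCat.ofHom f)) (ModuleCat.of ℝ ℝ)).f 1 ≫
      periodChain p = periodChain (p.comp f) := by
    refine SSet.chainComplex_hom_ext fun s => ?_
    rw [SSet.ι_chainComplexMap_f_assoc, ι_periodChain, ι_periodChain]
    rfl
  have key : SSet.homologyMap (TopCat.toSSet.map (TopCat.ofHom f)) (ModuleCat.of ℝ ℝ) 1 ≫
      ((chains X).homologyι 1 ≫
        (chains X).descOpcycles (periodChain p) 2 (by simp) (d_periodChain p)) =
      (chains X).homologyι 1 ≫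
        (chains X).descOpcycles (periodChain (p.comp f)) 2 (by simp) (d_periodChain _) := by
    rw [← cancel_epi ((chains X).homologyπ 1)]
    simp [hchain]
  exact congrArg (fun φ => φ.hom x) key

end Functionals

/-! ### Integral cellular cocycles -/

namespace Origami
variable {n : ℕ} (O : Origami n) {R : Type*} [AddCommGroup R]

/-- The value on the curve `σ_i` of a cellular cocycle with values `b` on the bottom sides and `l`
on the left sides. -/
def sigmaValue (b l : Fin n → R) (i : Fin n) : R :=
  b i + l (O.h i) + (b (O.v (O.h i)) + l (O.h (O.v (O.h i))))

/-- The value on the curve `ζ_i` of a cellular cocycle with values `b` on the bottom sides and `l`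
on the left sides. -/
def zetaValue (b l : Fin n → R) (i : Fin n) : R :=
  -b (O.h⁻¹ i) - b (O.h⁻¹ (O.h⁻¹ i)) + l (O.h⁻¹ (O.h⁻¹ i)) +
    (-b (O.h⁻¹ (O.v (O.h⁻¹ (O.h⁻¹ i)))) - b (O.h⁻¹ (O.h⁻¹ (O.v (O.h⁻¹ (O.h⁻¹ i))))) +
      l (O.h⁻¹ (O.h⁻¹ (O.v (O.h⁻¹ (O.h⁻¹ i))))))

/-- The map to the circle, bilinear on each square and constant on the vertices, whose displacements
along the sides are the values of an integral cellular cocycle. It is paired with a constant map, to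
have values in the torus. -/
noncomputable def cellMap (b l : Fin n → ℤ) (hrel : ∀ i, b i + l (O.h i) = l i + b (O.v i)) :
    C(O.Surface, Fin 2 → UnitAddCircle) where
  toFun := Quot.lift (fun q => torusMk ![(q.2.1 : ℝ) * b q.1 + q.2.2 * l q.1 +
      q.2.1 * q.2.2 * (l (O.h q.1) - l q.1), 0]) (by
    have key : ∀ (a a' : ℝ) (m : ℤ), a = a' + m → (a : UnitAddCircle) = (a' : UnitAddCircle) := by
      intro a a' m h
      refine QuotientAddGroup.eq_iff_sub_mem.mpr ⟨m, ?_⟩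
      simp [h]
    rintro _ _ (⟨i, y⟩ | ⟨i, x⟩)
    · refine funext fun k => ?_
      fin_cases k
      · refine key _ _ (b i) ?_
        simp
        ring
      · rfl
    · refine funext fun k => ?_
      fin_cases k
      · refine key _ _ (l i) ?_
        have h : (b i : ℝ) + l (O.h i) = l i + b (O.v i) := by exact_mod_cast hrel i
        simp
        linear_combination (x : ℝ) * h
      · rfl)
  continuous_toFun := by
    refine continuous_quot_lift _ (continuous_torusMk.comp (continuous_pi fun k => ?_))
    have hd : ∀ f : Fin n → ℝ, Continuous fun q : Fin n × (I × I) => f q.1 := fun f =>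
      (continuous_of_discreteTopology (f := f)).comp continuous_fst
    have h1 := hd fun i => (b i : ℝ)
    have h2 := hd fun i => (l i : ℝ)
    have h3 := hd fun i => (l (O.h i) : ℝ)
    fin_cases k
    · simp only [Fin.zero_eta, Matrix.cons_val_zero]
      fun_prop
    · simp only [Fin.mk_one, Matrix.cons_val_one, Matrix.cons_val_fin_one]
      fun_prop

variable (b l : Fin n → ℤ) (hrel : ∀ i, b i + l (O.h i) = l i + b (O.v i))

lemma displacement_cellMap_bottomSide (i : Fin n) :
    displacement ((O.cellMap b l hrel).comp (O.bottomSide i)) 0 = b i := by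
  rw [displacement_eq _ (⟨fun t => ![(t : ℝ) * b i + (0 : I) * l i +
      t * (0 : I) * (l (O.h i) - l i), 0], by
    refine continuous_pi fun k => ?_
    fin_cases k <;> simp <;> fun_prop⟩) (fun t => rfl)]
  simp

lemma displacement_cellMap_leftSide (i : Fin n) :
    displacement ((O.cellMap b l hrel).comp (O.leftSide i)) 0 = l i := by
  rw [displacement_eq _ (⟨fun t => ![((0 : I) : ℝ) * b i + t * l i +
      (0 : I) * t * (l (O.h i) - l i), 0], by
    refine continuous_pi fun k => ?_
    fin_cases k <;> simp <;> fun_prop⟩) (fun t => rfl)]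
  simp

end Origami

/-! ### Shears, relabellings and reflections of square-tiled surfaces -/

namespace Origami
variable {n : ℕ}

/-- The retraction of the real line onto the unit interval. -/
noncomputable def clamp : ℝ → I := Set.projIcc 0 1 zero_le_one

lemma continuous_clamp : Continuous clamp := continuous_projIcc

lemma clamp_of_eq {r : ℝ} {t : I} (h : r = t) : clamp r = t := by
  rw [h]
  exact Set.projIcc_val zero_le_one t

lemma coe_clamp {r : ℝ} (h0 : 0 ≤ r) (h1 : r ≤ 1) : (clamp r : ℝ) = r :=
  congrArg Subtype.val (Set.projIcc_of_mem zero_le_one ⟨h0, h1⟩)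

variable {O O' : Origami n}

lemma continuous_pt {Y : Type*} [TopologicalSpace Y] {f : Y → Fin n} {g k : Y → I}
    (hf : Continuous f) (hg : Continuous g) (hk : Continuous k) :
    Continuous fun y => O.pt (f y) (g y) (k y) :=
  continuous_quot_mk.comp (hf.prodMk (hg.prodMk hk))

section Shear

/-- The horizontal shear `(x, y) ↦ (x + y, y)` on the squares of `O`. -/
noncomputable def shearFun (O O' : Origami n) (q : Fin n × (I × I)) : O'.Surface :=
  if (q.2.1 + q.2.2 : ℝ) ≤ 1 then O'.pt q.1 (clamp (q.2.1 + q.2.2)) q.2.2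
  else O'.pt (O.h q.1) (clamp (q.2.1 + q.2.2 - 1)) q.2.2

/-- The inverse shear `(x, y) ↦ (x - y, y)` on the squares of `O'`. -/
noncomputable def unshearFun (O : Origami n) (q : Fin n × (I × I)) : O.Surface :=
  if (q.2.2 : ℝ) ≤ q.2.1 then O.pt q.1 (clamp (q.2.1 - q.2.2)) q.2.2
  else O.pt (O.h⁻¹ q.1) (clamp (q.2.1 - q.2.2 + 1)) q.2.2

lemma shearFun_of_le {i : Fin n} {x y : I} (z : I) (hz : (z : ℝ) = x + y) :
    shearFun O O' (i, (x, y)) = O'.pt i z y := by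
  rw [shearFun, if_pos (by dsimp only; rw [← hz]; exact z.2.2), clamp_of_eq hz.symm]

lemma shearFun_of_ge (hh : ∀ i, O'.h i = O.h i) {i : Fin n} {x y : I} (z : I)
    (hz : (z : ℝ) = x + y - 1) : shearFun O O' (i, (x, y)) = O'.pt (O.h i) z y := by
  rw [shearFun]
  split_ifs with h
  · have h1 : (x + y : ℝ) = 1 := le_antisymm h (by have := z.2.1; linarith)
    rw [clamp_of_eq (t := 1) (by simpa using h1), pt_right, hh]
    congr
    apply Subtype.ext
    simp [hz, h1]
  · rw [clamp_of_eq hz.symm]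

lemma unshearFun_of_le {i : Fin n} {x y : I} (z : I) (hz : (z : ℝ) = x - y) :
    unshearFun O (i, (x, y)) = O.pt i z y := by
  rw [unshearFun, if_pos (by have := z.2.1; dsimp only; linarith), clamp_of_eq hz.symm]

lemma unshearFun_of_ge {i : Fin n} {x y : I} (z : I) (hz : (z : ℝ) = x - y + 1) :
    unshearFun O (i, (x, y)) = O.pt (O.h⁻¹ i) z y := by
  rw [unshearFun]
  split_ifs with h
  · have h1 : (y : ℝ) = x := le_antisymm h (by have := z.2.2; linarith)
    have h2 : z = 1 := Subtype.ext (by simp [hz, h1])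
    rw [clamp_of_eq (t := 0) (by simp [h1]), h2, pt_right]
    congr
    exact (O.h.apply_symm_apply i).symm
  · rw [clamp_of_eq hz.symm]

lemma continuous_shearFun (hh : ∀ i, O'.h i = O.h i) : Continuous (shearFun O O') := by
  have hO : Continuous fun q : Fin n × (I × I) => O.h q.1 :=
    (continuous_of_discreteTopology (f := O.h)).comp continuous_fst
  refine Continuous.if_le
    (continuous_pt continuous_fst (continuous_clamp.comp (by fun_prop)) (by fun_prop))
    (continuous_pt hO (continuous_clamp.comp (by fun_prop)) (by fun_prop))
    (by fun_prop) continuous_const fun q hq => ?_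
  rw [hq, clamp_of_eq (t := 1) (by simp), clamp_of_eq (t := 0) (by simp), pt_right, hh]

lemma continuous_unshearFun : Continuous (unshearFun O) := by
  have hO : Continuous fun q : Fin n × (I × I) => O.h⁻¹ q.1 :=
    (continuous_of_discreteTopology (f := ⇑O.h⁻¹)).comp continuous_fst
  refine Continuous.if_le
    (continuous_pt continuous_fst (continuous_clamp.comp (by fun_prop)) (by fun_prop))
    (continuous_pt hO (continuous_clamp.comp (by fun_prop)) (by fun_prop))
    (by fun_prop) (by fun_prop) fun q hq => ?_
  have hi : O.h (O.h⁻¹ q.1) = q.1 := O.h.apply_symm_apply _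
  rw [hq, sub_self, zero_add, clamp_of_eq (r := 1) (t := 1) (by simp),
    clamp_of_eq (r := 0) (t := 0) (by simp), pt_right, hi]

/-- The horizontal shear, with derivative `T`, from the surface `(h, v)` to the surface
`(h, v h⁻¹)`. -/
noncomputable def shear (hh : ∀ i, O'.h i = O.h i) (hv : ∀ i, O'.v (O.h i) = O.v i) :
    O.Surface ≃ₜ O'.Surface where
  toFun := Quot.lift (shearFun O O') (by
    rintro _ _ (⟨i, y⟩ | ⟨i, x⟩)
    · rw [shearFun_of_ge hh y (by simp), shearFun_of_le y (by simp)]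
    · rw [shearFun_of_ge hh x (by simp), shearFun_of_le x (by simp), pt_top, hv])
  invFun := Quot.lift (unshearFun O) (by
    have hh' : ∀ i, O.h⁻¹ (O.h i) = i := O.h.symm_apply_apply
    rintro _ _ (⟨i, y⟩ | ⟨i, x⟩)
    · rw [unshearFun_of_le (σ y) (by simp), unshearFun_of_ge (σ y) (by simp; ring), hh, hh']
    · rw [unshearFun_of_ge x (by simp), unshearFun_of_le x (by simp), pt_top, ← hv]
      congr
      exact O.h.apply_symm_apply i)
  left_inv x := by
    induction x using Quot.ind with
    | mk q =>
      obtain ⟨i, x, y⟩ := q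
      change Quot.lift (unshearFun O) _ (shearFun O O' (i, (x, y))) = O.pt i x y
      have hx := x.2
      have hy := y.2
      rcases le_total ((x : ℝ) + y) 1 with h | h
      · rw [shearFun_of_le (clamp (x + y)) (coe_clamp (by linarith [hx.1, hy.1]) h)]
        exact unshearFun_of_le x (by rw [coe_clamp (by linarith [hx.1, hy.1]) h]; ring)
      · have hz : (clamp (x + y - 1) : ℝ) = x + y - 1 :=
          coe_clamp (by linarith) (by linarith [hx.2, hy.2])
        rw [shearFun_of_ge hh (clamp (x + y - 1)) hz]
        refine (unshearFun_of_ge x (by rw [hz]; ring)).trans ?_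
        congr
        exact O.h.symm_apply_apply i
  right_inv x := by
    induction x using Quot.ind with
    | mk q =>
      obtain ⟨i, x, y⟩ := q
      change Quot.lift (shearFun O O') _ (unshearFun O (i, (x, y))) = O'.pt i x y
      have hx := x.2
      have hy := y.2
      rcases le_total (y : ℝ) x with h | h
      · have hz : (clamp (x - y) : ℝ) = x - y := coe_clamp (by linarith) (by linarith [hx.2, hy.1])
        rw [unshearFun_of_le (clamp (x - y)) hz]
        exact shearFun_of_le x (by rw [hz]; ring)
      · have hz : (clamp (x - y + 1) : ℝ) = x - y + 1 :=
          coe_clamp (by linarith [hx.1, hy.2]) (by linarith)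
        rw [unshearFun_of_ge (clamp (x - y + 1)) hz]
        refine (shearFun_of_ge hh x (by rw [hz]; ring)).trans ?_
        congr
        exact O.h.apply_symm_apply i
  continuous_toFun := continuous_quot_lift _ (continuous_shearFun hh)
  continuous_invFun := continuous_quot_lift _ continuous_unshearFun

variable (hh : ∀ i, O'.h i = O.h i) (hv : ∀ i, O'.v (O.h i) = O.v i)

lemma shear_pt (i : Fin n) (x y : I) : shear hh hv (O.pt i x y) = shearFun O O' (i, (x, y)) := rfl

lemma proj_shear (x : O.Surface) :
    O'.proj (shear hh hv x) = ![O.proj x 0 + O.proj x 1, O.proj x 1] := by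
  obtain ⟨i, a, b, rfl⟩ := O.exists_pt x
  have ha := a.2
  have hb := b.2
  rw [shear_pt, proj_pt]
  rcases le_total ((a : ℝ) + b) 1 with h | h
  · rw [shearFun_of_le (clamp (a + b)) (coe_clamp (by linarith [ha.1, hb.1]) h), proj_pt,
      coe_clamp (by linarith [ha.1, hb.1]) h]
    refine funext fun k => ?_
    fin_cases k <;> simp [torusMk]
  · have hz : (clamp (a + b - 1) : ℝ) = a + b - 1 :=
      coe_clamp (by linarith) (by linarith [ha.2, hb.2])
    rw [shearFun_of_ge hh (clamp (a + b - 1)) hz, proj_pt, hz]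
    refine funext fun k => ?_
    fin_cases k <;> simp [torusMk]

lemma shear_bottomSide (i : Fin n) :
    (shear hh hv : C(O.Surface, O'.Surface)).comp (O.bottomSide i) = O'.bottomSide i := by
  ext t
  exact shearFun_of_le t (by simp)

lemma shear_leftSide (i : Fin n) :
    (shear hh hv : C(O.Surface, O'.Surface)).comp (O.leftSide i) =
      (O'.square i).comp (ray (1, 1)) := by
  ext t
  refine (shearFun_of_le t (by simp)).trans ?_
  simp [ray, square_apply]

end Shear

section Flip
variable (hh : ∀ i, O'.h i = O.v i) (hv : ∀ i, O'.v i = O.h i)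

/-- The reflection in the diagonal, from the surface `(h, v)` to the surface `(v, h)`. -/
def flip : O.Surface ≃ₜ O'.Surface where
  toFun := Quot.lift (fun q => O'.pt q.1 q.2.2 q.2.1) (by
    rintro _ _ (⟨i, y⟩ | ⟨i, x⟩)
    · exact (O'.pt_top _ _).trans (by rw [hv])
    · exact (O'.pt_right _ _).trans (by rw [hh]))
  invFun := Quot.lift (fun q => O.pt q.1 q.2.2 q.2.1) (by
    rintro _ _ (⟨i, y⟩ | ⟨i, x⟩)
    · exact (O.pt_top _ _).trans (by rw [hh])
    · exact (O.pt_right _ _).trans (by rw [hv]))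
  left_inv x := by
    induction x using Quot.ind with
    | mk q => rfl
  right_inv x := by
    induction x using Quot.ind with
    | mk q => rfl
  continuous_toFun := continuous_quot_lift _
    (continuous_pt (by fun_prop) (by fun_prop) (by fun_prop))
  continuous_invFun := continuous_quot_lift _
    (continuous_pt (by fun_prop) (by fun_prop) (by fun_prop))

lemma proj_flip (x : O.Surface) : O'.proj (flip hh hv x) = ![O.proj x 1, O.proj x 0] := by
  obtain ⟨i, a, b, rfl⟩ := O.exists_pt x
  refine funext fun k => ?_
  fin_cases k <;> rfl

end Flip

section Relabel
variable (π : Equiv.Perm (Fin n)) (hh : ∀ i, O'.h (π i) = π (O.h i))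
  (hv : ∀ i, O'.v (π i) = π (O.v i))

/-- The isomorphism of surfaces given by relabelling the squares. -/
def relabel : O.Surface ≃ₜ O'.Surface where
  toFun := Quot.lift (fun q => O'.pt (π q.1) q.2.1 q.2.2) (by
    rintro _ _ (⟨i, y⟩ | ⟨i, x⟩)
    · exact (O'.pt_right _ _).trans (by rw [hh])
    · exact (O'.pt_top _ _).trans (by rw [hv]))
  invFun := Quot.lift (fun q => O.pt (π.symm q.1) q.2.1 q.2.2) (by
    rintro _ _ (⟨i, y⟩ | ⟨i, x⟩)
    · refine (O.pt_right _ _).trans ?_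
      obtain ⟨j, rfl⟩ := π.surjective i
      simp [hh]
    · refine (O.pt_top _ _).trans ?_
      obtain ⟨j, rfl⟩ := π.surjective i
      simp [hv])
  left_inv x := by
    induction x using Quot.ind with
    | mk q =>
      change O.pt (π.symm (π q.1)) q.2.1 q.2.2 = O.pt q.1 q.2.1 q.2.2
      rw [π.symm_apply_apply]
  right_inv x := by
    induction x using Quot.ind with
    | mk q =>
      change O'.pt (π (π.symm q.1)) q.2.1 q.2.2 = O'.pt q.1 q.2.1 q.2.2
      rw [π.apply_symm_apply]
  continuous_toFun := continuous_quot_lift _ (continuous_pt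
    ((continuous_of_discreteTopology (f := π)).comp continuous_fst) (by fun_prop) (by fun_prop))
  continuous_invFun := continuous_quot_lift _ (continuous_pt
    ((continuous_of_discreteTopology (f := π.symm)).comp continuous_fst) (by fun_prop)
    (by fun_prop))

lemma proj_relabel (x : O.Surface) : O'.proj (relabel π hh hv x) = O.proj x := by
  obtain ⟨i, a, b, rfl⟩ := O.exists_pt x
  rfl

end Relabel

/-! ### Values of path cocycles on the sides, and their pullbacks -/

/-- The path cocycle `c` has the values `b i` and `l i` on the bottom and left sides of square `i`.
-/
structure HasSides (c : C(I, O.Surface) → ℝ) (b l : Fin n → ℝ) : Prop where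
  isPathCocycle : IsPathCocycle c
  bottom : ∀ i, c (O.bottomSide i) = b i
  left : ∀ i, c (O.leftSide i) = l i

lemma HasSides.of_eq {c c' : C(I, O.Surface) → ℝ} {b l b' l' : Fin n → ℝ} (H : HasSides c b l)
    (hc : c' = c) (hb : ∀ i, b i = b' i) (hl : ∀ i, l i = l' i) : HasSides c' b' l' := by
  obtain rfl : b = b' := funext hb
  obtain rfl : l = l' := funext hl
  rwa [hc]

variable {c : C(I, O'.Surface) → ℝ} {b l : Fin n → ℝ}

lemma HasSides.relabel (H : HasSides c b l) (π : Equiv.Perm (Fin n))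
    (hh : ∀ i, O'.h (π i) = π (O.h i)) (hv : ∀ i, O'.v (π i) = π (O.v i)) :
    HasSides (fun γ => c ((relabel π hh hv : C(O.Surface, O'.Surface)).comp γ))
      (fun i => b (π i)) (fun i => l (π i)) :=
  ⟨H.1.comap _, fun i => H.2 (π i), fun i => H.3 (π i)⟩

lemma HasSides.flip (H : HasSides c b l) (hh : ∀ i, O'.h i = O.v i) (hv : ∀ i, O'.v i = O.h i) :
    HasSides (fun γ => c ((flip hh hv : C(O.Surface, O'.Surface)).comp γ)) l b :=
  ⟨H.1.comap _, fun i => H.3 i, fun i => H.2 i⟩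

lemma HasSides.shear (H : HasSides c b l) (hh : ∀ i, O'.h i = O.h i)
    (hv : ∀ i, O'.v (O.h i) = O.v i) :
    HasSides (fun γ => c ((shear hh hv : C(O.Surface, O'.Surface)).comp γ))
      b (fun i => b i + l (O.h i)) := by
  refine ⟨H.1.comap _, fun i => ?_, fun i => ?_⟩
  · rw [shear_bottomSide, H.2]
  · rw [shear_leftSide, pathCocycle_ray_one H.1, H.2, H.3, hh]

lemma HasSides.shear_symm {c : C(I, O.Surface) → ℝ} (H : HasSides c b l) (hh : ∀ i, O'.h i = O.h i)
    (hv : ∀ i, O'.v (O.h i) = O.v i) :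
    HasSides (fun γ => c (((Origami.shear hh hv).symm : C(O'.Surface, O.Surface)).comp γ))
      b (fun i => l (O.h⁻¹ i) - b (O.h⁻¹ i)) := by
  have hcomp : ∀ γ : C(I, O.Surface), ((Origami.shear hh hv).symm : C(O'.Surface, O.Surface)).comp
      ((Origami.shear hh hv : C(O.Surface, O'.Surface)).comp γ) = γ := fun γ =>
    ContinuousMap.ext fun t => (Origami.shear hh hv).symm_apply_apply (γ t)
  have hb : ∀ i, c (((Origami.shear hh hv).symm : C(O'.Surface, O.Surface)).comp
      (O'.bottomSide i)) = b i := by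
    intro i
    rw [← shear_bottomSide hh hv, hcomp, H.2]
  refine ⟨H.1.comap _, hb, fun i => ?_⟩
  have h1 := pathCocycle_ray_one
    (H.1.comap ((Origami.shear hh hv).symm : C(O'.Surface, O.Surface))) (O.h⁻¹ i)
  have hi : O.h (O.h⁻¹ i) = i := O.h.apply_symm_apply i
  rw [← shear_leftSide hh hv, hcomp, hb, H.3, hh, hi] at h1
  linarith

/-- The displacements of a cellular map, as a path cocycle. -/
lemma hasSides_cellMap (b l : Fin n → ℤ) (hrel : ∀ i, b i + l (O.h i) = l i + b (O.v i)) :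
    HasSides (O := O) (fun γ => displacement ((O.cellMap b l hrel).comp γ) 0)
      (fun i => b i) (fun i => l i) :=
  ⟨isPathCocycle_displacement _ 0, O.displacement_cellMap_bottomSide b l hrel,
    O.displacement_cellMap_leftSide b l hrel⟩

lemma HasSides.relation {c : C(I, O.Surface) → ℝ} (H : HasSides c b l) (i : Fin n) :
    b i + l (O.h i) = l i + b (O.v i) := by
  have h := pathCocycle_relation H.1 i
  rwa [H.2, H.2, H.3, H.3] at h

/-- A map that is induced by an integral matrix on the torus is affine with this matrix as
derivative. -/
lemma isAffine_of_proj {f : O.Surface → O.Surface} (A : Matrix (Fin 2) (Fin 2) ℤ)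
    (h : ∀ x k, O.proj (f x) k = A k 0 • O.proj x 0 + A k 1 • O.proj x 1) :
    O.IsAffine f (A.map (↑)) := by
  intro x
  obtain ⟨U, hU, z, hz, hp⟩ := O.exists_coord x
  refine ⟨U, hU, z, hz, hp, 0, fun y hy => funext fun k => ?_⟩
  rw [h, hp y hy]
  fin_cases k <;> simp [torusMk]

end Origami

namespace Mutetrahedron
variable {c : C(I, mutetrahedron.Surface) → ℝ} {b l : Fin 24 → ℝ}

lemma pathCocycle_sigmaCurve (H : Origami.HasSides c b l) (i : Fin 24) :
    c (sigmaCurve i).toContinuousMap = mutetrahedron.sigmaValue b l i := by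
  refine (H.1.trans (mutetrahedron.pathRight i)
    (mutetrahedron.pathRight (mutetrahedron.v (mutetrahedron.h i)))).trans ?_
  rw [Origami.pathCocycle_pathRight H.1, Origami.pathCocycle_pathRight H.1, right_closed,
    Origami.sigmaValue, H.2, H.2, H.3, H.3]
  ring

lemma pathCocycle_zetaCurve (H : Origami.HasSides c b l) (i : Fin 24) :
    c (zetaCurve i).toContinuousMap = mutetrahedron.zetaValue b l i := by
  refine (H.1.trans (mutetrahedron.pathLeft i) (mutetrahedron.pathLeft
    (mutetrahedron.v (mutetrahedron.h⁻¹ (mutetrahedron.h⁻¹ i))))).trans ?_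
  rw [Origami.pathCocycle_pathLeft H.1, Origami.pathCocycle_pathLeft H.1, left_closed,
    Origami.zetaValue, H.2, H.2, H.3, H.2, H.2, H.3]
  ring

end Mutetrahedron

/-! ### Generators of a congruence group of level three -/

section Generators
open SpecialLinearGroup

/-- The matrix `S⁻¹T`, with integer entries. -/
def rotInt : SpecialLinearGroup (Fin 2) ℤ := ⟨!![1, 1; -1, 0], by simp⟩

/-- The matrix `TST⁻¹`, with integer entries. -/
def parInt : SpecialLinearGroup (Fin 2) ℤ := ⟨!![2, -1; 1, 0], by simp⟩

/-- The subgroup of `SL(2, ℤ)` generated by `S⁻¹T` and `TST⁻¹`. -/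
def levelThree : Subgroup (SpecialLinearGroup (Fin 2) ℤ) := Subgroup.closure {rotInt, parInt}

lemma rotInt_mem : rotInt ∈ levelThree := Subgroup.subset_closure (by simp)

lemma parInt_mem : parInt ∈ levelThree := Subgroup.subset_closure (by simp)

lemma neg_one_mem_levelThree : (-1 : SpecialLinearGroup (Fin 2) ℤ) ∈ levelThree := by
  have h : rotInt * rotInt * rotInt = -1 := by decide
  rw [← h]
  exact mul_mem (mul_mem rotInt_mem rotInt_mem) rotInt_mem

/-- The lower triangular matrix with entry `3`. -/
def lowerThree : SpecialLinearGroup (Fin 2) ℤ := ⟨!![1, 0; 3, 1], by simp⟩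

lemma lowerThree_mem : lowerThree ∈ levelThree := by
  have h : lowerThree = -1 * (parInt⁻¹ * rotInt) := by decide
  rw [h]
  exact mul_mem neg_one_mem_levelThree (mul_mem (inv_mem parInt_mem) rotInt_mem)

lemma mem_levelThree_of_mul {A B : SpecialLinearGroup (Fin 2) ℤ} (hB : B ∈ levelThree)
    (h : B * A ∈ levelThree) : A ∈ levelThree :=
  (Subgroup.mul_mem_cancel_left _ hB).mp h

lemma parInt_mul (A : SpecialLinearGroup (Fin 2) ℤ) (j : Fin 2) :
    (parInt * A) 0 j = 2 * A 0 j - A 1 j ∧ (parInt * A) 1 j = A 0 j := by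
  have h : (parInt * A).1 = !![2, -1; 1, 0] * A.1 := rfl
  constructor <;> simp [h, Matrix.mul_apply, Fin.sum_univ_two, sub_eq_add_neg]

lemma parInt_inv_mul (A : SpecialLinearGroup (Fin 2) ℤ) (j : Fin 2) :
    (parInt⁻¹ * A) 0 j = A 1 j ∧ (parInt⁻¹ * A) 1 j = 2 * A 1 j - A 0 j := by
  have h0 : (parInt⁻¹).1 = !![0, 1; -1, 2] := by decide
  have h : (parInt⁻¹ * A).1 = !![0, 1; -1, 2] * A.1 := h0 ▸ rfl
  constructor <;> simp [h, Matrix.mul_apply, Fin.sum_univ_two, neg_add_eq_sub]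

lemma lowerThree_mul (A : SpecialLinearGroup (Fin 2) ℤ) (j : Fin 2) :
    (lowerThree * A) 0 j = A 0 j ∧ (lowerThree * A) 1 j = 3 * A 0 j + A 1 j := by
  have h : (lowerThree * A).1 = !![1, 0; 3, 1] * A.1 := rfl
  constructor <;> simp [h, Matrix.mul_apply, Fin.sum_univ_two]

lemma lowerThree_inv_mul (A : SpecialLinearGroup (Fin 2) ℤ) (j : Fin 2) :
    (lowerThree⁻¹ * A) 0 j = A 0 j ∧ (lowerThree⁻¹ * A) 1 j = A 1 j - 3 * A 0 j := by
  have h0 : (lowerThree⁻¹).1 = !![1, 0; -3, 1] := by decide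
  have h : (lowerThree⁻¹ * A).1 = !![1, 0; -3, 1] * A.1 := h0 ▸ rfl
  constructor <;> simp [h, Matrix.mul_apply, Fin.sum_univ_two, neg_add_eq_sub]

/-- The matrices fixing `(1, 1)` are the powers of `TST⁻¹`. -/
lemma mem_levelThree_of_fixed (b : ℤ) : ∀ A : SpecialLinearGroup (Fin 2) ℤ,
    A 0 0 = 1 - b → A 0 1 = b → A 1 0 = -b → A 1 1 = 1 + b → A ∈ levelThree := by
  induction b using Int.induction_on with
  | zero =>
    intro A h1 h2 h3 h4
    have : A = 1 := by
      ext i j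
      fin_cases i <;> fin_cases j <;> simp [h1, h2, h3, h4]
    rw [this]
    exact one_mem _
  | succ k ih =>
    intro A h1 h2 h3 h4
    refine mem_levelThree_of_mul parInt_mem (ih _ ?_ ?_ ?_ ?_)
    · rw [(parInt_mul A 0).1]; linarith
    · rw [(parInt_mul A 1).1]; linarith
    · rw [(parInt_mul A 0).2]; linarith
    · rw [(parInt_mul A 1).2]; linarith
  | pred k ih =>
    intro A h1 h2 h3 h4
    refine mem_levelThree_of_mul (inv_mem parInt_mem) (ih _ ?_ ?_ ?_ ?_)
    · rw [(parInt_inv_mul A 0).1]; linarith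
    · rw [(parInt_inv_mul A 1).1]; linarith
    · rw [(parInt_inv_mul A 0).2]; linarith
    · rw [(parInt_inv_mul A 1).2]; linarith

/-- A form of the Euclidean algorithm: the group generated by `S⁻¹T` and `TST⁻¹` contains `-1`, the
matrix `TST⁻¹`, which in the basis `(1, 1)`, `(0, 1)` is upper triangular with entry `-1`, and the
lower triangular matrix with entry `3`. These reduce the first column `(p, 3 s)` to `(±1, 0)`. -/
lemma mem_levelThree_aux (N : ℕ) : ∀ (A : SpecialLinearGroup (Fin 2) ℤ) (p s : ℤ),
    A 0 0 + A 0 1 = p → A 1 0 + A 1 1 = p + 3 * s → p.natAbs + s.natAbs ≤ N → A ∈ levelThree := by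
  induction N with
  | zero =>
    intro A p s hp hs hN
    exfalso
    obtain rfl : p = 0 := by omega
    obtain rfl : s = 0 := by omega
    have hd := A.det_coe
    rw [Matrix.det_fin_two,
      show A.1 0 1 = -A.1 0 0 by linarith [show A.1 0 0 + A.1 0 1 = 0 from hp],
      show A.1 1 1 = -A.1 1 0 by linarith [show A.1 1 0 + A.1 1 1 = 0 + 3 * 0 from hs]] at hd
    ring_nf at hd
    omega
  | succ N ih =>
    intro A p s hp hs hN
    have hd : A 0 0 * A 1 1 - A 0 1 * A 1 0 = 1 := by
      rw [← Matrix.det_fin_two]; exact A.det_coe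
    -- the determinant in the basis `(1, 1)`, `(0, 1)`
    have hd' : p * (A 1 1 - A 0 1) - 3 * s * A 0 1 = 1 := by
      have e1 : A 0 0 = p - A 0 1 := by linarith
      have e2 : A 1 0 = p + 3 * s - A 1 1 := by linarith
      rw [e1, e2] at hd
      linarith
    by_cases hs0 : s = 0
    · subst hs0
      have hdp : p * (A 1 1 - A 0 1) = 1 := by linarith
      rcases Int.eq_one_or_neg_one_of_mul_eq_one hdp with rfl | rfl
      · exact mem_levelThree_of_fixed (A 0 1) A (by linarith) rfl (by linarith) (by linarith)
      · refine mem_levelThree_of_mul neg_one_mem_levelThree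
          (mem_levelThree_of_fixed (-A 0 1) _ ?_ ?_ ?_ ?_) <;> rw [neg_one_mul] <;>
          simp only [SpecialLinearGroup.coe_neg, Matrix.neg_apply] <;> linarith
    · have hp0 : p ≠ 0 := by
        rintro rfl
        have : (3 : ℤ) ∣ 1 := ⟨-(s * A 0 1), by linarith⟩
        norm_num at this
      have key : (p - 3 * s).natAbs < p.natAbs ∨ (p + 3 * s).natAbs < p.natAbs ∨
          (s + p).natAbs < s.natAbs ∨ (s - p).natAbs < s.natAbs := by omega
      rcases key with h | h | h | h
      · refine mem_levelThree_of_mul parInt_mem (ih _ (p - 3 * s) s ?_ ?_ (by omega))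
        · rw [(parInt_mul A 0).1, (parInt_mul A 1).1]; linarith
        · rw [(parInt_mul A 0).2, (parInt_mul A 1).2]; linarith
      · refine mem_levelThree_of_mul (inv_mem parInt_mem) (ih _ (p + 3 * s) s ?_ ?_ (by omega))
        · rw [(parInt_inv_mul A 0).1, (parInt_inv_mul A 1).1]; linarith
        · rw [(parInt_inv_mul A 0).2, (parInt_inv_mul A 1).2]; linarith
      · refine mem_levelThree_of_mul lowerThree_mem (ih _ p (s + p) ?_ ?_ (by omega))
        · rw [(lowerThree_mul A 0).1, (lowerThree_mul A 1).1]; linarith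
        · rw [(lowerThree_mul A 0).2, (lowerThree_mul A 1).2]; linarith
      · refine mem_levelThree_of_mul (inv_mem lowerThree_mem) (ih _ p (s - p) ?_ ?_ (by omega))
        · rw [(lowerThree_inv_mul A 0).1, (lowerThree_inv_mul A 1).1]; linarith
        · rw [(lowerThree_inv_mul A 0).2, (lowerThree_inv_mul A 1).2]; linarith

lemma coe_matS_inv_mul_matT : (matS⁻¹ * matT).1 = !![1, 1; -1, 0] := by
  have h : (matS⁻¹ * matT).1 = matS.1.adjugate * matT.1 := rfl
  rw [h, Matrix.adjugate_fin_two]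
  simp [matS, matT]

lemma coe_matT_mul_matS_mul_matT_inv : (matT * matS * matT⁻¹).1 = !![2, -1; 1, 0] := by
  have h : (matT * matS * matT⁻¹).1 = matT.1 * matS.1 * matT.1.adjugate := rfl
  rw [h, Matrix.adjugate_fin_two]
  simp [matS, matT]
  norm_num

lemma map_rotInt : SpecialLinearGroup.map (Int.castRingHom ℝ) rotInt = matS⁻¹ * matT := by
  refine Subtype.ext (Eq.trans ?_ coe_matS_inv_mul_matT.symm)
  change (!![1, 1; -1, 0] : Matrix (Fin 2) (Fin 2) ℤ).map (Int.castRingHom ℝ) = _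
  ext i j
  fin_cases i <;> fin_cases j <;> simp

lemma map_parInt : SpecialLinearGroup.map (Int.castRingHom ℝ) parInt = matT * matS * matT⁻¹ := by
  refine Subtype.ext (Eq.trans ?_ coe_matT_mul_matS_mul_matT_inv.symm)
  change (!![2, -1; 1, 0] : Matrix (Fin 2) (Fin 2) ℤ).map (Int.castRingHom ℝ) = _
  ext i j
  fin_cases i <;> fin_cases j <;> simp

/-- An integral matrix of determinant one which preserves the line of `(1, 1)` modulo `3` is a
product of `S⁻¹T`, `TST⁻¹` and their inverses. -/
theorem mem_closure_of_dvd (A : SpecialLinearGroup (Fin 2) ℝ) (B : Matrix (Fin 2) (Fin 2) ℤ)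
    (hAB : ∀ i j, A i j = B i j) (h3 : 3 ∣ (B 1 0 + B 1 1) - (B 0 0 + B 0 1)) :
    A ∈ Subgroup.closure {matS⁻¹ * matT, matT * matS * matT⁻¹} := by
  have hdet : B.det = 1 := by
    have h := A.det_coe
    rw [Matrix.det_fin_two] at h ⊢
    rw [hAB, hAB, hAB, hAB] at h
    exact_mod_cast h
  obtain ⟨s, hs⟩ := h3
  have hmem := mem_levelThree_aux _ ⟨B, hdet⟩ _ s rfl
    (show B 1 0 + B 1 1 = (B 0 0 + B 0 1) + 3 * s by linarith) le_rfl
  have hA : A = SpecialLinearGroup.map (Int.castRingHom ℝ) ⟨B, hdet⟩ := by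
    ext i j
    exact hAB i j
  have h := Subgroup.mem_map_of_mem (SpecialLinearGroup.map (Int.castRingHom ℝ)) hmem
  rw [levelThree, MonoidHom.map_closure, Set.image_pair, map_rotInt, map_parInt, ← hA] at h
  exact h

end Generators

/-! ### Singular points and the rigidity of affine homeomorphisms -/

lemma int_sub_of_torusMk_eq {a b : Fin 2 → ℝ} (h : torusMk a = torusMk b) (k : Fin 2) :
    ∃ m : ℤ, a k - b k = m := by
  obtain ⟨m, hm⟩ := QuotientAddGroup.eq_iff_sub_mem.mp (congrFun h k)
  exact ⟨m, by rw [← hm]; simp⟩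

lemma eq_of_torusMk_eq {a b : Fin 2 → ℝ} (h : torusMk a = torusMk b)
    (hlt : ∀ k, |a k - b k| < 1) : a = b := by
  refine funext fun k => ?_
  obtain ⟨m, hm⟩ := int_sub_of_torusMk_eq h k
  have h1 := hlt k
  rw [hm] at h1
  have h2 : |m| < 1 := by exact_mod_cast h1
  rw [Int.abs_lt_one_iff.mp h2] at hm
  simpa [sub_eq_zero] using hm

/-- The displacement of a closed path in the torus is integral. -/
lemma exists_int_displacement (c : C(I, Fin 2 → UnitAddCircle)) (h : c 1 = c 0) (k : Fin 2) :
    ∃ m : ℤ, displacement c k = m := by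
  obtain ⟨u, hu⟩ := exists_lift c
  rw [displacement_eq c u hu]
  exact int_sub_of_torusMk_eq (by rw [hu, hu, h]) k

namespace Origami
variable {n : ℕ} {O : Origami n}

/-- A point near which the projection to the torus is injective, that is, which is not a cone point.
-/
def IsRegular (x : O.Surface) : Prop := ∃ U ∈ 𝓝 x, Set.InjOn O.proj U

/-- A preimage of a regular point under an affine homeomorphism is regular, so singular points are
mapped to singular points. -/
lemma IsAffine.isRegular {f : O.Surface ≃ₜ O.Surface} {A : Matrix (Fin 2) (Fin 2) ℝ}
    (hf : O.IsAffine f A) {x : O.Surface} (hx : IsRegular (f x)) : IsRegular x := by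
  obtain ⟨U, hU, z, hz, hp, b, hb⟩ := hf x
  obtain ⟨V, hV, hinj⟩ := hx
  have hball : z ⁻¹' Metric.ball (z x) (1 / 2) ∈ 𝓝 x :=
    (hz.continuousAt hU).preimage_mem_nhds (Metric.ball_mem_nhds _ (by norm_num))
  refine ⟨U ∩ f ⁻¹' V ∩ z ⁻¹' Metric.ball (z x) (1 / 2), Filter.inter_mem (Filter.inter_mem hU
    (f.continuous.continuousAt.preimage_mem_nhds hV)) hball, ?_⟩
  rintro y ⟨⟨hyU, hyV⟩, hy⟩ y' ⟨⟨hyU', hyV'⟩, hy'⟩ hyy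
  have hzz : z y = z y' := by
    refine eq_of_torusMk_eq (by rw [← hp y hyU, ← hp y' hyU', hyy]) fun k => ?_
    have h1 : dist (z y) (z y') < 1 := by
      have h2 := dist_triangle_right (z y) (z y') (z x)
      have h3 : dist (z y) (z x) < 1 / 2 := hy
      have h4 : dist (z y') (z x) < 1 / 2 := hy'
      linarith
    exact lt_of_le_of_lt (dist_le_pi_dist (z y) (z y') k) h1
  refine f.injective (hinj hyV hyV' ?_)
  rw [hb y hyU, hb y' hyU', hzz]

/-- The union of the part `x < m` of square `i` and the part `m < x` of the square to its left. -/
def strip (O : Origami n) (i : Fin n) (m : ℝ) (hm0 : 0 < m) (hm1 : m < 1) : Set O.Surface :=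
  {x | Quot.lift (fun q : Fin n × (I × I) => (0 < (q.2.2 : ℝ) ∧ (q.2.2 : ℝ) < 1) ∧
    ((q.1 = i ∧ (q.2.1 : ℝ) < m) ∨ (O.h q.1 = i ∧ m < (q.2.1 : ℝ)))) (by
    rintro _ _ (⟨j, y⟩ | ⟨j, x⟩)
    · simp [hm0, hm1, not_lt.mpr hm0.le, not_lt.mpr hm1.le]
    · simp) x}

lemma isOpen_strip (i : Fin n) (m : ℝ) (hm0 : 0 < m) (hm1 : m < 1) :
    IsOpen (O.strip i m hm0 hm1) := by
  rw [← O.isQuotientMap_toSurface.isOpen_preimage]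
  have h1 : IsOpen {q : Fin n × (I × I) | 0 < (q.2.2 : ℝ) ∧ (q.2.2 : ℝ) < 1} :=
    (isOpen_Ioo (a := (0 : ℝ)) (b := 1)).preimage (by fun_prop)
  have hd : ∀ s : Set (Fin n), IsOpen {q : Fin n × (I × I) | q.1 ∈ s} := fun s =>
    (isOpen_discrete s).preimage continuous_fst
  have h2 : IsOpen {q : Fin n × (I × I) | (q.2.1 : ℝ) < m} :=
    isOpen_lt (by fun_prop) continuous_const
  have h3 : IsOpen {q : Fin n × (I × I) | m < (q.2.1 : ℝ)} :=
    isOpen_lt continuous_const (by fun_prop)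
  exact h1.inter (((hd {i}).inter h2).union ((hd {j | O.h j = i}).inter h3))

lemma injOn_strip (i : Fin n) (m : ℝ) (hm0 : 0 < m) (hm1 : m < 1) :
    Set.InjOn O.proj (O.strip i m hm0 hm1) := by
  intro x hx x' hx' hxx
  obtain ⟨j, a, b, rfl⟩ := O.exists_pt x
  obtain ⟨j', a', b', rfl⟩ := O.exists_pt x'
  rw [proj_pt, proj_pt] at hxx
  have ha := a.2
  have ha' := a'.2
  obtain ⟨⟨h1, h2⟩, h3⟩ := hx
  obtain ⟨⟨h1', h2'⟩, h3'⟩ := hx'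
  dsimp only at h1 h2 h3 h1' h2' h3'
  have hb : b = b' := by
    obtain ⟨k, hk⟩ := int_sub_of_torusMk_eq hxx 1
    simp only [Matrix.cons_val_one, Matrix.cons_val_fin_one] at hk
    have l1 : (k : ℝ) < 1 := by linarith
    have l2 : (-1 : ℝ) < k := by linarith
    have : k = 0 := by
      have : k < 1 := by exact_mod_cast l1
      have : -1 < k := by exact_mod_cast l2
      omega
    rw [this] at hk
    exact Subtype.ext (by push_cast at hk; linarith)
  subst hb
  obtain ⟨k, hk⟩ := int_sub_of_torusMk_eq hxx 0
  simp only [Matrix.cons_val_zero] at hk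
  have same : (k : ℝ) < 1 → (-1 : ℝ) < k → a = a' := by
    intro l1 l2
    have : k = 0 := by
      have : k < 1 := by exact_mod_cast l1
      have : -1 < k := by exact_mod_cast l2
      omega
    rw [this] at hk
    exact Subtype.ext (by push_cast at hk; linarith)
  rcases h3 with ⟨rfl, h3⟩ | ⟨h4, h3⟩ <;> rcases h3' with ⟨h4', h3'⟩ | ⟨h4', h3'⟩
  · rw [same (by linarith [ha'.1]) (by linarith [ha.1]), h4']
  · have : k = -1 := by
      have l1 : (k : ℝ) < 0 := by linarith
      have l2 : (-1 : ℝ) ≤ k := by linarith [ha.1, ha'.2]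
      have : k < 0 := by exact_mod_cast l1
      have : -1 ≤ k := by exact_mod_cast l2
      omega
    rw [this] at hk
    push_cast at hk
    have e1 : a = 0 := Subtype.ext (by simp only [Set.Icc.coe_zero]; linarith [ha.1, ha'.2])
    have e2 : a' = 1 := Subtype.ext (by simp only [Set.Icc.coe_one]; linarith [ha.1, ha'.2])
    rw [e1, e2, pt_right, h4']
  · have : k = 1 := by
      have l1 : (0 : ℝ) < k := by linarith
      have l2 : (k : ℝ) ≤ 1 := by linarith [ha.2, ha'.1]
      have : 0 < k := by exact_mod_cast l1
      have : k ≤ 1 := by exact_mod_cast l2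
      omega
    rw [this] at hk
    push_cast at hk
    have e1 : a = 1 := Subtype.ext (by simp only [Set.Icc.coe_one]; linarith [ha.2, ha'.1])
    have e2 : a' = 0 := Subtype.ext (by simp only [Set.Icc.coe_zero]; linarith [ha.2, ha'.1])
    rw [e1, e2, pt_right, h4, h4']
  · rw [same (by linarith [ha.2]) (by linarith [ha'.2]), O.h.injective (h4.trans h4'.symm)]

lemma isRegular_of_mem_Ioo (i : Fin n) (a b : I) (h0 : 0 < (b : ℝ)) (h1 : (b : ℝ) < 1) :
    IsRegular (O.pt i a b) := by
  have key : ∀ (j : Fin n) (a : I), (a : ℝ) < 1 → IsRegular (O.pt j a b) := by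
    intro j a ha
    have ha0 := a.2.1
    exact ⟨O.strip j ((1 + a) / 2) (by linarith) (by linarith), (isOpen_strip _ _ _ _).mem_nhds
      ⟨⟨h0, h1⟩, Or.inl ⟨rfl, by dsimp only; linarith⟩⟩, injOn_strip _ _ _ _⟩
  rcases lt_or_eq_of_le a.2.2 with ha | ha
  · exact key i a ha
  · obtain rfl : a = 1 := Subtype.ext ha
    rw [pt_right]
    exact key _ 0 (by simp)

/-- Singular points lie over the origin of the torus. -/
lemma proj_eq_zero_of_not_isRegular {x : O.Surface} (hx : ¬ IsRegular x) : O.proj x = 0 := by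
  obtain ⟨i, a, b, rfl⟩ := O.exists_pt x
  have hb : ¬ (0 < (b : ℝ) ∧ (b : ℝ) < 1) := fun h => hx (isRegular_of_mem_Ioo i a b h.1 h.2)
  have ha : ¬ (0 < (a : ℝ) ∧ (a : ℝ) < 1) := by
    intro h
    let O' : Origami n := ⟨O.v, O.h⟩
    let f : O.Surface ≃ₜ O'.Surface := flip (fun _ => rfl) (fun _ => rfl)
    obtain ⟨U, hU, hinj⟩ := isRegular_of_mem_Ioo (O := O') i b a h.1 h.2
    refine hx ⟨f ⁻¹' U, f.continuous.continuousAt.preimage_mem_nhds hU, ?_⟩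
    intro y hy y' hy' hyy
    refine f.injective (hinj hy hy' ?_)
    rw [proj_flip, proj_flip, hyy]
  have key : ∀ t : I, ¬ (0 < (t : ℝ) ∧ (t : ℝ) < 1) → ((t : ℝ) : UnitAddCircle) = 0 := by
    intro t ht
    rcases lt_or_eq_of_le t.2.1 with h | h
    · have h2 : (t : ℝ) = 1 := le_antisymm t.2.2 (not_lt.mp fun h2 => ht ⟨h, h2⟩)
      rw [h2]
      exact AddCircle.coe_period 1
    · rw [← h]; rfl
  rw [proj_pt]
  refine funext fun k => ?_
  fin_cases k
  · exact key a ha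
  · exact key b hb

lemma eq_of_pt_eq_of_mem_Ioo {i j : Fin n} {t : I} (h0 : 0 < (t : ℝ)) (h1 : (t : ℝ) < 1)
    (h : O.pt i t t = O.pt j t t) : i = j := by
  let P : O.Surface → Prop := Quot.lift (fun q : Fin n × (I × I) => q.1 = i ∧
      (0 < (q.2.1 : ℝ) ∧ (q.2.1 : ℝ) < 1) ∧ (0 < (q.2.2 : ℝ) ∧ (q.2.2 : ℝ) < 1)) (by
    rintro _ _ (⟨j, y⟩ | ⟨j, x⟩) <;> simp)
  have hP : P (O.pt i t t) := ⟨rfl, ⟨h0, h1⟩, ⟨h0, h1⟩⟩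
  rw [h] at hP
  exact hP.1.symm

/-- The top right corner of a square is a cone point when the two ways around it lead to different
squares. -/
lemma not_isRegular_of_ne {i : Fin n} (hne : O.v (O.h i) ≠ O.h (O.v i)) :
    ¬ IsRegular (O.pt (O.v (O.h i)) 0 0) := by
  have heq : O.pt (O.v (O.h i)) 0 0 = O.pt (O.h (O.v i)) 0 0 := by
    rw [← pt_top, ← pt_right, pt_top, pt_right]
  rintro ⟨U, hU, hinj⟩
  have hlim : ∀ j, Filter.Tendsto (fun t : I => O.pt j t t) (𝓝 0) (𝓝 (O.pt j 0 0)) := fun j =>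
    (continuous_pt (f := fun _ : I => j) continuous_const continuous_id continuous_id).tendsto 0
  have hev := Filter.inter_mem ((hlim (O.v (O.h i))).eventually hU)
    ((hlim (O.h (O.v i))).eventually (heq ▸ hU : U ∈ 𝓝 (O.pt (O.h (O.v i)) 0 0)))
  obtain ⟨ε, hε, hball⟩ := Metric.mem_nhds_iff.mp hev
  obtain ⟨r, hr0, hr1⟩ := exists_between (lt_min hε one_pos)
  let t : I := ⟨r, hr0.le, (hr1.trans_le (min_le_right _ _)).le⟩
  have ht : t ∈ Metric.ball (0 : I) ε := by
    rw [Metric.mem_ball, Subtype.dist_eq, Real.dist_eq]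
    simp only [t, Set.Icc.coe_zero, sub_zero, abs_of_pos hr0]
    exact hr1.trans_le (min_le_left _ _)
  obtain ⟨h1, h2⟩ := hball ht
  refine hne (eq_of_pt_eq_of_mem_Ioo (O := O) (t := t) hr0 (hr1.trans_le (min_le_right _ _)) ?_)
  exact hinj h1 h2 rfl

/-- The derivative of an affine homeomorphism maps the holonomy of a path between singular points to
an integral vector. -/
lemma IsAffine.exists_int_mulVec {f : O.Surface ≃ₜ O.Surface} {A : Matrix (Fin 2) (Fin 2) ℝ}
    (hf : O.IsAffine f A) (γ : C(I, O.Surface)) (h0 : ¬ IsRegular (γ 0)) (h1 : ¬ IsRegular (γ 1))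
    (k : Fin 2) : ∃ m : ℤ, (A *ᵥ SquareTiled.displacement (O.projMap.comp γ)) k = m := by
  have h := IsAffine.displacement (f := (f : C(O.Surface, O.Surface))) hf γ
  obtain ⟨m, hm⟩ := exists_int_displacement
    (O.projMap.comp ((f : C(O.Surface, O.Surface)).comp γ)) (by
      change O.proj (f (γ 1)) = O.proj (f (γ 0))
      rw [proj_eq_zero_of_not_isRegular (fun h => h0 (hf.isRegular h)),
        proj_eq_zero_of_not_isRegular (fun h => h1 (hf.isRegular h))]) k
  exact ⟨m, by rw [← hm]; exact (congrFun h k).symm⟩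

lemma displacement_projMap_bottomSide (i : Fin n) :
    displacement (O.projMap.comp (O.bottomSide i)) = ![1, 0] := by
  rw [displacement_eq _ (⟨fun t => ![(t : ℝ), ((0 : I) : ℝ)], by
    refine continuous_pi fun k => ?_
    fin_cases k <;> simp <;> fun_prop⟩) (fun t => rfl)]
  ext k
  fin_cases k <;> simp

lemma displacement_projMap_leftSide (i : Fin n) :
    displacement (O.projMap.comp (O.leftSide i)) = ![0, 1] := by
  rw [displacement_eq _ (⟨fun t => ![((0 : I) : ℝ), (t : ℝ)], by
    refine continuous_pi fun k => ?_
    fin_cases k <;> simp <;> fun_prop⟩) (fun t => rfl)]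
  ext k
  fin_cases k <;> simp

/-- If one horizontal and one vertical side of a square have singular endpoints, the derivatives of
affine homeomorphisms are integral. -/
lemma IsAffine.exists_int_matrix {f : O.Surface ≃ₜ O.Surface} {A : Matrix (Fin 2) (Fin 2) ℝ}
    (hf : O.IsAffine f A) {i j : Fin n} (hi : ¬ IsRegular (O.pt i 0 0))
    (hi' : ¬ IsRegular (O.pt (O.h i) 0 0)) (hj : ¬ IsRegular (O.pt j 0 0))
    (hj' : ¬ IsRegular (O.pt (O.v j) 0 0)) :
    ∃ B : Matrix (Fin 2) (Fin 2) ℤ, ∀ k l, A k l = B k l := by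
  rw [← pt_right] at hi'
  rw [← pt_top] at hj'
  choose p hp using hf.exists_int_mulVec (O.bottomSide i) hi hi'
  choose q hq using hf.exists_int_mulVec (O.leftSide j) hj hj'
  refine ⟨Matrix.of fun k => ![p k, q k], fun k l => ?_⟩
  have h1 := hp k
  have h2 := hq k
  rw [displacement_projMap_bottomSide] at h1
  rw [displacement_projMap_leftSide] at h2
  fin_cases l
  · simpa [Matrix.mulVec, dotProduct, Fin.sum_univ_two] using h1
  · simpa [Matrix.mulVec, dotProduct, Fin.sum_univ_two] using h2

/-- The holonomy `(a, b)` of a closed path satisfies `3 ∣ a - b` if the squares have a colouring by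
`ℤ/3` that increases by one to the right and decreases by one upwards: then `(x - y + c i) / 3` is a
well-defined map to the circle. -/
lemma exists_sub_eq_three_mul (c : Fin n → ℤ) (hh : ∀ i, (3 : ℤ) ∣ c i + 1 - c (O.h i))
    (hv : ∀ i, (3 : ℤ) ∣ c i - 1 - c (O.v i)) (γ : C(I, O.Surface)) (hγ : γ 1 = γ 0) :
    ∃ m : ℤ, displacement (O.projMap.comp γ) 0 - displacement (O.projMap.comp γ) 1 = 3 * m := by
  have key : ∀ (a a' : ℝ) (m : ℤ), a = a' + m → (a : UnitAddCircle) = (a' : UnitAddCircle) := by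
    intro a a' m h
    refine QuotientAddGroup.eq_iff_sub_mem.mpr ⟨m, ?_⟩
    simp [h]
  let r : C(O.Surface, Fin 2 → UnitAddCircle) := ⟨Quot.lift (fun q =>
      torusMk ![((q.2.1 : ℝ) - q.2.2 + c q.1) / 3, 0]) (by
    rintro _ _ (⟨i, y⟩ | ⟨i, x⟩)
    · refine funext fun k => ?_
      fin_cases k
      · obtain ⟨m, hm⟩ := hh i
        refine key _ _ m ?_
        have : (c i : ℝ) + 1 - c (O.h i) = 3 * m := by exact_mod_cast hm
        simp
        linarith
      · rfl
    · refine funext fun k => ?_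
      fin_cases k
      · obtain ⟨m, hm⟩ := hv i
        refine key _ _ m ?_
        have : (c i : ℝ) - 1 - c (O.v i) = 3 * m := by exact_mod_cast hm
        simp
        linarith
      · rfl), by
    refine continuous_quot_lift _ (continuous_torusMk.comp (continuous_pi fun k => ?_))
    have h1 : Continuous fun q : Fin n × (I × I) => (c q.1 : ℝ) :=
      (continuous_of_discreteTopology (f := fun i => (c i : ℝ))).comp continuous_fst
    fin_cases k
    · simp only [Fin.zero_eta, Matrix.cons_val_zero]
      fun_prop
    · simp only [Fin.mk_one, Matrix.cons_val_one, Matrix.cons_val_fin_one]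
      fun_prop⟩
  -- three times `r` is the difference of the two coordinates
  have hr : ∀ x, (3 : ℤ) • r x 0 = O.proj x 0 - O.proj x 1 := by
    intro x
    obtain ⟨i, a, b, rfl⟩ := O.exists_pt x
    have h1 : (3 : ℤ) • r (O.pt i a b) 0 = (((a : ℝ) - b + c i : ℝ) : UnitAddCircle) := by
      change (3 : ℤ) • (((((a : ℝ) - b + c i) / 3 : ℝ)) : UnitAddCircle) = _
      rw [← AddCircle.coe_zsmul]
      congr 1
      simp only [zsmul_eq_mul]
      push_cast
      ring
    rw [h1, proj_pt]
    exact key _ _ (c i) rfl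
  obtain ⟨w, hw⟩ := exists_lift (r.comp γ)
  obtain ⟨u, hu⟩ := exists_lift (O.projMap.comp γ)
  obtain ⟨m, hm⟩ := int_sub_of_torusMk_eq
    (show torusMk (w 1) = torusMk (w 0) by rw [hw, hw]; exact congrArg r hγ) 0
  refine ⟨m, ?_⟩
  rw [displacement_eq _ u hu, ← hm]
  let e : C(Fin 2 → ℝ, Fin 2 → ℝ) := ⟨fun z => ![z 0 - z 1, 0], by
    refine continuous_pi fun k => ?_
    fin_cases k <;> simp <;> fun_prop⟩
  let e' : C(Fin 2 → ℝ, Fin 2 → ℝ) := ⟨fun z => ![3 * z 0, 0], by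
    refine continuous_pi fun k => ?_
    fin_cases k <;> simp <;> fun_prop⟩
  have h := lift_sub_eq (e.comp u) (e'.comp w) (fun t => by
    refine funext fun k => ?_
    fin_cases k
    · have h1 := hr (γ t)
      have h2 : r (γ t) 0 = ((w t 0 : ℝ) : UnitAddCircle) := (congrFun (hw t) 0).symm
      have h3 : ∀ k, O.proj (γ t) k = ((u t k : ℝ) : UnitAddCircle) := fun k =>
        (congrFun (hu t) k).symm
      rw [h2, h3, h3, ← AddCircle.coe_zsmul, ← AddCircle.coe_sub] at h1
      change ((u t 0 - u t 1 : ℝ) : UnitAddCircle) = ((3 * w t 0 : ℝ) : UnitAddCircle)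
      rw [← h1]
      simp
    · rfl) 1 0
  have h0 := congrFun h 0
  simp [e, e'] at h0
  simp only [Pi.sub_apply]
  linarith

/-- A locally constant function is constant if the two permutations act transitively. -/
lemma eq_of_isLocallyConstant {Z : Type*} {D : O.Surface → Z} (hD : IsLocallyConstant D)
    (i₀ : Fin n) (htrans : ∀ P : Fin n → Prop, P i₀ → (∀ i, P i → P (O.h i)) →
      (∀ i, P i → P (O.v i)) → ∀ i, P i) (x : O.Surface) : D x = D (O.pt i₀ 0 0) := by
  have hsq : ∀ i a b a' b', D (O.pt i a b) = D (O.pt i a' b') := fun i a b a' b' =>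
    (hD.comp_continuous (O.square i).continuous).apply_eq_of_preconnectedSpace (a, b) (a', b')
  obtain ⟨i, a, b, rfl⟩ := O.exists_pt x
  refine (hsq i a b 0 0).trans (htrans (fun i => D (O.pt i 0 0) = D (O.pt i₀ 0 0)) rfl ?_ ?_ i)
  · intro i hi
    rw [← pt_right, hsq i 1 0 0 0, hi]
  · intro i hi
    rw [← pt_top, hsq i 0 1 0 0, hi]

/-- An affine homeomorphism with trivial derivative of a connected surface with a singular point
is an automorphism: it is locally a translation of the torus, and it maps a singular point to a
singular point. -/
lemma IsAffine.mem_automorphismGroup {f : O.Surface ≃ₜ O.Surface} (hf : O.IsAffine f 1)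
    {i₀ : Fin n} (hsing : ¬ IsRegular (O.pt i₀ 0 0))
    (htrans : ∀ P : Fin n → Prop, P i₀ → (∀ i, P i → P (O.h i)) →
      (∀ i, P i → P (O.v i)) → ∀ i, P i) : f ∈ O.automorphismGroup := by
  have hloc : IsLocallyConstant fun x => O.proj (f x) - O.proj x := by
    refine (IsLocallyConstant.iff_eventually_eq _).mpr fun x => ?_
    obtain ⟨U, hU, z, hz, hp, b, hb⟩ := hf x
    have hxU := mem_of_mem_nhds hU
    have : ∀ y ∈ U, O.proj (f y) - O.proj y = torusMk b := by
      intro y hy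
      rw [hb y hy, hp y hy, Matrix.one_mulVec, torusMk_add, add_sub_cancel_left]
    filter_upwards [hU] with y hy
    rw [this y hy, this x hxU]
  intro x
  have h := eq_of_isLocallyConstant hloc i₀ htrans x
  rw [proj_eq_zero_of_not_isRegular hsing,
    proj_eq_zero_of_not_isRegular (fun h => hsing (hf.isRegular h)), sub_zero, sub_eq_zero] at h
  exact h

end Origami

/-! ### The combinatorics of the cover of the mutetrahedron -/

namespace Mutetrahedron

/-- The values of the permutation `h`. -/
def hTable : Fin 24 → Fin 24 :=
  ![19, 2, 3, 4, 5, 6, 1, 8, 9, 10, 11, 12, 7, 14, 15, 16, 17, 18, 13, 20, 21, 22, 23, 0]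

/-- The values of the inverse of `h`. -/
def hInvTable : Fin 24 → Fin 24 :=
  ![23, 6, 1, 2, 3, 4, 5, 12, 7, 8, 9, 10, 11, 18, 13, 14, 15, 16, 17, 0, 19, 20, 21, 22]

/-- The values of the permutation `v`. -/
def vTable : Fin 24 → Fin 24 :=
  ![4, 7, 20, 21, 10, 23, 0, 13, 6, 15, 16, 3, 18, 11, 12, 19, 8, 9, 22, 5, 14, 1, 2, 17]

/-- The values of the inverse of `v`. -/
def vInvTable : Fin 24 → Fin 24 :=
  ![6, 21, 22, 11, 0, 19, 8, 1, 16, 17, 4, 13, 14, 7, 20, 9, 10, 23, 12, 15, 2, 3, 18, 5]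

set_option maxRecDepth 20000 in
lemma h_apply : ∀ i, mutetrahedron.h i = hTable i := by decide

set_option maxRecDepth 20000 in
lemma h_inv_apply : ∀ i, mutetrahedron.h⁻¹ i = hInvTable i := by decide

set_option maxRecDepth 20000 in
lemma v_apply : ∀ i, mutetrahedron.v i = vTable i := by decide

set_option maxRecDepth 20000 in
lemma v_inv_apply : ∀ i, mutetrahedron.v⁻¹ i = vInvTable i := by decide

set_option maxHeartbeats 4000000 in
/-- A real cellular cocycle which vanishes on the ten curves `σ_i`, `ζ_i` with `i = 1, 3, 4, 6, 8`
is a coboundary. -/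
theorem exists_coboundary (b l : Fin 24 → ℝ)
    (hrel : ∀ i, b i + l (mutetrahedron.h i) = l i + b (mutetrahedron.v i))
    (hσ : ∀ k, mutetrahedron.sigmaValue b l (basisIndex k) = 0)
    (hσ8 : mutetrahedron.sigmaValue b l 8 = 0)
    (hζ : ∀ k, mutetrahedron.zetaValue b l (basisIndex k) = 0)
    (hζ8 : mutetrahedron.zetaValue b l 8 = 0) :
    ∃ u : Fin 24 → ℝ, (∀ i, b i = u (mutetrahedron.h i) - u i) ∧
      ∀ i, l i = u (mutetrahedron.v i) - u i := by
  simp only [h_apply, v_apply] at hrel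
  simp only [Origami.sigmaValue, Origami.zetaValue, h_apply, h_inv_apply, v_apply] at hσ hσ8 hζ hζ8
  have r0 : b 0 + l 19 = l 0 + b 4 := hrel 0
  have r1 : b 1 + l 2 = l 1 + b 7 := hrel 1
  have r2 : b 2 + l 3 = l 2 + b 20 := hrel 2
  have r3 : b 3 + l 4 = l 3 + b 21 := hrel 3
  have r4 : b 4 + l 5 = l 4 + b 10 := hrel 4
  have r5 : b 5 + l 6 = l 5 + b 23 := hrel 5
  have r6 : b 6 + l 1 = l 6 + b 0 := hrel 6
  have r7 : b 7 + l 8 = l 7 + b 13 := hrel 7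
  have r8 : b 8 + l 9 = l 8 + b 6 := hrel 8
  have r9 : b 9 + l 10 = l 9 + b 15 := hrel 9
  have r10 : b 10 + l 11 = l 10 + b 16 := hrel 10
  have r11 : b 11 + l 12 = l 11 + b 3 := hrel 11
  have r12 : b 12 + l 7 = l 12 + b 18 := hrel 12
  have r13 : b 13 + l 14 = l 13 + b 11 := hrel 13
  have r14 : b 14 + l 15 = l 14 + b 12 := hrel 14
  have r15 : b 15 + l 16 = l 15 + b 19 := hrel 15
  have r16 : b 16 + l 17 = l 16 + b 8 := hrel 16
  have r17 : b 17 + l 18 = l 17 + b 9 := hrel 17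
  have r18 : b 18 + l 13 = l 18 + b 22 := hrel 18
  have r19 : b 19 + l 20 = l 19 + b 5 := hrel 19
  have r20 : b 20 + l 21 = l 20 + b 14 := hrel 20
  have r21 : b 21 + l 22 = l 21 + b 1 := hrel 21
  have r22 : b 22 + l 23 = l 22 + b 2 := hrel 22
  have r23 : b 23 + l 0 = l 23 + b 17 := hrel 23
  have s0 : b 1 + l 2 + (b 20 + l 21) = 0 := hσ 0
  have z0 : -b 6 - b 5 + l 5 + (-b 22 - b 21 + l 21) = 0 := hζ 0
  have s1 : b 3 + l 4 + (b 10 + l 11) = 0 := hσ 1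
  have z1 : -b 2 - b 1 + l 1 + (-b 12 - b 11 + l 11) = 0 := hζ 1
  have s2 : b 4 + l 5 + (b 23 + l 0) = 0 := hσ 2
  have z2 : -b 3 - b 2 + l 2 + (-b 19 - b 0 + l 0) = 0 := hζ 2
  have s3 : b 6 + l 1 + (b 7 + l 8) = 0 := hσ 3
  have z3 : -b 5 - b 4 + l 4 + (-b 9 - b 8 + l 8) = 0 := hζ 3
  have s4 : b 8 + l 9 + (b 15 + l 16) = 0 := hσ8
  have z4 : -b 7 - b 12 + l 12 + (-b 17 - b 16 + l 16) = 0 := hζ8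
  -- the sums of the cocycle along paths of sides from the lower left corner of square `8`
  refine ⟨![-b 7 - b 0,
    -b 7 - l 1,
    -l 2,
    b 8 - l 17,
    -b 7 - b 0 + l 0,
    -b 7 + l 19,
    l 8,
    -b 7,
    0,
    b 8,
    b 8 + b 9,
    -b 7 - b 0 - b 23,
    -b 7 - b 12,
    -b 7 + l 7,
    l 8,
    -b 7 - l 1,
    -l 16,
    b 8 - l 17,
    -b 7 - b 0 + l 0,
    -b 7,
    0,
    b 20,
    b 8 + b 9,
    -b 7 - b 0 - b 23], fun i => ?_, fun i => ?_⟩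
  · rw [h_apply]
    fin_cases i <;> simp [hTable] <;> linarith
  · rw [v_apply]
    fin_cases i <;> simp [vTable] <;> linarith

/-- Integral cellular cocycles dual, up to the factor `2`, to the curves `Σ_k` and `Z_k`: the values
on the bottom sides. -/
def dualBottom : Fin 4 ⊕ Fin 4 → Fin 24 → ℤ := Sum.elim
  ![![0, 0, 0, 0, 0, 0, 0, 0, 0, 0, 0, 0, 0, 0, 2, 0, 0, 0, 0, 0, 0, 0, 2, 0],
    ![0, -1, 0, 1, 1, 0, 1, 1, 0, 0, 0, 1, 0, 0, 0, 0, 0, 0, 0, 0, 0, 1, -1, 0],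
    ![0, 0, 0, -1, 0, 0, 0, -1, 0, -1, 0, -1, 0, -1, -1, -1, 0, 0, 0, 0, 0, 0, -1, 0],
    ![0, 1, 0, 1, 0, 0, -1, 1, 0, 0, 1, 0, -1, 2, -2, 0, 0, 0, -1, 0, 0, -1, 0, 0]]
  ![![0, -1, 0, 1, 0, 0, -1, -1, 0, 0, 1, 0, 1, 0, 0, 0, 0, 0, 1, 0, 0, -1, 0, 0],
    ![0, -1, 0, -1, 1, 0, -1, -1, 0, 0, 0, -1, 0, 0, 0, 0, 0, 0, 0, 0, 0, -1, 1, 0],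
    ![0, 0, 0, 0, 0, 0, 2, 2, 0, 0, 0, 0, 0, 0, 0, 0, 0, 0, 0, 0, 0, 0, 0, 0],
    ![0, 1, 0, -1, 0, 0, -1, -1, 0, 0, -1, 0, 1, 0, 0, 0, 0, 0, 1, 0, 0, 1, 0, 0]]

/-- Integral cellular cocycles dual, up to the factor `2`, to the curves `Σ_k` and `Z_k`: the values
on the left sides. -/
def dualLeft : Fin 4 ⊕ Fin 4 → Fin 24 → ℤ := Sum.elim
  ![![0, 0, 0, 0, 0, 0, 0, 0, 0, 0, 0, 0, 0, 2, 2, 0, 0, 0, 0, 0, 0, 2, 2, 0],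
    ![-1, -1, 1, 1, 1, 0, 0, 0, -1, 0, 0, 0, 0, -1, 0, 0, 0, 0, 0, 0, 0, 0, -2, -1],
    ![1, 0, -1, -1, 0, 0, 0, 0, 0, 0, 0, 0, 0, -2, -2, -1, 0, 0, -1, 1, 1, 0, 0, 1],
    ![0, 1, 1, 1, -1, 0, 0, 0, 1, 0, 0, -1, 0, 1, -1, 0, 0, 0, 0, 0, 0, -2, 0, 0]]
  ![![0, 1, 1, 1, -1, 0, 0, 0, 1, 0, 0, -1, 0, -1, -1, 0, 0, 0, 0, 0, 0, 0, 0, 0],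
    ![-1, 1, 1, 1, 1, 0, 0, 0, 1, 0, 0, 0, 0, 1, 0, 0, 0, 0, 0, 0, 0, 0, 0, -1],
    ![0, -2, 0, 0, 0, 0, 0, 0, -2, 0, 0, 0, 0, 0, 0, 0, 0, 0, 0, 0, 0, 0, 0, 0],
    ![0, 1, -1, -1, 1, 0, 0, 0, 1, 0, 0, 1, 0, -1, -1, 0, 0, 0, 0, 0, 0, 0, 0, 0]]

/-- The relabelling of squares in the affine homeomorphism with derivative `S⁻¹T`. -/
def permST : Equiv.Perm (Fin 24) where
  toFun := ![2, 22, 13, 8, 17, 0, 1, 11, 14, 21, 4, 19, 16, 12, 15, 10, 5, 20, 3, 23, 6, 9, 18, 7]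
  invFun := ![5, 6, 0, 18, 10, 16, 20, 23, 3, 21, 15, 7, 13, 2, 8, 14, 12, 4, 22, 11, 17, 9, 1, 19]
  left_inv := by decide
  right_inv := by decide

/-- The relabelling of squares in the affine homeomorphism with derivative `TST⁻¹`. -/
def permTST : Equiv.Perm (Fin 24) where
  toFun := ![12, 1, 21, 3, 11, 13, 7, 6, 8, 16, 10, 4, 0, 5, 19, 15, 9, 17, 23, 14, 20, 2, 22, 18]
  invFun := ![12, 1, 21, 3, 11, 13, 7, 6, 8, 16, 10, 4, 0, 5, 19, 15, 9, 17, 23, 14, 20, 2, 22, 18]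
  left_inv := by decide
  right_inv := by decide

/-- A colouring of the squares by `ℤ/3` which increases by one to the right and decreases by one
upwards. -/
def colour : Fin 24 → ℤ :=
  ![0, 2, 0, 1, 2, 0, 1, 1, 2, 0, 1, 2, 0, 0, 1, 2, 0, 1, 2, 1, 2, 0, 1, 2]

/-- The matrix of `α(S⁻¹T)` with integer entries. -/
def intST : Matrix (Fin 4 ⊕ Fin 4) (Fin 4 ⊕ Fin 4) ℤ :=
  Matrix.fromBlocks 0
    !![0, 0, -1, 0; -1, -1, -1, -1; 0, 0, 1, 1; 1, 0, 1, 0]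
    !![0, 0, -1, 0; 0, 1, 0, 0; 1, 0, 1, 0; 0, 0, 0, 1]
    !![1, 0, 1, 1; 0, 0, -1, 0; -1, -1, -1, -1; 0, 1, 1, 1]

/-- The matrix of `α(TST⁻¹)` with integer entries. -/
def intTST : Matrix (Fin 4 ⊕ Fin 4) (Fin 4 ⊕ Fin 4) ℤ :=
  Matrix.fromBlocks
    !![1, 0, 1, 0; 0, 1, 0, 0; 0, 0, -1, 0; 0, 0, 0, 1]
    !![-1, 0, -1, 0; 0, -1, -1, -1; 1, -1, 1, 2; 0, 0, 1, 0]
    0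
    !![0, 0, -1, -1; 1, 1, 1, 1; 0, 0, 1, 0; -1, 0, -1, 0]

lemma alphaST_eq : alphaST = intST.map (↑) := by
  rw [intST, Matrix.fromBlocks_map, alphaST]
  congr 1 <;> ext i j <;> fin_cases i <;> fin_cases j <;> simp

lemma alphaTST_eq : alphaTST = intTST.map (↑) := by
  rw [intTST, Matrix.fromBlocks_map, alphaTST]
  congr 1 <;> ext i j <;> fin_cases i <;> fin_cases j <;> simp

section Pairing
variable {R : Type*} [AddCommGroup R]

/-- The values of a cellular cocycle on the curves `Σ_k` and `Z_k`. -/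
def curveValue (b l : Fin 24 → R) : Fin 4 ⊕ Fin 4 → R :=
  Sum.elim
    (fun k => mutetrahedron.sigmaValue b l (basisIndex k) - mutetrahedron.sigmaValue b l 8)
    (fun k => mutetrahedron.zetaValue b l (basisIndex k) - mutetrahedron.zetaValue b l 8)

/-- The bottom values of the pullback of a cellular cocycle under the affine map with derivative
`S⁻¹T`. -/
def bottomST (b l : Fin 24 → R) (i : Fin 24) : R :=
  b (permST (mutetrahedron.h (mutetrahedron.v⁻¹ i))) -
    l (permST (mutetrahedron.h (mutetrahedron.v⁻¹ i)))

/-- The left values of the pullback of a cellular cocycle under the affine map with derivative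
`S⁻¹T`. -/
def leftST (b l : Fin 24 → R) (i : Fin 24) : R :=
  bottomST b l i + l (permST (mutetrahedron.h i))

/-- The left values of the pullback of a cellular cocycle under the last two factors, a shear with
derivative `T` and a relabelling, of the affine map with derivative `TST⁻¹`. -/
def leftTSTAux (b l : Fin 24 → R) (i : Fin 24) : R :=
  b (permTST i) + l (permTST (mutetrahedron.v⁻¹ i))

/-- The bottom values of the pullback of a cellular cocycle under the affine map with derivative
`TST⁻¹`. -/
def bottomTST (b l : Fin 24 → R) (i : Fin 24) : R :=
  leftTSTAux b l i + b (permTST (mutetrahedron.v (mutetrahedron.h i)))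

/-- The left values of the pullback of a cellular cocycle under the affine map with derivative
`TST⁻¹`. -/
def leftTST (b l : Fin 24 → R) (i : Fin 24) : R :=
  leftTSTAux b l (mutetrahedron.h⁻¹ i) - bottomTST b l (mutetrahedron.h⁻¹ i)

end Pairing

lemma dual_relation : ∀ j i, dualBottom j i + dualLeft j (mutetrahedron.h i) =
    dualLeft j i + dualBottom j (mutetrahedron.v i) := by
  simp only [h_apply, v_apply]
  decide +kernel

lemma curveValue_dual : ∀ j k, curveValue (dualBottom j) (dualLeft j) k =
    if j = k then 2 else 0 := by
  simp only [curveValue, Origami.sigmaValue, Origami.zetaValue, h_apply, h_inv_apply, v_apply]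
  decide +kernel

lemma curveValue_dual_ST : ∀ j k, curveValue (bottomST (dualBottom j) (dualLeft j))
    (leftST (dualBottom j) (dualLeft j)) k = 2 * intST j k := by
  simp only [curveValue, Origami.sigmaValue, Origami.zetaValue, bottomST, leftST,
    h_apply, h_inv_apply, v_apply, v_inv_apply]
  decide +kernel

lemma curveValue_dual_TST : ∀ j k, curveValue (bottomTST (dualBottom j) (dualLeft j))
    (leftTST (dualBottom j) (dualLeft j)) k = 2 * intTST j k := by
  simp only [curveValue, Origami.sigmaValue, Origami.zetaValue, bottomTST, leftTST, leftTSTAux,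
    h_apply, h_inv_apply, v_apply, v_inv_apply]
  decide +kernel

lemma colour_right : ∀ i, (3 : ℤ) ∣ colour i + 1 - colour (mutetrahedron.h i) := by
  simp only [h_apply]
  decide +kernel

lemma colour_top : ∀ i, (3 : ℤ) ∣ colour i - 1 - colour (mutetrahedron.v i) := by
  simp only [v_apply]
  decide +kernel

/-- The permutations `h` and `v` act transitively. -/
lemma transitive (P : Fin 24 → Prop) (h8 : P 8) (hh : ∀ i, P i → P (mutetrahedron.h i))
    (hv : ∀ i, P i → P (mutetrahedron.v i)) : ∀ i, P i := by
  simp only [h_apply, v_apply] at hh hv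
  have row : ∀ i, P i → P (hTable i) ∧ P (hTable (hTable i)) ∧ P (hTable (hTable (hTable i))) ∧
      P (hTable (hTable (hTable (hTable i)))) ∧
      P (hTable (hTable (hTable (hTable (hTable i))))) := fun i h1 =>
    have h2 := hh _ h1
    have h3 := hh _ h2
    have h4 := hh _ h3
    have h5 := hh _ h4
    ⟨h2, h3, h4, h5, hh _ h5⟩
  -- the squares `8`, `6`, `0`, `16` lie in the four cycles of `h`
  obtain ⟨h9, h10, h11, h12, h7⟩ := row 8 h8
  have h6 : P 6 := hv 8 h8
  obtain ⟨h1, h2, h3, h4, h5⟩ := row 6 h6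
  have h0 : P 0 := hv 6 h6
  obtain ⟨h19, h20, h21, h22, h23⟩ := row 0 h0
  have h16 : P 16 := hv 10 h10
  obtain ⟨h17, h18, h13, h14, h15⟩ := row 16 h16
  intro i
  fin_cases i <;> assumption

end Mutetrahedron

/-! ### The affine homeomorphisms with derivatives `S⁻¹T` and `TST⁻¹` -/

namespace Origami
variable {n : ℕ} {O O' : Origami n}

section VerticalShear
variable (hv : ∀ i, O'.v i = O.v i) (hh : ∀ i, O'.h (O.v i) = O.h i)

/-- The vertical shear, with derivative `S`, from the surface `(h, v)` to the surface `(h v⁻¹,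
v)`. It is the horizontal shear conjugated by the reflection in the diagonal. -/
noncomputable def vshear : O.Surface ≃ₜ O'.Surface :=
  (flip (O := O) (O' := ⟨O.v, O.h⟩) (fun _ => rfl) (fun _ => rfl)).trans
    ((shear (O' := ⟨O'.v, O'.h⟩) hv hh).trans (flip (fun _ => rfl) (fun _ => rfl)))

/-- The inverse vertical shear, with derivative `S⁻¹`. -/
noncomputable def vunshear : O'.Surface ≃ₜ O.Surface :=
  (flip (O := O') (O' := ⟨O'.v, O'.h⟩) (fun _ => rfl) (fun _ => rfl)).trans
    ((shear (O := ⟨O.v, O.h⟩) (O' := ⟨O'.v, O'.h⟩) hv hh).symm.trans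
      (flip (fun _ => rfl) (fun _ => rfl)))

lemma proj_shear_symm (hh : ∀ i, O'.h i = O.h i) (hv : ∀ i, O'.v (O.h i) = O.v i)
    (x : O'.Surface) :
    O.proj ((shear hh hv).symm x) = ![O'.proj x 0 - O'.proj x 1, O'.proj x 1] := by
  obtain ⟨y, rfl⟩ := (shear hh hv).surjective x
  rw [Homeomorph.symm_apply_apply, proj_shear]
  refine funext fun k => ?_
  fin_cases k <;> simp

lemma proj_vshear (x : O.Surface) :
    O'.proj (vshear hv hh x) = ![O.proj x 0, O.proj x 0 + O.proj x 1] := by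
  refine (proj_flip (O := ⟨O'.v, O'.h⟩) (O' := O') (fun _ => rfl) (fun _ => rfl) _).trans ?_
  erw [proj_shear, proj_flip]
  simp [add_comm]

lemma proj_vunshear (x : O'.Surface) :
    O.proj (vunshear hv hh x) = ![O'.proj x 0, O'.proj x 1 - O'.proj x 0] := by
  refine (proj_flip (O := ⟨O.v, O.h⟩) (O' := O) (fun _ => rfl) (fun _ => rfl) _).trans ?_
  erw [proj_shear_symm, proj_flip]
  simp

variable {b l : Fin n → ℝ}

lemma HasSides.vshear {c : C(I, O'.Surface) → ℝ} (H : HasSides c b l) :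
    HasSides (fun γ => c ((vshear hv hh : C(O.Surface, O'.Surface)).comp γ))
      (fun i => l i + b (O.v i)) l :=
  ((H.flip (O := ⟨O'.v, O'.h⟩) (fun _ => rfl) (fun _ => rfl)).shear (O := ⟨O.v, O.h⟩) hv hh).flip
    (fun _ => rfl) (fun _ => rfl)

lemma HasSides.vunshear {c : C(I, O.Surface) → ℝ} (H : HasSides c b l) :
    HasSides (fun γ => c ((vunshear hv hh : C(O'.Surface, O.Surface)).comp γ))
      (fun i => b (O.v⁻¹ i) - l (O.v⁻¹ i)) l :=
  ((H.flip (O := ⟨O.v, O.h⟩) (fun _ => rfl) (fun _ => rfl)).shear_symm (O := ⟨O.v, O.h⟩)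
    (O' := ⟨O'.v, O'.h⟩) hv hh).flip (fun _ => rfl) (fun _ => rfl)

end VerticalShear

section Composites
variable (O)

/-- The image of the surface under `T`. -/
def imageT : Origami n := ⟨O.h, O.v * O.h⁻¹⟩

/-- The image of the surface under `S⁻¹T`. -/
def imageST : Origami n := ⟨O.h * O.v * O.h⁻¹, O.v * O.h⁻¹⟩

/-- The image of the surface under `T⁻¹`. -/
def imageTinv : Origami n := ⟨O.h, O.v * O.h⟩

/-- The image of the surface under `ST⁻¹`. -/
def imageSTinv : Origami n := ⟨O.v⁻¹, O.v * O.h⟩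

/-- The image of the surface under `TST⁻¹`. -/
def imageTST : Origami n := ⟨O.v⁻¹, O.v * O.h * O.v⟩

lemma imageT_v_h (i : Fin n) : O.imageT.v (O.h i) = O.v i := by simp [imageT]

lemma imageT_h_v (i : Fin n) : O.imageT.h (O.imageST.v i) = O.imageST.h i := by
  simp [imageT, imageST]

lemma v_h_eq_imageTinv (i : Fin n) : O.v (O.imageTinv.h i) = O.imageTinv.v i := by
  simp [imageTinv]

lemma imageSTinv_h_v (i : Fin n) : O.imageSTinv.h (O.imageTinv.v i) = O.imageTinv.h i := by
  simp [imageSTinv, imageTinv]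

lemma imageTST_v_h (i : Fin n) : O.imageTST.v (O.imageSTinv.h i) = O.imageSTinv.v i := by
  simp [imageTST, imageSTinv]

variable {O}
variable (π : Equiv.Perm (Fin n))

section ST
variable (hh : ∀ i, O.h (π i) = π (O.imageST.h i)) (hv : ∀ i, O.v (π i) = π (O.imageST.v i))

/-- The affine homeomorphism with derivative `S⁻¹T` that an isomorphism of the image of the surface
under `S⁻¹T` with the surface itself determines. -/
noncomputable def homeoOfST : O.Surface ≃ₜ O.Surface :=
  (shear (O := O) (O' := O.imageT) (fun _ => rfl) O.imageT_v_h).trans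
    ((vunshear (O := O.imageST) (O' := O.imageT) (fun _ => rfl) O.imageT_h_v).trans
      (relabel (O := O.imageST) (O' := O) π hh hv))

lemma proj_homeoOfST (x : O.Surface) :
    O.proj (homeoOfST π hh hv x) = ![O.proj x 0 + O.proj x 1, -O.proj x 0] := by
  refine (proj_relabel π hh hv _).trans
    ((proj_vunshear (O := O.imageST) (O' := O.imageT) (fun _ => rfl) O.imageT_h_v _).trans ?_)
  erw [proj_shear (O := O) (O' := O.imageT)]
  simp

lemma isAffine_homeoOfST : O.IsAffine (homeoOfST π hh hv) (matS⁻¹ * matT).1 := by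
  have h := isAffine_of_proj (O := O) (f := homeoOfST π hh hv) !![1, 1; -1, 0] (fun x k => by
    rw [proj_homeoOfST]
    fin_cases k <;> simp)
  convert h using 1
  rw [coe_matS_inv_mul_matT]
  ext i j
  fin_cases i <;> fin_cases j <;> simp

lemma HasSides.homeoOfST {c : C(I, O.Surface) → ℝ} {b l : Fin n → ℝ} (H : HasSides c b l) :
    HasSides (fun γ => c ((homeoOfST π hh hv : C(O.Surface, O.Surface)).comp γ))
      (fun i => b (π (O.imageST.v⁻¹ i)) - l (π (O.imageST.v⁻¹ i)))
      (fun i => b (π (O.imageST.v⁻¹ i)) - l (π (O.imageST.v⁻¹ i)) + l (π (O.h i))) :=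
  ((H.relabel π hh hv).vunshear (O := O.imageST) (O' := O.imageT) (fun _ => rfl)
    O.imageT_h_v).shear (O := O) (O' := O.imageT) (fun _ => rfl) O.imageT_v_h

end ST

section TST
variable (hh : ∀ i, O.h (π i) = π (O.imageTST.h i)) (hv : ∀ i, O.v (π i) = π (O.imageTST.v i))

/-- The affine homeomorphism with derivative `TST⁻¹` that an isomorphism of the image of the surface
under `TST⁻¹` with the surface itself determines. -/
noncomputable def homeoOfTST : O.Surface ≃ₜ O.Surface :=
  (shear (O := O.imageTinv) (O' := O) (fun _ => rfl) O.v_h_eq_imageTinv).symm.trans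
    ((vshear (O := O.imageTinv) (O' := O.imageSTinv) (fun _ => rfl) O.imageSTinv_h_v).trans
      ((shear (O := O.imageSTinv) (O' := O.imageTST) (fun _ => rfl) O.imageTST_v_h).trans
        (relabel (O := O.imageTST) (O' := O) π hh hv)))

lemma proj_homeoOfTST (x : O.Surface) :
    O.proj (homeoOfTST π hh hv x) =
      ![O.proj x 0 - O.proj x 1 + O.proj x 0, O.proj x 0] := by
  refine (proj_relabel π hh hv _).trans
    ((proj_shear (O := O.imageSTinv) (O' := O.imageTST) (fun _ => rfl) O.imageTST_v_h _).trans ?_)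
  erw [proj_vshear, proj_shear_symm]
  simp

lemma isAffine_homeoOfTST : O.IsAffine (homeoOfTST π hh hv) (matT * matS * matT⁻¹).1 := by
  have h := isAffine_of_proj (O := O) (f := homeoOfTST π hh hv) !![2, -1; 1, 0] (fun x k => by
    rw [proj_homeoOfTST]
    fin_cases k
    · simp [two_zsmul]
      abel
    · simp)
  convert h using 1
  rw [coe_matT_mul_matS_mul_matT_inv]
  ext i j
  fin_cases i <;> fin_cases j <;> simp

lemma HasSides.homeoOfTST {c : C(I, O.Surface) → ℝ} {b l : Fin n → ℝ} (H : HasSides c b l) :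
    HasSides (fun γ => c ((homeoOfTST π hh hv : C(O.Surface, O.Surface)).comp γ))
      (fun i => b (π i) + l (π (O.v⁻¹ i)) + b (π (O.imageTinv.v i)))
      (fun i => b (π (O.h⁻¹ i)) + l (π (O.v⁻¹ (O.h⁻¹ i))) -
        (b (π (O.h⁻¹ i)) + l (π (O.v⁻¹ (O.h⁻¹ i))) + b (π (O.imageTinv.v (O.h⁻¹ i))))) :=
  (((H.relabel π hh hv).shear (O := O.imageSTinv) (fun _ => rfl) O.imageTST_v_h).vshear
    (O := O.imageTinv) (O' := O.imageSTinv) (fun _ => rfl) O.imageSTinv_h_v).shear_symm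
    (O' := O) (fun _ => rfl) O.v_h_eq_imageTinv

end TST
end Composites
end Origami

namespace Mutetrahedron
open Origami

lemma permST_h (i : Fin 24) :
    mutetrahedron.h (permST i) = permST (mutetrahedron.imageST.h i) := by
  simp only [imageST, Equiv.Perm.mul_apply, h_apply, v_apply, h_inv_apply]
  revert i
  decide +kernel

lemma permST_v (i : Fin 24) :
    mutetrahedron.v (permST i) = permST (mutetrahedron.imageST.v i) := by
  simp only [imageST, Equiv.Perm.mul_apply, v_apply, h_inv_apply]
  revert i
  decide +kernel

lemma permTST_h (i : Fin 24) :
    mutetrahedron.h (permTST i) = permTST (mutetrahedron.imageTST.h i) := by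
  simp only [imageTST, h_apply, v_inv_apply]
  revert i
  decide +kernel

lemma permTST_v (i : Fin 24) :
    mutetrahedron.v (permTST i) = permTST (mutetrahedron.imageTST.v i) := by
  simp only [imageTST, Equiv.Perm.mul_apply, h_apply, v_apply]
  revert i
  decide +kernel

/-- The affine homeomorphism with derivative `S⁻¹T`. -/
noncomputable def homeoST : mutetrahedron.Surface ≃ₜ mutetrahedron.Surface :=
  homeoOfST permST permST_h permST_v

/-- The affine homeomorphism with derivative `TST⁻¹`. -/
noncomputable def homeoTST : mutetrahedron.Surface ≃ₜ mutetrahedron.Surface :=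
  homeoOfTST permTST permTST_h permTST_v

lemma isAffine_homeoST : mutetrahedron.IsAffine homeoST (matS⁻¹ * matT).1 :=
  isAffine_homeoOfST permST permST_h permST_v

lemma isAffine_homeoTST : mutetrahedron.IsAffine homeoTST (matT * matS * matT⁻¹).1 :=
  isAffine_homeoOfTST permTST permTST_h permTST_v

variable {c : C(I, mutetrahedron.Surface) → ℝ} {b l : Fin 24 → ℝ}

lemma hasSides_homeoST (H : HasSides c b l) :
    HasSides (fun γ => c ((homeoST : C(mutetrahedron.Surface, mutetrahedron.Surface)).comp γ))
      (bottomST b l) (leftST b l) := by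
  refine (H.homeoOfST permST permST_h permST_v).of_eq rfl (fun i => ?_) (fun i => ?_)
  · simp [bottomST, imageST]
  · simp [leftST, bottomST, imageST]

lemma hasSides_homeoTST (H : HasSides c b l) :
    HasSides (fun γ => c ((homeoTST : C(mutetrahedron.Surface, mutetrahedron.Surface)).comp γ))
      (bottomTST b l) (leftTST b l) := by
  refine (H.homeoOfTST permTST permTST_h permTST_v).of_eq rfl (fun i => ?_) (fun i => ?_)
  · simp [bottomTST, leftTSTAux, imageTinv]
  · simp [leftTST, bottomTST, leftTSTAux, imageTinv]

/-! ### The Veech group -/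

lemma not_isRegular_seven : ¬ IsRegular (mutetrahedron.pt 7 0 0) := by
  have h := not_isRegular_of_ne (O := mutetrahedron) (i := 6)
    (by simp only [h_apply, v_apply]; decide)
  simp only [h_apply, v_apply] at h
  exact h

lemma not_isRegular_eight : ¬ IsRegular (mutetrahedron.pt 8 0 0) := by
  have h := not_isRegular_of_ne (O := mutetrahedron) (i := 15)
    (by simp only [h_apply, v_apply]; decide)
  simp only [h_apply, v_apply] at h
  exact h

lemma not_isRegular_one : ¬ IsRegular (mutetrahedron.pt 1 0 0) := by
  have h := not_isRegular_of_ne (O := mutetrahedron) (i := 20)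
    (by simp only [h_apply, v_apply]; decide)
  simp only [h_apply, v_apply] at h
  exact h

lemma hasSides_proj_zero : HasSides (O := mutetrahedron)
    (fun γ => displacement (mutetrahedron.projMap.comp γ) 0) (fun _ => 1) (fun _ => 0) :=
  ⟨isPathCocycle_displacement _ 0, fun i => by rw [displacement_projMap_bottomSide]; simp,
    fun i => by rw [displacement_projMap_leftSide]; simp⟩

lemma hasSides_proj_one : HasSides (O := mutetrahedron)
    (fun γ => displacement (mutetrahedron.projMap.comp γ) 1) (fun _ => 0) (fun _ => 1) :=
  ⟨isPathCocycle_displacement _ 1, fun i => by rw [displacement_projMap_bottomSide]; simp,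
    fun i => by rw [displacement_projMap_leftSide]; simp⟩

lemma displacement_sigmaCurve (i : Fin 24) :
    displacement (mutetrahedron.projMap.comp (sigmaCurve i).toContinuousMap) = ![2, 2] := by
  have h0 := pathCocycle_sigmaCurve hasSides_proj_zero i
  have h1 := pathCocycle_sigmaCurve hasSides_proj_one i
  refine funext fun k => ?_
  fin_cases k
  · refine h0.trans ?_
    norm_num [Origami.sigmaValue]
  · refine h1.trans ?_
    norm_num [Origami.sigmaValue]

lemma displacement_zetaCurve (i : Fin 24) :
    displacement (mutetrahedron.projMap.comp (zetaCurve i).toContinuousMap) = ![-4, 2] := by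
  have h0 := pathCocycle_zetaCurve hasSides_proj_zero i
  have h1 := pathCocycle_zetaCurve hasSides_proj_one i
  refine funext fun k => ?_
  fin_cases k
  · refine h0.trans ?_
    norm_num [Origami.zetaValue]
  · refine h1.trans ?_
    norm_num [Origami.zetaValue]

/-- The derivative is integral because the lower left corners of the squares `1`, `7 = v 1` and `8
= h 7` are singular, and it preserves the line of `(1, 1)` modulo `3` because of the colouring. -/
lemma mem_closure_of_isAffine {f : mutetrahedron.Surface ≃ₜ mutetrahedron.Surface}
    {A : SpecialLinearGroup (Fin 2) ℝ} (hf : mutetrahedron.IsAffine f A) :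
    A ∈ Subgroup.closure {matS⁻¹ * matT, matT * matS * matT⁻¹} := by
  obtain ⟨B, hB⟩ := hf.exists_int_matrix not_isRegular_seven
    (by rw [h_apply]; exact not_isRegular_eight) not_isRegular_one
    (by rw [v_apply]; exact not_isRegular_seven)
  refine mem_closure_of_dvd A B hB ?_
  obtain ⟨m, hm⟩ := exists_sub_eq_three_mul colour colour_right colour_top
    ((f : C(mutetrahedron.Surface, mutetrahedron.Surface)).comp (sigmaCurve 8).toContinuousMap) (by
      change f (sigmaCurve 8 1) = f (sigmaCurve 8 0)
      rw [Path.source, Path.target])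
  have h := IsAffine.displacement
    (f := (f : C(mutetrahedron.Surface, mutetrahedron.Surface))) hf (sigmaCurve 8).toContinuousMap
  have h' : displacement (mutetrahedron.projMap.comp
      ((f : C(mutetrahedron.Surface, mutetrahedron.Surface)).comp
        (sigmaCurve 8).toContinuousMap)) = (A : Matrix (Fin 2) (Fin 2) ℝ) *ᵥ ![2, 2] :=
    h.trans (congrArg _ (displacement_sigmaCurve 8))
  rw [h'] at hm
  simp only [Matrix.mulVec, dotProduct, Fin.sum_univ_two, Matrix.cons_val_zero, Matrix.cons_val_one,
    Matrix.cons_val_fin_one, hB] at hm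
  have hm' : B 0 0 * 2 + B 0 1 * 2 - (B 1 0 * 2 + B 1 1 * 2) = 3 * m := by exact_mod_cast hm
  omega

theorem veechGroup_eq :
    mutetrahedron.veechGroup = Subgroup.closure {matS⁻¹ * matT, matT * matS * matT⁻¹} := by
  apply le_antisymm
  · rintro A ⟨f, hf⟩
    exact mem_closure_of_isAffine hf
  · rw [Subgroup.closure_le]
    rintro A (rfl | rfl)
    · exact ⟨homeoST, isAffine_homeoST⟩
    · exact ⟨homeoTST, isAffine_homeoTST⟩

/-! ### The zero-holonomy subspace -/

section Periods
variable {p : C(mutetrahedron.Surface, Fin 2 → UnitAddCircle)} {k : Fin 2}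

lemma periods_sigma (H : HasSides (fun γ => displacement (p.comp γ) k) b l) (i : Fin 24) :
    periods p (sigma i) k = mutetrahedron.sigmaValue b l i := by
  rw [sigma, periods_loopClass]
  exact pathCocycle_sigmaCurve H i

lemma periods_zeta (H : HasSides (fun γ => displacement (p.comp γ) k) b l) (i : Fin 24) :
    periods p (zeta i) k = mutetrahedron.zetaValue b l i := by
  rw [zeta, periods_loopClass]
  exact pathCocycle_zetaCurve H i

/-- The classes `Σ_k` and `Z_k`, where `k` runs over `1, 3, 4, 6`. -/
noncomputable def basisClass : Fin 4 ⊕ Fin 4 → H₁ mutetrahedron.Surface :=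
  Sum.elim (fun k => sigma (basisIndex k) - sigma 8) (fun k => zeta (basisIndex k) - zeta 8)

lemma periods_basisClass (H : HasSides (fun γ => displacement (p.comp γ) k) b l)
    (j : Fin 4 ⊕ Fin 4) : periods p (basisClass j) k = curveValue b l j := by
  rcases j with j | j
  · simp only [basisClass, curveValue, Sum.elim_inl, map_sub, Pi.sub_apply, periods_sigma H]
  · simp only [basisClass, curveValue, Sum.elim_inr, map_sub, Pi.sub_apply, periods_zeta H]

end Periods

/-- The circle-valued map given by a dual cocycle. -/
noncomputable def dualMap (j : Fin 4 ⊕ Fin 4) : C(mutetrahedron.Surface, Fin 2 → UnitAddCircle) :=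
  mutetrahedron.cellMap (dualBottom j) (dualLeft j) (dual_relation j)

/-- Integration of a dual cocycle. -/
noncomputable def dualPeriod (j : Fin 4 ⊕ Fin 4) : H₁ mutetrahedron.Surface →ₗ[ℝ] ℝ :=
  LinearMap.proj 0 ∘ₗ periods (dualMap j)

lemma curveValue_intCast (b l : Fin 24 → ℤ) (k : Fin 4 ⊕ Fin 4) :
    curveValue (fun i => (b i : ℝ)) (fun i => (l i : ℝ)) k = (curveValue b l k : ℤ) := by
  rcases k with k | k <;> simp [curveValue, Origami.sigmaValue, Origami.zetaValue]

lemma dualPeriod_basisClass (j k : Fin 4 ⊕ Fin 4) :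
    dualPeriod j (basisClass k) = if j = k then 2 else 0 := by
  refine (periods_basisClass (hasSides_cellMap _ _ (dual_relation j)) k).trans ?_
  rw [curveValue_intCast, curveValue_dual]
  split_ifs <;> simp

lemma dualPeriod_homeoST (j k : Fin 4 ⊕ Fin 4) :
    dualPeriod j (H₁map (homeoST : C(mutetrahedron.Surface, mutetrahedron.Surface))
      (basisClass k)) = 2 * intST j k := by
  refine (congrFun (periods_comp _ _ _) 0).trans ((periods_basisClass
    (hasSides_homeoST (hasSides_cellMap _ _ (dual_relation j))) k).trans ?_)
  have h : bottomST (fun i => (dualBottom j i : ℝ)) (fun i => (dualLeft j i : ℝ)) =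
      fun i => ((bottomST (dualBottom j) (dualLeft j) i : ℤ) : ℝ) := by
    ext i; simp [bottomST]
  have h' : leftST (fun i => (dualBottom j i : ℝ)) (fun i => (dualLeft j i : ℝ)) =
      fun i => ((leftST (dualBottom j) (dualLeft j) i : ℤ) : ℝ) := by
    ext i; simp [leftST, bottomST]
  rw [h, h', curveValue_intCast, curveValue_dual_ST]
  push_cast
  rfl

lemma dualPeriod_homeoTST (j k : Fin 4 ⊕ Fin 4) :
    dualPeriod j (H₁map (homeoTST : C(mutetrahedron.Surface, mutetrahedron.Surface))
      (basisClass k)) = 2 * intTST j k := by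
  refine (congrFun (periods_comp _ _ _) 0).trans ((periods_basisClass
    (hasSides_homeoTST (hasSides_cellMap _ _ (dual_relation j))) k).trans ?_)
  have h : bottomTST (fun i => (dualBottom j i : ℝ)) (fun i => (dualLeft j i : ℝ)) =
      fun i => ((bottomTST (dualBottom j) (dualLeft j) i : ℤ) : ℝ) := by
    ext i; simp [bottomTST, leftTSTAux]
  have h' : leftTST (fun i => (dualBottom j i : ℝ)) (fun i => (dualLeft j i : ℝ)) =
      fun i => ((leftTST (dualBottom j) (dualLeft j) i : ℤ) : ℝ) := by
    ext i; simp [leftTST, bottomTST, leftTSTAux]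
  rw [h, h', curveValue_intCast, curveValue_dual_TST]
  push_cast
  rfl

lemma holonomy_sigma (i : Fin 24) : mutetrahedron.holonomy (sigma i) = ![2, 2] := by
  rw [← displacement_sigmaCurve i]
  exact periods_loopClass _ _

lemma holonomy_zeta (i : Fin 24) : mutetrahedron.holonomy (zeta i) = ![-4, 2] := by
  rw [← displacement_zetaCurve i]
  exact periods_loopClass _ _

lemma basisClass_mem (k : Fin 4 ⊕ Fin 4) : basisClass k ∈ mutetrahedron.zeroHolonomy := by
  rcases k with k | k
  · exact LinearMap.mem_ker.mpr (by
      rw [basisClass, Sum.elim_inl, map_sub, holonomy_sigma, holonomy_sigma, sub_self])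
  · exact LinearMap.mem_ker.mpr (by
      rw [basisClass, Sum.elim_inr, map_sub, holonomy_zeta, holonomy_zeta, sub_self])

/-- The ten classes `σ_i`, `ζ_i` with `i = 1, 3, 4, 6, 8` span first homology: a functional that
vanishes on them is integration of an exact path cocycle. -/
lemma functional_eq_zero (ℓ : H₁ mutetrahedron.Surface →ₗ[ℝ] ℝ)
    (hσ : ∀ k, ℓ (sigma (basisIndex k)) = 0) (hσ8 : ℓ (sigma 8) = 0)
    (hζ : ∀ k, ℓ (zeta (basisIndex k)) = 0) (hζ8 : ℓ (zeta 8) = 0) : ℓ = 0 := by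
  obtain ⟨c, hc, hloop, hzero⟩ := exists_pathCocycle ℓ
  obtain ⟨b, hb⟩ : ∃ b : Fin 24 → ℝ, ∀ i, c (mutetrahedron.bottomSide i) = b i :=
    ⟨_, fun _ => rfl⟩
  obtain ⟨l, hl⟩ : ∃ l : Fin 24 → ℝ, ∀ i, c (mutetrahedron.leftSide i) = l i :=
    ⟨_, fun _ => rfl⟩
  have H : HasSides c b l := ⟨hc, hb, hl⟩
  have hs : ∀ i, ℓ (sigma i) = mutetrahedron.sigmaValue b l i := fun i =>
    (hloop _ _).trans (pathCocycle_sigmaCurve H i)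
  have hz : ∀ i, ℓ (zeta i) = mutetrahedron.zetaValue b l i := fun i =>
    (hloop _ _).trans (pathCocycle_zetaCurve H i)
  obtain ⟨u, hub, hul⟩ := exists_coboundary b l H.relation
    (fun k => (hs (basisIndex k)).symm.trans (hσ k)) ((hs 8).symm.trans hσ8)
    (fun k => (hz (basisIndex k)).symm.trans (hζ k)) ((hz 8).symm.trans hζ8)
  obtain ⟨F, hF⟩ := exists_primitive hc u (fun i => (hb i).trans (hub i))
    (fun i => (hl i).trans (hul i))
  exact hzero F hF

/-- A class with zero holonomy is determined by its eight dual periods. -/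
lemma eq_zero_of_dualPeriod {y : H₁ mutetrahedron.Surface} (hy : y ∈ mutetrahedron.zeroHolonomy)
    (hd : ∀ j, dualPeriod j y = 0) : y = 0 := by
  refine (Module.forall_dual_apply_eq_zero_iff ℝ y).mp fun ℓ => ?_
  -- subtract from `ℓ` a combination of the dual periods and of the two coordinates of the holonomy
  -- to obtain a functional that vanishes on the ten generators
  let H0 : H₁ mutetrahedron.Surface →ₗ[ℝ] ℝ := LinearMap.proj 0 ∘ₗ mutetrahedron.holonomy
  let H1 : H₁ mutetrahedron.Surface →ₗ[ℝ] ℝ := LinearMap.proj 1 ∘ₗ mutetrahedron.holonomy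
  let ℓ₁ : H₁ mutetrahedron.Surface →ₗ[ℝ] ℝ := ℓ - ∑ j, (ℓ (basisClass j) / 2) • dualPeriod j
  let ℓ₂ : H₁ mutetrahedron.Surface →ₗ[ℝ] ℝ := ℓ₁ - ((ℓ₁ (sigma 8) - ℓ₁ (zeta 8)) / 6) • H0 -
    ((2 * ℓ₁ (sigma 8) + ℓ₁ (zeta 8)) / 6) • H1
  have h1 : ∀ k, ℓ₁ (basisClass k) = 0 := by
    intro k
    simp [ℓ₁, dualPeriod_basisClass, -Fintype.sum_sum_type]
  have hH0 : ∀ x ∈ mutetrahedron.zeroHolonomy, H0 x = 0 := fun x hx => by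
    have : mutetrahedron.holonomy x = 0 := hx
    simp [H0, this]
  have hH1 : ∀ x ∈ mutetrahedron.zeroHolonomy, H1 x = 0 := fun x hx => by
    have : mutetrahedron.holonomy x = 0 := hx
    simp [H1, this]
  have h2 : ∀ k, ℓ₂ (basisClass k) = 0 := by
    intro k
    simp [ℓ₂, h1, hH0 _ (basisClass_mem k), hH1 _ (basisClass_mem k)]
  have hσ8 : ℓ₂ (sigma 8) = 0 := by
    simp [ℓ₂, H0, H1, holonomy_sigma]
    ring
  have hζ8 : ℓ₂ (zeta 8) = 0 := by
    simp [ℓ₂, H0, H1, holonomy_zeta]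
    ring
  have h0 : ℓ₂ = 0 := by
    refine functional_eq_zero ℓ₂ (fun k => ?_) hσ8 (fun k => ?_) hζ8
    · have h := h2 (Sum.inl k)
      rw [basisClass, Sum.elim_inl, map_sub, hσ8, sub_zero] at h
      exact h
    · have h := h2 (Sum.inr k)
      rw [basisClass, Sum.elim_inr, map_sub, hζ8, sub_zero] at h
      exact h
  have h3 := LinearMap.congr_fun h0 y
  simpa [ℓ₂, ℓ₁, hH0 y hy, hH1 y hy, hd, -Fintype.sum_sum_type] using h3

lemma linearIndependent_basisClass : LinearIndependent ℝ
    (fun k => (⟨basisClass k, basisClass_mem k⟩ : mutetrahedron.zeroHolonomy)) := by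
  rw [Fintype.linearIndependent_iff]
  intro g hg k
  have h := congrArg (fun x : mutetrahedron.zeroHolonomy => dualPeriod k x) hg
  simpa [dualPeriod_basisClass, -Fintype.sum_sum_type] using h

lemma eq_sum_basisClass {x : H₁ mutetrahedron.Surface} (hx : x ∈ mutetrahedron.zeroHolonomy) :
    x = ∑ k, (dualPeriod k x / 2) • basisClass k := by
  rw [← sub_eq_zero]
  refine eq_zero_of_dualPeriod (sub_mem hx (Submodule.sum_mem _ fun k _ =>
    Submodule.smul_mem _ _ (basisClass_mem k))) fun j => ?_
  simp [dualPeriod_basisClass, -Fintype.sum_sum_type]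

/-- The basis `Σ_1, Σ_3, Σ_4, Σ_6, Z_1, Z_3, Z_4, Z_6` of the zero-holonomy subspace. -/
noncomputable def zeroBasis : Module.Basis (Fin 4 ⊕ Fin 4) ℝ mutetrahedron.zeroHolonomy :=
  Module.Basis.mk linearIndependent_basisClass (by
    rintro ⟨x, hx⟩ -
    have h : (⟨x, hx⟩ : mutetrahedron.zeroHolonomy) =
        ∑ k, (dualPeriod k x / 2) • ⟨basisClass k, basisClass_mem k⟩ :=
      Subtype.ext ((eq_sum_basisClass hx).trans (by simp [-Fintype.sum_sum_type]))
    rw [h]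
    exact Submodule.sum_mem _ fun k _ =>
      Submodule.smul_mem _ _ (Submodule.subset_span ⟨k, rfl⟩))

lemma coe_zeroBasis (k : Fin 4 ⊕ Fin 4) :
    (zeroBasis k : H₁ mutetrahedron.Surface) = basisClass k := by
  rw [zeroBasis, Module.Basis.mk_apply]

/-- The coordinates of a class with zero holonomy are half its dual periods. -/
lemma zeroBasis_repr (x : mutetrahedron.zeroHolonomy) (j : Fin 4 ⊕ Fin 4) :
    zeroBasis.repr x j = dualPeriod j x / 2 := by
  have h : x = ∑ k, (dualPeriod k x / 2) • zeroBasis k :=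
    Subtype.ext ((eq_sum_basisClass x.2).trans (by simp [coe_zeroBasis, -Fintype.sum_sum_type]))
  conv_lhs => rw [h]
  rw [Module.Basis.repr_sum_self]

/-- The affine homeomorphism with derivative `S⁻¹T`, as an element of the affine group. -/
noncomputable def affST : mutetrahedron.affineGroup := ⟨homeoST, _, isAffine_homeoST⟩

/-- The affine homeomorphism with derivative `TST⁻¹`, as an element of the affine group. -/
noncomputable def affTST : mutetrahedron.affineGroup := ⟨homeoTST, _, isAffine_homeoTST⟩

lemma toMatrix_alpha_affST :
    LinearMap.toMatrix zeroBasis zeroBasis (mutetrahedron.alpha affST).1 = alphaST := by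
  ext j k
  rw [LinearMap.toMatrix_apply, zeroBasis_repr, coe_alpha, coe_zeroBasis]
  erw [dualPeriod_homeoST]
  rw [alphaST_eq, Matrix.map_apply]
  ring

lemma toMatrix_alpha_affTST :
    LinearMap.toMatrix zeroBasis zeroBasis (mutetrahedron.alpha affTST).1 = alphaTST := by
  ext j k
  rw [LinearMap.toMatrix_apply, zeroBasis_repr, coe_alpha, coe_zeroBasis]
  erw [dualPeriod_homeoTST]
  rw [alphaTST_eq, Matrix.map_apply]
  ring

/-! ### The Kontsevich–Zorich monodromy group -/

/-- Every matrix generated by `S⁻¹T` and `TST⁻¹` is the derivative of a word in the two affine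
homeomorphisms. -/
lemma exists_word {A : SpecialLinearGroup (Fin 2) ℝ}
    (hA : A ∈ Subgroup.closure {matS⁻¹ * matT, matT * matS * matT⁻¹}) :
    ∃ g ∈ Subgroup.closure {affST, affTST}, mutetrahedron.IsAffine g.1 A := by
  induction hA using Subgroup.closure_induction with
  | mem A hA =>
    rcases hA with rfl | rfl
    · exact ⟨affST, Subgroup.subset_closure (by simp), isAffine_homeoST⟩
    · exact ⟨affTST, Subgroup.subset_closure (by simp), isAffine_homeoTST⟩
  | one => exact ⟨1, one_mem _, mutetrahedron.isAffine_id⟩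
  | mul A B _ _ hA hB =>
    obtain ⟨f, hf, hfA⟩ := hA
    obtain ⟨g, hg, hgB⟩ := hB
    exact ⟨f * g, mul_mem hf hg, hfA.comp hgB g.1.continuous⟩
  | inv A _ hA =>
    obtain ⟨f, hf, hfA⟩ := hA
    exact ⟨f⁻¹, inv_mem hf, hfA.symm (sl_inv_mul_coe A)⟩

theorem kontsevichZorichGroup_eq : mutetrahedron.kontsevichZorichGroup =
    Subgroup.closure {mutetrahedron.alpha affST, mutetrahedron.alpha affTST} ⊔
      (mutetrahedron.automorphismGroup.subgroupOf mutetrahedron.affineGroup).map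
        mutetrahedron.alpha := by
  have hcl : Subgroup.closure {mutetrahedron.alpha affST, mutetrahedron.alpha affTST} =
      (Subgroup.closure {affST, affTST}).map mutetrahedron.alpha := by
    rw [MonoidHom.map_closure, Set.image_pair]
  rw [hcl, ← Subgroup.map_sup, kontsevichZorichGroup, MonoidHom.range_eq_map]
  congr 1
  refine (top_le_iff.mp fun f _ => ?_).symm
  obtain ⟨A, hA⟩ := f.2
  obtain ⟨g, hg, hgA⟩ := exists_word (mem_closure_of_isAffine hA)
  have h1 : mutetrahedron.IsAffine (g⁻¹ * f).1 1 := by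
    have h := (hgA.symm (sl_inv_mul_coe A)).comp hA f.1.continuous
    rwa [sl_inv_mul_coe] at h
  have h2 : g⁻¹ * f ∈ mutetrahedron.automorphismGroup.subgroupOf mutetrahedron.affineGroup :=
    h1.mem_automorphismGroup not_isRegular_eight transitive
  rw [← mul_inv_cancel_left g f]
  exact mul_mem (Subgroup.mem_sup_left hg) (Subgroup.mem_sup_right h2)

end Mutetrahedron
end SquareTiled

theorem mainTheorem4 :
    mutetrahedron.veechGroup = Subgroup.closure {matS⁻¹ * matT, matT * matS * matT⁻¹} ∧
    ∃ b : Module.Basis (Fin 4 ⊕ Fin 4) ℝ mutetrahedron.zeroHolonomy,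
      (∀ k, (b (Sum.inl k) : H₁ mutetrahedron.Surface) = sigma (basisIndex k) - sigma 8) ∧
      (∀ k, (b (Sum.inr k) : H₁ mutetrahedron.Surface) = zeta (basisIndex k) - zeta 8) ∧
      ∃ φ ψ : mutetrahedron.affineGroup,
        mutetrahedron.IsAffine φ.1 (matS⁻¹ * matT).1 ∧
        mutetrahedron.IsAffine ψ.1 (matT * matS * matT⁻¹).1 ∧
        LinearMap.toMatrix b b (mutetrahedron.alpha φ).1 = alphaST ∧
        LinearMap.toMatrix b b (mutetrahedron.alpha ψ).1 = alphaTST ∧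
        mutetrahedron.kontsevichZorichGroup =
          Subgroup.closure {mutetrahedron.alpha φ, mutetrahedron.alpha ψ} ⊔
            (mutetrahedron.automorphismGroup.subgroupOf mutetrahedron.affineGroup).map
              mutetrahedron.alpha :=
  ⟨veechGroup_eq, zeroBasis, fun k => coe_zeroBasis (Sum.inl k), fun k => coe_zeroBasis (Sum.inr k),
    affST, affTST, isAffine_homeoST, isAffine_homeoTST,
    toMatrix_alpha_affST, toMatrix_alpha_affTST,
    kontsevichZorichGroup_eq⟩
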